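/- Let $d\ge 0$ be an integer and $s\ge \frac12$. For $n\ge 0$ and $h>0$, let $\mathcal S_{s,h}(\mathbf R^n)$ be the normed space of all $f\in C^\infty(\mathbf R^n)$ (complex-valued) with $$\|f\|_{\mathcal S_{s,h}}=\sup_{\alpha,\beta\in\mathbf N^n,\,x\in\mathbf R^n}\frac{|x^\beta\partial^\alpha f(x)|}{h^{|\alpha|+|\beta|}(\alpha!\,\beta!)^s}<\infty .$$ The Gelfand–Shilov spaces are $\mathcal S_s(\mathbf R^n)=\bigcup_{h>0}\mathcal S_{s,h}(\mathbf R^n)$, with the (locally convex) inductive limit topology, and $\Sigma_s(\mathbf R^n)=\bigcap_{h>0}\mathcal S_{s,h}(\mathbf R^n)$, with the projective limit topology; both are contained in the Schwartz space $\mathscr S(\mathbf R^n)$. Let $\mathscr S'$, $\mathcal S_s'$, $\Sigma_s'$ be the topological duals of $\mathscr S$, $\mathcal S_s$, $\Sigma_s$, with the strong dual topology. A test function $f$ in any of these spaces is identified with the distribution $\psi\mapsto\int f\psi\,dx$ in the corresponding dual. For $f,\phi\in\mathscr S(\mathbf R^d)$, $t\in\mathbf R$ and $x,\xi\in\mathbf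 R^d$ let $$W_t(f,\phi)(x,\xi)=(2\pi)^{-d/2}\int_{\mathbf R^d}f(x+ty)\,\overline{\phi(x-(1-t)y)}\,e^{-i\langle y,\xi\rangle}\,dy,\qquad W_{\mathrm{BJ}}(f,\phi)(x,\xi)=\int_0^1W_t(f,\phi)(x,\xi)\,dt .$$ Then these integrals converge absolutely, and the following is true. (1) The map $(f,\phi)\mapsto W_{\mathrm{BJ}}(f,\phi)$ is continuous from $\mathscr S(\mathbf R^d)\times\mathscr S(\mathbf R^d)$ to $\mathscr S(\mathbf R^{2d})$, and it restricts to a continuous map from $\mathcal S_s(\mathbf R^d)\times\mathcal S_s(\mathbf R^d)$ to $\mathcal S_s(\mathbf R^{2d})$. (2) The map $(f,\phi)\mapsto W_{\mathrm{BJ}}(f,\phi)$ from $\mathcal S_s(\mathbf R^d)\times\mathcal S_s(\mathbf R^d)$ to $\mathcal S_s(\mathbf R^{2d})$ extends uniquely to a continuous map from $\mathcal S_s'(\mathbf R^d)\times\mathcal S_s'(\mathbf R^d)$ to $\mathcal S_s'(\mathbf R^{2d})$, and it extends uniquely to a continuous map from $\mathscr S'(\mathbf R^d)\times\mathscr S'(\mathbf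 R^d)$ to $\mathscr S'(\mathbf R^{2d})$. If $s>\frac12$, then (1) and (2) also hold with $\Sigma_s$ and $\Sigma_s'$ in place of $\mathcal S_s$ and $\mathcal S_s'$, respectively. -/

import Mathlib

open MeasureTheory SchwartzMap LineDeriv
open scoped SchwartzMap ComplexConjugate

noncomputable section

/-! ### Gelfand-Shilov spaces -/

namespace GelfandShilov

/-- The Schwartz space `𝒮(ℝⁿ)` of complex-valued functions. -/
abbrev Sch (n : ℕ) : Type := 𝓢(EuclideanSpace ℝ (Fin n), ℂ)

/-- The partial derivative `∂^α = ∂₁^{α₁} ⋯ ∂ₙ^{αₙ}` for a multi-index `α ∈ ℕⁿ`. -/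
def multiDeriv {n : ℕ} (α : Fin n → ℕ) : Sch n →L[ℂ] Sch n :=
  ((List.finRange n).map fun i =>
    (lineDerivOpCLM ℂ (Sch n) (EuclideanSpace.single i (1 : ℝ)) : Sch n →L[ℂ] Sch n) ^ α i).prod

/-- The quantity `|x^β ∂^α f(x)| / (h^{|α|+|β|} (α! β!)^s)`. -/
def ratio {n : ℕ} (s h : ℝ) (α β : Fin n → ℕ) (x : EuclideanSpace ℝ (Fin n)) (f : Sch n) : ℝ :=
  |∏ i, x i ^ β i| * ‖multiDeriv α f x‖ /
    (h ^ ((∑ i, α i) + ∑ i, β i) * (((∏ i, (α i).factorial) * ∏ i, (β i).factorial : ℕ) : ℝ) ^ s)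

/-- The index set of all `(α, β, x)`, with multi-indices `α, β ∈ ℕⁿ` and a point `x ∈ ℝⁿ`. -/
abbrev Idx (n : ℕ) : Type := (Fin n → ℕ) × (Fin n → ℕ) × EuclideanSpace ℝ (Fin n)

/-- All the values over which the supremum in the norm of `𝒮_{s,h}(ℝⁿ)` is taken. -/
def ratios {n : ℕ} (s h : ℝ) (f : Sch n) (a : Idx n) : ℝ := ratio s h a.1 a.2.1 a.2.2 f

section helpers

variable {n : ℕ} {s : ℝ}

theorem denom_pos {h : ℝ} (hh : 0 < h) (α β : Fin n → ℕ) :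
    0 < h ^ ((∑ i, α i) + ∑ i, β i) * (((∏ i, (α i).factorial) * ∏ i, (β i).factorial : ℕ) : ℝ) ^ s := by
  have h1 : 0 < (∏ i, (α i).factorial) * ∏ i, (β i).factorial :=
    Nat.mul_pos (Finset.prod_pos fun i _ => Nat.factorial_pos _)
      (Finset.prod_pos fun i _ => Nat.factorial_pos _)
  have h2 : (0 : ℝ) < (((∏ i, (α i).factorial) * ∏ i, (β i).factorial : ℕ) : ℝ) := by exact_mod_cast h1
  exact mul_pos (pow_pos hh _) (Real.rpow_pos_of_pos h2 _)

theorem ratios_nonneg {h : ℝ} (hh : 0 < h) (f : Sch n) (a : Idx n) : 0 ≤ ratios s h f a :=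
  div_nonneg (by positivity) (denom_pos hh _ _).le

theorem ratios_zero (h : ℝ) (a : Idx n) : ratios s h (0 : Sch n) a = 0 := by
  simp [ratios, ratio]

theorem ratios_add_le {h : ℝ} (hh : 0 < h) (f g : Sch n) (a : Idx n) :
    ratios s h (f + g) a ≤ ratios s h f a + ratios s h g a := by
  simp only [ratios, ratio, map_add, ← add_div, ← mul_add]
  refine div_le_div_of_nonneg_right ?_ (denom_pos hh _ _).le
  exact mul_le_mul_of_nonneg_left (norm_add_le _ _) (abs_nonneg _)

theorem ratios_smul (h : ℝ) (c : ℂ) (f : Sch n) (a : Idx n) :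
    ratios s h (c • f) a = ‖c‖ * ratios s h f a := by
  simp only [ratios, ratio, map_smul, smul_apply, norm_smul]
  ring

theorem ratios_anti {h k : ℝ} (hh : 0 < h) (hk : h ≤ k) (f : Sch n) (a : Idx n) :
    ratios s k f a ≤ ratios s h f a := by
  refine div_le_div_of_nonneg_left (by positivity) (denom_pos hh _ _) ?_
  exact mul_le_mul_of_nonneg_right (pow_le_pow_left₀ hh.le hk _)
    (Real.rpow_nonneg (Nat.cast_nonneg _) _)

theorem ratios_zero_idx (h : ℝ) (f : Sch n) (x : EuclideanSpace ℝ (Fin n)) :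
    ratios s h f (0, 0, x) = ‖f x‖ := by
  have : multiDeriv (0 : Fin n → ℕ) f = f := by simp [multiDeriv]
  simp [ratios, ratio, this]

end helpers

/-! #### The spaces `𝒮_{s,h}` -/

/-- The set `𝒮_{s,h}(ℝⁿ)` of all `f` for which
`‖f‖_{s,h} = sup_{α,β,x} |x^β ∂^α f(x)| / (h^{|α|+|β|} (α! β!)^s)` is finite. (Such functions are
automatically Schwartz functions.) -/
def stepSubmodule (n : ℕ) (s : ℝ) (h : Set.Ioi (0 : ℝ)) : Submodule ℂ (Sch n) where
  carrier := {f | BddAbove (Set.range (ratios s h f))}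
  zero_mem' := ⟨0, by rintro _ ⟨a, rfl⟩; exact (ratios_zero _ a).le⟩
  add_mem' := by
    rintro f g ⟨A, hA⟩ ⟨B, hB⟩
    refine ⟨A + B, ?_⟩
    rintro _ ⟨a, rfl⟩
    exact (ratios_add_le h.2 f g a).trans (add_le_add (hA ⟨a, rfl⟩) (hB ⟨a, rfl⟩))
  smul_mem' := by
    rintro c f ⟨A, hA⟩
    refine ⟨‖c‖ * A, ?_⟩
    rintro _ ⟨a, rfl⟩
    rw [ratios_smul]
    exact mul_le_mul_of_nonneg_left (hA ⟨a, rfl⟩) (norm_nonneg c)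

/-- The space `𝒮_{s,h}(ℝⁿ)`, a normed space below. -/
def Step (n : ℕ) (s : ℝ) (h : Set.Ioi (0 : ℝ)) : Type := stepSubmodule n s h

namespace Step

variable {n : ℕ} {s : ℝ} {h : Set.Ioi (0 : ℝ)}

instance : AddCommGroup (Step n s h) := inferInstanceAs (AddCommGroup (stepSubmodule n s h))
instance : Module ℂ (Step n s h) := inferInstanceAs (Module ℂ (stepSubmodule n s h))

/-- The inclusion `𝒮_{s,h}(ℝⁿ) ⊆ 𝒮(ℝⁿ)`. -/
def toSch : Step n s h →ₗ[ℂ] Sch n := (stepSubmodule n s h).subtype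

theorem bdd (f : Step n s h) : BddAbove (Set.range (ratios s h (toSch f))) := f.2

/-- The norm `‖f‖_{s,h} = sup_{α,β,x} |x^β ∂^α f(x)| / (h^{|α|+|β|} (α! β!)^s)`. -/
def gsNorm (f : Step n s h) : ℝ := ⨆ a, ratios s h (toSch f) a

theorem le_gsNorm (f : Step n s h) (a : Idx n) : ratios s h (toSch f) a ≤ gsNorm f :=
  le_ciSup (bdd f) a

theorem norm_apply_le_gsNorm (f : Step n s h) (x : EuclideanSpace ℝ (Fin n)) :
    ‖toSch f x‖ ≤ gsNorm f := by
  rw [← ratios_zero_idx (s := s) h (toSch f) x]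
  exact le_gsNorm f _

instance : NormedAddCommGroup (Step n s h) :=
  AddGroupNorm.toNormedAddCommGroup
    { toFun := gsNorm
      map_zero' := by simp [gsNorm, ratios_zero]
      add_le' := fun f g => by
        refine ciSup_le fun a => ?_
        rw [map_add]
        exact (ratios_add_le h.2 _ _ a).trans (add_le_add (le_gsNorm f a) (le_gsNorm g a))
      neg' := fun f => by
        have : ∀ a, ratios s h (toSch (-f)) a = ratios s h (toSch f) a := fun a => by
          have := ratios_smul (s := s) h (-1) (toSch f) a
          simpa using this
        simp only [gsNorm, this]
      eq_zero_of_map_eq_zero' := fun f hf => by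
        refine Subtype.ext (SchwartzMap.ext fun x => ?_)
        exact norm_le_zero_iff.mp ((norm_apply_le_gsNorm f x).trans hf.le) }

theorem norm_def (f : Step n s h) : ‖f‖ = ⨆ a, ratios s h (toSch f) a := rfl

instance : NormedSpace ℂ (Step n s h) where
  norm_smul_le c f := by
    simp only [norm_def, map_smul, ratios_smul]
    rw [Real.mul_iSup_of_nonneg (norm_nonneg c)]

end Step

/-! #### The spaces `𝒮_s` (inductive limit) -/

/-- The set `𝒮_s(ℝⁿ) = ⋃_{h > 0} 𝒮_{s,h}(ℝⁿ)`. -/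
def rouSubmodule (n : ℕ) (s : ℝ) : Submodule ℂ (Sch n) where
  carrier := {f | ∃ h : Set.Ioi (0 : ℝ), f ∈ stepSubmodule n s h}
  zero_mem' := ⟨⟨1, Set.mem_Ioi.2 one_pos⟩, zero_mem _⟩
  add_mem' := by
    have key : ∀ (f : Sch n) (h k : Set.Ioi (0 : ℝ)), h ≤ k →
        f ∈ stepSubmodule n s h → f ∈ stepSubmodule n s k := by
      rintro f h k hk ⟨A, hA⟩
      refine ⟨A, ?_⟩
      rintro _ ⟨a, rfl⟩
      exact (ratios_anti h.2 hk f a).trans (hA ⟨a, rfl⟩)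
    rintro f g ⟨h, hf⟩ ⟨k, hg⟩
    exact ⟨max h k, add_mem (key f h _ (le_max_left _ _) hf) (key g k _ (le_max_right _ _) hg)⟩
  smul_mem' := by
    rintro c f ⟨h, hf⟩
    exact ⟨h, Submodule.smul_mem _ c hf⟩

/-- The Gelfand-Shilov space `𝒮_s(ℝⁿ)` of Roumieu type. -/
def Rou (n : ℕ) (s : ℝ) : Type := rouSubmodule n s

namespace Rou

variable {n : ℕ} {s : ℝ}

instance : AddCommGroup (Rou n s) := inferInstanceAs (AddCommGroup (rouSubmodule n s))
instance : Module ℂ (Rou n s) := inferInstanceAs (Module ℂ (rouSubmodule n s))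

/-- The inclusion `𝒮_s(ℝⁿ) ⊆ 𝒮(ℝⁿ)`. -/
def toSch : Rou n s →ₗ[ℂ] Sch n := (rouSubmodule n s).subtype

/-- The inclusion `𝒮_{s,h}(ℝⁿ) ⊆ 𝒮_s(ℝⁿ)`. -/
def ofStep (h : Set.Ioi (0 : ℝ)) : Step n s h →ₗ[ℂ] Rou n s :=
  Submodule.inclusion (p := stepSubmodule n s h) (p' := rouSubmodule n s)
    fun f hf => show ∃ h, f ∈ stepSubmodule n s h from ⟨h, hf⟩

/-- The topology of `𝒮_s(ℝⁿ)` as the inductive limit of the spaces `𝒮_{s,h}(ℝⁿ)`, `h > 0`: the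
finest locally convex topology for which all the inclusions of `𝒮_{s,h}(ℝⁿ)` are continuous. -/
instance : TopologicalSpace (Rou n s) :=
  sInf {t : TopologicalSpace (Rou n s) |
    (∀ h, @Continuous (Step n s h) (Rou n s) _ t (ofStep h)) ∧
    @IsTopologicalAddGroup (Rou n s) t _ ∧
    @ContinuousSMul ℂ (Rou n s) _ _ t ∧
    @LocallyConvexSpace ℝ (Rou n s) _ _ _ _ t}

instance : IsTopologicalAddGroup (Rou n s) :=
  topologicalAddGroup_sInf fun _ ht => ht.2.1

instance : ContinuousSMul ℂ (Rou n s) :=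
  continuousSMul_sInf fun _ ht => ht.2.2.1

instance : LocallyConvexSpace ℝ (Rou n s) :=
  LocallyConvexSpace.sInf fun _ ht => ht.2.2.2

theorem continuous_ofStep (h : Set.Ioi (0 : ℝ)) :
    Continuous (ofStep h : Step n s h → Rou n s) :=
  continuous_sInf_rng.2 fun _ ht => ht.1 h

/-- The universal property of the inductive limit, for linear functionals. -/
theorem continuous_of_step (ℓ : Rou n s →ₗ[ℂ] ℂ)
    (hℓ : ∀ h, Continuous fun f : Step n s h => ℓ (ofStep h f)) : Continuous ℓ := by
  rw [continuous_iff_le_induced]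
  refine sInf_le ⟨fun h => continuous_induced_rng.2 (hℓ h), topologicalAddGroup_induced ℓ,
    continuousSMul_induced ℓ, ?_⟩
  exact LocallyConvexSpace.induced (𝕜 := ℝ) (ℓ.restrictScalars ℝ)

end Rou

/-! #### The spaces `Σ_s` (projective limit) -/

/-- The set `Σ_s(ℝⁿ) = ⋂_{h > 0} 𝒮_{s,h}(ℝⁿ)`. -/
def beuSubmodule (n : ℕ) (s : ℝ) : Submodule ℂ (Sch n) :=
  ⨅ h : Set.Ioi (0 : ℝ), stepSubmodule n s h

/-- The Gelfand-Shilov space `Σ_s(ℝⁿ)` of Beurling type. -/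
def Beu (n : ℕ) (s : ℝ) : Type := beuSubmodule n s

namespace Beu

variable {n : ℕ} {s : ℝ}

instance : AddCommGroup (Beu n s) := inferInstanceAs (AddCommGroup (beuSubmodule n s))
instance : Module ℂ (Beu n s) := inferInstanceAs (Module ℂ (beuSubmodule n s))

/-- The inclusion `Σ_s(ℝⁿ) ⊆ 𝒮(ℝⁿ)`. -/
def toSch : Beu n s →ₗ[ℂ] Sch n := (beuSubmodule n s).subtype

/-- The inclusion `Σ_s(ℝⁿ) ⊆ 𝒮_{s,h}(ℝⁿ)`. -/
def toStep (h : Set.Ioi (0 : ℝ)) : Beu n s →ₗ[ℂ] Step n s h :=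
  Submodule.inclusion (p := beuSubmodule n s) (p' := stepSubmodule n s h) (iInf_le _ h)

/-- The topology of `Σ_s(ℝⁿ)` as the projective limit of the spaces `𝒮_{s,h}(ℝⁿ)`, `h > 0`: the
topology defined by the norms `‖·‖_{s,h}`. -/
instance : TopologicalSpace (Beu n s) :=
  ⨅ h : Set.Ioi (0 : ℝ), TopologicalSpace.induced (toStep h) inferInstance

instance : IsTopologicalAddGroup (Beu n s) :=
  topologicalAddGroup_iInf fun h => topologicalAddGroup_induced (toStep h)

instance : ContinuousSMul ℂ (Beu n s) :=
  continuousSMul_iInf fun h => continuousSMul_induced (toStep h)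

theorem continuous_toStep (h : Set.Ioi (0 : ℝ)) :
    Continuous (toStep h : Beu n s → Step n s h) :=
  continuous_iInf_dom continuous_induced_dom

end Beu

/-! ### Test functions as distributions

The distribution spaces `𝒮'`, `𝒮_s'`, `Σ_s'` are `StrongDual ℂ E` for `E = 𝒮, 𝒮_s, Σ_s`: all the
continuous linear functionals on `E`, with the strong dual topology (uniform convergence on the
bounded subsets of `E`). A test function `f` is the distribution `ψ ↦ ∫ f(x) ψ(x) dx`. -/

/-- The embedding `𝒮(ℝⁿ) → 𝒮'(ℝⁿ)`. -/
def schDist {n : ℕ} (f : Sch n) : StrongDual ℂ (Sch n) :=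
  (SchwartzMap.integralCLM ℂ volume).comp (SchwartzMap.pairing (ContinuousLinearMap.mul ℂ ℂ) f)

theorem schDist_apply {n : ℕ} (f ψ : Sch n) : schDist f ψ = ∫ x, f x * ψ x := by
  simp [schDist, SchwartzMap.integralCLM_apply]

theorem continuous_step_pairing {n : ℕ} {s : ℝ} (h : Set.Ioi (0 : ℝ)) (f : Sch n) :
    Continuous fun ψ : Step n s h => schDist f (Step.toSch ψ) := by
  refine AddMonoidHomClass.continuous_of_bound
    ((schDist f).toLinearMap.comp (Step.toSch (n := n) (s := s) (h := h))) (∫ x, ‖f x‖) ?_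
  intro ψ
  change ‖schDist f (Step.toSch ψ)‖ ≤ _
  rw [schDist_apply, ← integral_mul_const]
  refine norm_integral_le_of_norm_le (f.integrable.norm.mul_const _) (Filter.Eventually.of_forall ?_)
  intro x
  rw [norm_mul]
  exact mul_le_mul_of_nonneg_left (Step.norm_apply_le_gsNorm ψ x) (norm_nonneg _)

/-- The embedding `𝒮_s(ℝⁿ) → 𝒮_s'(ℝⁿ)`. -/
def rouDist {n : ℕ} {s : ℝ} (f : Rou n s) : StrongDual ℂ (Rou n s) where
  toLinearMap := (schDist (Rou.toSch f)).toLinearMap.comp Rou.toSch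
  cont := Rou.continuous_of_step _ fun h => continuous_step_pairing h (Rou.toSch f)

theorem rouDist_apply {n : ℕ} {s : ℝ} (f ψ : Rou n s) :
    rouDist f ψ = ∫ x, Rou.toSch f x * Rou.toSch ψ x := schDist_apply _ _

/-- The embedding `Σ_s(ℝⁿ) → Σ_s'(ℝⁿ)`. -/
def beuDist {n : ℕ} {s : ℝ} (f : Beu n s) : StrongDual ℂ (Beu n s) where
  toLinearMap := (schDist (Beu.toSch f)).toLinearMap.comp Beu.toSch
  cont := by
    have h := (continuous_step_pairing (s := s) ⟨1, Set.mem_Ioi.2 one_pos⟩ (Beu.toSch f)).comp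
      (Beu.continuous_toStep ⟨1, Set.mem_Ioi.2 one_pos⟩)
    exact h

theorem beuDist_apply {n : ℕ} {s : ℝ} (f ψ : Beu n s) :
    beuDist f ψ = ∫ x, Beu.toSch f x * Beu.toSch ψ x := schDist_apply _ _

end GelfandShilov

/-! ### Wigner distributions and the Born-Jordan distribution -/

namespace BornJordan

/-- The component `x ∈ ℝᵈ` of `z = (x, ξ) ∈ ℝ²ᵈ`. -/
def position {d : ℕ} (z : EuclideanSpace ℝ (Fin (d + d))) : EuclideanSpace ℝ (Fin d) :=
  WithLp.toLp 2 fun i => z (Fin.castAdd d i)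

/-- The component `ξ ∈ ℝᵈ` of `z = (x, ξ) ∈ ℝ²ᵈ`. -/
def frequency {d : ℕ} (z : EuclideanSpace ℝ (Fin (d + d))) : EuclideanSpace ℝ (Fin d) :=
  WithLp.toLp 2 fun i => z (Fin.natAdd d i)

/-- `f(x + t y) \overline{φ(x - (1 - t) y)} e^{-i⟨y, ξ⟩}`, as a function of `y`. -/
def wignerIntegrand {d : ℕ} (t : ℝ) (f φ : EuclideanSpace ℝ (Fin d) → ℂ)
    (x ξ y : EuclideanSpace ℝ (Fin d)) : ℂ :=
  f (x + t • y) * conj (φ (x - (1 - t) • y)) * Complex.exp (-Complex.I * (inner ℝ y ξ : ℝ))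

/-- The `t`-Wigner distribution `W_t(f, φ)(x, ξ) =
(2π)^{-d/2} ∫ f(x + t y) \overline{φ(x - (1 - t) y)} e^{-i⟨y, ξ⟩} dy`. -/
def wigner {d : ℕ} (t : ℝ) (f φ : EuclideanSpace ℝ (Fin d) → ℂ)
    (x ξ : EuclideanSpace ℝ (Fin d)) : ℂ :=
  (((2 * Real.pi) ^ (-(d : ℝ) / 2) : ℝ) : ℂ) * ∫ y, wignerIntegrand t f φ x ξ y

/-- The Born-Jordan distribution `W_BJ(f, φ) = ∫₀¹ W_t(f, φ) dt`. -/
def wignerBJ {d : ℕ} (f φ : EuclideanSpace ℝ (Fin d) → ℂ)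
    (x ξ : EuclideanSpace ℝ (Fin d)) : ℂ :=
  ∫ t in (0 : ℝ)..1, wigner t f φ x ξ

end BornJordan

end

open GelfandShilov BornJordan

open GelfandShilov BornJordan

noncomputable section

/-! All three kinds of test spaces are described by one datum: bounds on words in the operators `xᵢ`
and `∂ᵢ`. For a weight M, `wordBall n M` consists of the f with |w f| ≤ M(|w|) for every word w.
With all weights, these balls and their subsets are the bounded sets of 𝒮; with weights bounded by C
h^m m!^s for some h they give those of 𝒮_s, and for every h those of Σ_s. Such bounds survive the
Fourier transform, which only exchanges letters, and linear substitutions, which cost a factor c^m.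
The price is the passage from the normally ordered operators x^β ∂^α of the definition to arbitrary
words. Applying one more letter to a word of length m creates at most m commutators, each two
letters shorter than the leading term, and the two missing factors of the factorial, raised to the
power s, pay for m exactly because 2s ≥ 1 (`NormallyBounded.norm_word_le`). For Σ_s the strict
inequality makes the cost arbitrarily small.

W_BJ is a composition: the tensor product of f and the conjugate of φ, the average over 0 ≤ t ≤ 1 of
the substitutions A_t(x, y) = (x + ty, x - (1-t)y), and the partial Fourier transform in y. Each
factor respects word balls, so W_BJ maps bounded sets to bounded sets
(`WeightClass.exists_bornJordan_bound`). In the first countable spaces 𝒮 and Σ_s this gives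
continuity. In 𝒮_s it does so because bounds c(i, j) on countably many pairs of steps are dominated
by products C(i) C(j) (`Rou.continuous₂_of_bounded`).

For the duals, A_t preserves volume and the Fourier kernel is symmetric, so ∫ W_BJ(f, φ) ψ = ∫ f(x)
∫ conj φ(y) (Dψ)(x, y) dy dx with D = `bornJordanDual`. The right side makes sense for functionals:
v acts in y for fixed x, and u acts on the resulting test function of x (`slicePairing`,
`dualForm`). Since M(j+k) ≤ M'(j) M'(k) for a suitable M', the result is bounded by the product of
the suprema of |u| and |v| over one word ball (`exists_dualForm_bound`), which yields joint
continuity for the strong topologies.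

Uniqueness is density of test functions in the strong duals (`exists_approx`). Multiplying ψ by
g(η·), with g the Gaussian, and then convolving with a dilate of g changes ψ by η times a bounded
error, and a functional of the regularized ψ is the integral of ψ against a test function. The
Gaussian has word bounds 2^m √(m!), which fit the weights of 𝒮_s for s ≥ 1/2 and those of Σ_s for s
> 1/2. All of this is done once for an abstract `WeightClass` and `IsTestSpace`, and then used for
𝒮, 𝒮_s and Σ_s. -/

namespace GelfandShilov

/-! ### Word bounds and their relation to the Schwartz seminorms -/

section
/-- Euclidean space `ℝⁿ`. -/
abbrev Euc (n : ℕ) : Type := EuclideanSpace ℝ (Fin n)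

/-! ### Words in the operators of multiplication by a coordinate and of partial differentiation -/

/-- Multiplication by the coordinate function `xᵢ`. -/
def coordMul {n : ℕ} (i : Fin n) : Sch n →L[ℂ] Sch n :=
  smulLeftCLM ℂ fun x : Euc n => ((x i : ℝ) : ℂ)

/-- The partial derivative `∂ᵢ`. -/
def pderiv {n : ℕ} (i : Fin n) : Sch n →L[ℂ] Sch n :=
  lineDerivOpCLM ℂ (Sch n) (EuclideanSpace.single i (1 : ℝ))

/-- A letter stands for one of the operators `xᵢ`, `∂ᵢ`. -/
abbrev Letter (n : ℕ) : Type := Fin n ⊕ Fin n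

/-- The operator of a letter. -/
def letter {n : ℕ} : Letter n → Sch n →L[ℂ] Sch n := Sum.elim coordMul pderiv

/-- The operator of a word; the head of the list acts first. -/
def word {n : ℕ} : List (Letter n) → Sch n →L[ℂ] Sch n
  | [] => ContinuousLinearMap.id ℂ _
  | l :: w => (word w).comp (letter l)

/-- The functions `f` with `|w f| ≤ M(|w|)` for every word `w`. -/
def wordBall (n : ℕ) (M : ℕ → ℝ) : Set (Sch n) := {f | ∀ w x, ‖word w f x‖ ≤ M w.length}

variable {n : ℕ}

theorem hasTemperateGrowth_coord (i : Fin n) :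
    Function.HasTemperateGrowth fun x : Euc n => ((x i : ℝ) : ℂ) :=
  (Complex.ofRealCLM.comp (EuclideanSpace.proj i : Euc n →L[ℝ] ℝ)).hasTemperateGrowth

@[simp] theorem coordMul_apply (i : Fin n) (f : Sch n) (x : Euc n) :
    coordMul i f x = (x i : ℂ) * f x := by
  simp [coordMul, smulLeftCLM_apply_apply (hasTemperateGrowth_coord i)]

@[simp] theorem letter_inl (i : Fin n) : letter (Sum.inl i) = coordMul i := rfl
@[simp] theorem letter_inr (i : Fin n) : letter (Sum.inr i) = pderiv i := rfl
@[simp] theorem word_nil (f : Sch n) : word [] f = f := rfl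
@[simp] theorem word_cons (l : Letter n) (w : List (Letter n)) (f : Sch n) :
    word (l :: w) f = word w (letter l f) := rfl

theorem word_append (w v : List (Letter n)) (f : Sch n) : word (w ++ v) f = word v (word w f) := by
  induction w generalizing f with
  | nil => rfl
  | cons l w ih => simp [ih]

theorem wordBall_mono {M N : ℕ → ℝ} (h : ∀ m, M m ≤ N m) : wordBall n M ⊆ wordBall n N :=
  fun _ hf w x => (hf w x).trans (h _)

theorem letter_mem_wordBall {M : ℕ → ℝ} {f : Sch n} (hf : f ∈ wordBall n M) (l : Letter n) :
    letter l f ∈ wordBall n fun m => M (m + 1) :=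
  fun w x => hf (l :: w) x

theorem word_mem_wordBall {M : ℕ → ℝ} {f : Sch n} (hf : f ∈ wordBall n M) (v : List (Letter n)) :
    word v f ∈ wordBall n fun m => M (m + v.length) := fun w x => by
  rw [← word_append]
  simpa [add_comm] using hf (v ++ w) x

theorem norm_le_of_mem_wordBall {M : ℕ → ℝ} {f : Sch n} (hf : f ∈ wordBall n M) (x : Euc n) :
    ‖f x‖ ≤ M 0 := hf [] x

theorem nonneg_of_mem_wordBall {M : ℕ → ℝ} {f : Sch n} (hf : f ∈ wordBall n M) (w : List (Letter n)) :
    0 ≤ M w.length := (norm_nonneg _).trans (hf w 0)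

theorem add_mem_wordBall {M N : ℕ → ℝ} {f g : Sch n} (hf : f ∈ wordBall n M)
    (hg : g ∈ wordBall n N) : f + g ∈ wordBall n fun m => M m + N m := fun w x => by
  rw [map_add]
  exact (norm_add_le _ _).trans (add_le_add (hf w x) (hg w x))

theorem smul_mem_wordBall {M : ℕ → ℝ} {f : Sch n} (hf : f ∈ wordBall n M) (c : ℂ) :
    c • f ∈ wordBall n fun m => ‖c‖ * M m := fun w x => by
  rw [map_smul, smul_apply, norm_smul]
  exact mul_le_mul_of_nonneg_left (hf w x) (norm_nonneg c)

theorem zero_mem_wordBall {M : ℕ → ℝ} (hM : ∀ m, 0 ≤ M m) : (0 : Sch n) ∈ wordBall n M :=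
  fun w x => by simpa using hM _

theorem sum_mem_wordBall {ι : Type*} (s : Finset ι) {M : ι → ℕ → ℝ} {f : ι → Sch n}
    (hf : ∀ i ∈ s, f i ∈ wordBall n (M i)) :
    ∑ i ∈ s, f i ∈ wordBall n fun m => ∑ i ∈ s, M i m := fun w x => by
  rw [map_sum, sum_apply]
  exact norm_sum_le_of_le _ fun i hi => hf i hi w x

/-! ### Total derivatives in terms of partial derivatives -/

/-- The linear form on `ℝⁿ` with the given coefficients. -/
def gradOf (D : Fin n → ℂ) : Euc n →L[ℝ] ℂ :=
  ∑ i, (EuclideanSpace.proj i : Euc n →L[ℝ] ℝ).smulRight (D i)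

theorem gradOf_apply (D : Fin n → ℂ) (v : Euc n) : gradOf D v = ∑ i, (v i : ℂ) * D i := by
  simp [gradOf]

theorem gradOf_single (D : Fin n → ℂ) (i : Fin n) : gradOf D (EuclideanSpace.single i 1) = D i := by
  rw [gradOf_apply, Finset.sum_eq_single i] <;> simp +contextual

theorem eq_gradOf (L : Euc n →L[ℝ] ℂ) : L = gradOf fun i => L (EuclideanSpace.single i 1) := by
  refine ContinuousLinearMap.ext fun v => ?_
  have hv : v = ∑ i, v i • EuclideanSpace.single i (1 : ℝ) := by
    ext j
    simp [Finset.sum_apply, Pi.single_apply]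
  conv_lhs => rw [hv]
  rw [map_sum, gradOf_apply]
  simp

theorem pderiv_eq_fderiv (i : Fin n) (f : Sch n) (x : Euc n) :
    pderiv i f x = fderiv ℝ f x (EuclideanSpace.single i 1) := by
  rw [pderiv, lineDerivOpCLM_apply, lineDerivOp_apply_eq_fderiv]

theorem hasFDerivAt_gradOf (f : Sch n) (x : Euc n) :
    HasFDerivAt f (gradOf fun i => pderiv i f x) x := by
  simp only [pderiv_eq_fderiv]
  rw [← eq_gradOf]
  exact f.differentiableAt.hasFDerivAt

theorem pderiv_eq_of_hasFDerivAt {f : Sch n} {D : Fin n → ℂ} {x : Euc n}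
    (h : HasFDerivAt f (gradOf D) x) (i : Fin n) : pderiv i f x = D i := by
  rw [pderiv_eq_fderiv, h.fderiv, gradOf_single]

theorem norm_coord_le (x : Euc n) (i : Fin n) : |x i| ≤ ‖x‖ := by
  simpa using EuclideanSpace.norm_eq x ▸ PiLp.norm_apply_le x i

theorem norm_le_sum_coord (x : Euc n) : ‖x‖ ≤ ∑ i, |x i| := by
  have hv : x = ∑ i, x i • EuclideanSpace.single i (1 : ℝ) := by
    ext j
    simp [Finset.sum_apply, Pi.single_apply]
  conv_lhs => rw [hv]
  refine (norm_sum_le _ _).trans (Finset.sum_le_sum fun i _ => ?_)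
  simp [norm_smul]

theorem norm_gradOf_le (D : Fin n → ℂ) : ‖gradOf D‖ ≤ ∑ i, ‖D i‖ := by
  refine ContinuousLinearMap.opNorm_le_bound _ (Finset.sum_nonneg fun _ _ => norm_nonneg _) ?_
  intro v
  rw [gradOf_apply, Finset.sum_mul]
  refine norm_sum_le_of_le _ fun i _ => ?_
  rw [norm_mul, mul_comm, Complex.norm_real]
  exact mul_le_mul_of_nonneg_left (norm_coord_le v i) (norm_nonneg _)

/-! ### Construction of Schwartz functions -/

/-- A collection of uniformly bounded families of functions on `ℝⁿ` that is closed under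
multiplication by coordinates and under partial differentiation. -/
structure ClosedFamilies (𝔅 : Set (Set (Euc n → ℂ))) : Prop where
  bound : ∀ F ∈ 𝔅, ∃ C, ∀ G ∈ F, ∀ x, ‖G x‖ ≤ C
  coord : ∀ F ∈ 𝔅, ∀ i : Fin n, ∃ F' ∈ 𝔅, ∀ G ∈ F, (fun x => (x i : ℂ) * G x) ∈ F'
  deriv : ∀ F ∈ 𝔅, ∃ F' : Fin n → Set (Euc n → ℂ), (∀ i, F' i ∈ 𝔅) ∧ ∀ G ∈ F,
    ∃ D : Fin n → Euc n → ℂ, (∀ i, D i ∈ F' i) ∧ ∀ x, HasFDerivAt G (gradOf fun i => D i x) x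

namespace ClosedFamilies

variable {𝔅 : Set (Set (Euc n → ℂ))}

theorem contDiff (h𝔅 : ClosedFamilies 𝔅) (k : ℕ) : ∀ F ∈ 𝔅, ∀ G ∈ F, ContDiff ℝ k G := by
  induction k with
  | zero =>
    intro F hF G hG
    obtain ⟨F', -, h⟩ := h𝔅.deriv F hF
    obtain ⟨D, -, hd⟩ := h G hG
    exact contDiff_zero.2 (continuous_iff_continuousAt.2 fun x => (hd x).continuousAt)
  | succ k ih =>
    intro F hF G hG
    obtain ⟨F', hF', h⟩ := h𝔅.deriv F hF
    obtain ⟨D, hDm, hd⟩ := h G hG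
    rw [Nat.cast_succ, contDiff_succ_iff_fderiv]
    refine ⟨fun x => (hd x).differentiableAt, by simp, ?_⟩
    have : fderiv ℝ G = fun x => gradOf fun i => D i x := funext fun x => (hd x).fderiv
    rw [this]
    unfold gradOf
    refine _root_.ContDiff.sum fun i _ => ?_
    exact contDiff_const.smulRight (ih _ (hF' i) _ (hDm i))

/-- Since |x| ≤ ∑ |xᵢ|, a power of |x| is traded for one multiplication by a coordinate in each
direction, which stays inside 𝔅. -/
theorem decay_zero (h𝔅 : ClosedFamilies 𝔅) (k : ℕ) :
    ∀ F ∈ 𝔅, ∃ C, ∀ G ∈ F, ∀ x, ‖x‖ ^ k * ‖G x‖ ≤ C := by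
  induction k with
  | zero => simpa using h𝔅.bound
  | succ k ih =>
    intro F hF
    choose F' hF' h using h𝔅.coord F hF
    choose C hC using fun i => ih (F' i) (hF' i)
    refine ⟨∑ i, C i, fun G hG x => ?_⟩
    calc ‖x‖ ^ (k + 1) * ‖G x‖ = ‖x‖ * (‖x‖ ^ k * ‖G x‖) := by ring
      _ ≤ (∑ i, |x i|) * (‖x‖ ^ k * ‖G x‖) := by gcongr; exact norm_le_sum_coord x
      _ = ∑ i, ‖x‖ ^ k * ‖(x i : ℂ) * G x‖ := by
        rw [Finset.sum_mul]
        refine Finset.sum_congr rfl fun i _ => ?_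
        rw [norm_mul, Complex.norm_real, Real.norm_eq_abs]
        ring
      _ ≤ ∑ i, C i := Finset.sum_le_sum fun i _ => hC i _ (h i G hG) x

/-- The total derivative of G is the sum of its partial derivatives times coordinate forms of norm
at most 1. One order of differentiation is thus traded for passing to the families F' i. The
constants depend on the family only, which is what makes the comparison of bounded sets possible. -/
theorem decay (h𝔅 : ClosedFamilies 𝔅) (m k : ℕ) :
    ∀ F ∈ 𝔅, ∃ C, ∀ G ∈ F, ∀ x, ‖x‖ ^ k * ‖iteratedFDeriv ℝ m G x‖ ≤ C := by
  induction m with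
  | zero => simpa using h𝔅.decay_zero k
  | succ m ih =>
    intro F hF
    obtain ⟨F', hF', h⟩ := h𝔅.deriv F hF
    choose C hC using fun i => ih (F' i) (hF' i)
    refine ⟨∑ i, C i, fun G hG x => ?_⟩
    obtain ⟨D, hDm, hd⟩ := h G hG
    have hcd : ∀ i, ContDiff ℝ m (D i) := fun i => h𝔅.contDiff m _ (hF' i) _ (hDm i)
    have e : fderiv ℝ G = fun x => ∑ i, ((ContinuousLinearMap.smulRightL ℝ (Euc n) ℂ
        (EuclideanSpace.proj i)) ∘ D i) x := funext fun x => (hd x).fderiv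
    have hcd' : ∀ i, ContDiff ℝ m ((ContinuousLinearMap.smulRightL ℝ (Euc n) ℂ
        (EuclideanSpace.proj i)) ∘ D i) := fun i => (ContinuousLinearMap.contDiff _).comp (hcd i)
    rw [← norm_iteratedFDeriv_fderiv, e, iteratedFDeriv_fun_sum_apply fun i _ => (hcd' i).contDiffAt]
    refine (mul_le_mul_of_nonneg_left (norm_sum_le _ _) (by positivity)).trans ?_
    rw [Finset.mul_sum]
    refine Finset.sum_le_sum fun i _ => le_trans ?_ (hC i _ (hDm i) x)
    gcongr
    refine (ContinuousLinearMap.norm_iteratedFDeriv_comp_left _ (hcd i).contDiffAt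
      le_rfl).trans (mul_le_of_le_one_left (norm_nonneg _) ?_)
    refine ContinuousLinearMap.opNorm_le_bound _ zero_le_one fun c => ?_
    refine ContinuousLinearMap.opNorm_le_bound _ (by positivity) fun v => ?_
    change ‖v i • c‖ ≤ 1 * ‖c‖ * ‖v‖
    rw [norm_smul, one_mul, mul_comm]
    exact mul_le_mul_of_nonneg_left (norm_coord_le v i) (norm_nonneg _)

/-- The members of closed families are Schwartz functions. -/
theorem exists_schwartz (h𝔅 : ClosedFamilies 𝔅) {F : Set (Euc n → ℂ)} (hF : F ∈ 𝔅)
    {G : Euc n → ℂ} (hG : G ∈ F) : ∃ g : Sch n, ∀ x, g x = G x :=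
  ⟨⟨G, contDiff_infty.2 fun k => h𝔅.contDiff k F hF G hG, fun k m => by
    obtain ⟨C, hC⟩ := h𝔅.decay m k F hF
    exact ⟨C, hC G hG⟩⟩, fun _ => rfl⟩

end ClosedFamilies

/-- A set of bounded functions that is closed under multiplication by coordinates and under partial
differentiation consists of Schwartz functions. -/
theorem exists_schwartz_of_closed {𝒜 : Set (Euc n → ℂ)}
    (hb : ∀ G ∈ 𝒜, ∃ C, ∀ x, ‖G x‖ ≤ C)
    (hX : ∀ G ∈ 𝒜, ∀ i : Fin n, (fun x => (x i : ℂ) * G x) ∈ 𝒜)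
    (hD : ∀ G ∈ 𝒜, ∃ D : Fin n → Euc n → ℂ, (∀ i, D i ∈ 𝒜) ∧
      ∀ x, HasFDerivAt G (gradOf fun i => D i x) x)
    {G : Euc n → ℂ} (hG : G ∈ 𝒜) : ∃ g : Sch n, ∀ x, g x = G x := by
  have h𝔅 : ClosedFamilies (singleton '' 𝒜) := by
    refine ⟨?_, ?_, ?_⟩
    · rintro _ ⟨G, hG, rfl⟩
      simpa using hb G hG
    · rintro _ ⟨G, hG, rfl⟩ i
      exact ⟨_, ⟨_, hX G hG i, rfl⟩, by simp⟩
    · rintro _ ⟨G, hG, rfl⟩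
      obtain ⟨D, hDm, hd⟩ := hD G hG
      refine ⟨fun i => {D i}, fun i => ⟨_, hDm i, rfl⟩, ?_⟩
      rintro _ rfl
      exact ⟨D, fun i => rfl, hd⟩
  exact h𝔅.exists_schwartz ⟨G, hG, rfl⟩ rfl

/-- Sets that are bounded in the sense of words are bounded for the Schwartz seminorms. -/
theorem exists_seminorm_bound_of_wordBall (M : ℕ → ℝ) (k m : ℕ) :
    ∃ C, ∀ f ∈ wordBall n M, SchwartzMap.seminorm ℂ k m f ≤ C := by
  -- The word balls themselves form closed families: a letter only shifts the weight by one.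
  have h𝔅 : ClosedFamilies (n := n) (Set.range fun M => (fun f : Sch n => ⇑f) '' wordBall n M) := by
    refine ⟨?_, ?_, ?_⟩
    · rintro _ ⟨M, rfl⟩
      refine ⟨M 0, ?_⟩
      rintro _ ⟨f, hf, rfl⟩ x
      exact norm_le_of_mem_wordBall hf x
    · rintro _ ⟨M, rfl⟩ i
      refine ⟨_, ⟨fun m => M (m + 1), rfl⟩, ?_⟩
      rintro _ ⟨f, hf, rfl⟩
      exact ⟨_, letter_mem_wordBall hf (Sum.inl i), by ext; simp⟩
    · rintro _ ⟨M, rfl⟩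
      refine ⟨_, fun _ => ⟨fun m => M (m + 1), rfl⟩, ?_⟩
      rintro _ ⟨f, hf, rfl⟩
      exact ⟨fun i => pderiv i f, fun i => ⟨_, letter_mem_wordBall hf (Sum.inr i), rfl⟩,
        hasFDerivAt_gradOf f⟩
  obtain ⟨C, hC⟩ := h𝔅.decay m k _ ⟨M, rfl⟩
  refine ⟨max C 0, fun f hf => SchwartzMap.seminorm_le_bound ℂ _ _ _ (le_max_right _ _) fun x => ?_⟩
  exact (hC f ⟨f, hf, rfl⟩ x).trans (le_max_left _ _)

/-- The bound of `(1 + ∑ |xᵢ|) ^ r |f(x)|` in terms of the bounds for words. -/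
def decayConst (n : ℕ) : ℕ → (ℕ → ℝ) → ℝ
  | 0, M => M 0
  | r + 1, M => decayConst n r M + n * decayConst n r fun m => M (m + 1)

/-- A factor 1 + |x| is at most 1 + ∑ |xᵢ|, that is, f itself plus n coordinate letters; this is the
recursion of `decayConst`. -/
theorem decay_of_mem_wordBall (r : ℕ) {M : ℕ → ℝ} {f : Sch n} (hf : f ∈ wordBall n M) (x : Euc n) :
    (1 + ‖x‖) ^ r * ‖f x‖ ≤ decayConst n r M := by
  induction r generalizing f M with
  | zero => simpa [decayConst] using norm_le_of_mem_wordBall hf x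
  | succ r ih =>
    calc (1 + ‖x‖) ^ (r + 1) * ‖f x‖
        ≤ (1 + ‖x‖) ^ r * ((1 + ∑ i, |x i|) * ‖f x‖) := by
          rw [pow_succ, mul_assoc]
          gcongr
          exact norm_le_sum_coord x
      _ = (1 + ‖x‖) ^ r * ‖f x‖ + ∑ i, (1 + ‖x‖) ^ r * ‖coordMul i f x‖ := by
          rw [add_mul, mul_add, one_mul, Finset.sum_mul, Finset.mul_sum]
          congr 1
          refine Finset.sum_congr rfl fun i _ => ?_
          rw [coordMul_apply, norm_mul, Complex.norm_real, Real.norm_eq_abs]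
      _ ≤ decayConst n r M + ∑ _i : Fin n, decayConst n r fun m => M (m + 1) :=
          add_le_add (ih hf) (Finset.sum_le_sum fun i _ => ih (letter_mem_wordBall hf (Sum.inl i)))
      _ = decayConst n (r + 1) M := by simp [decayConst]

theorem norm_le_decay (r : ℕ) {M : ℕ → ℝ} {f : Sch n} (hf : f ∈ wordBall n M) (x : Euc n) :
    ‖f x‖ ≤ decayConst n r M * (1 + ‖x‖) ^ (-(r : ℝ)) := by
  have h := decay_of_mem_wordBall r hf x
  have hp : 0 < (1 + ‖x‖) ^ r := by positivity
  rw [Real.rpow_neg (by positivity), Real.rpow_natCast, ← div_eq_mul_inv, le_div_iff₀ hp, mul_comm]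
  exact h

end

/-! ### Operations between functions on ℝᵈ and on ℝ²ᵈ -/

section
/-! ### The doubled space -/

section doubled

variable {d : ℕ}

/-- The point `(x, y)` of `ℝ²ᵈ`. -/
def join (x y : Euc d) : Euc (d + d) := WithLp.toLp 2 (Fin.append x y)

@[simp] theorem join_castAdd (x y : Euc d) (i : Fin d) : join x y (Fin.castAdd d i) = x i := by
  simp [join]

theorem join_natAdd (x y : Euc d) (i : Fin d) : join x y (Fin.natAdd d i) = y i := by
  simp [join, -Fin.natAdd_eq_addNat]

@[simp] theorem join_addNat (x y : Euc d) (i : Fin d) : join x y (i.addNat d) = y i := by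
  rw [← Fin.natAdd_eq_addNat, join_natAdd]

@[simp] theorem position_apply (z : Euc (d + d)) (i : Fin d) :
    position z i = z (Fin.castAdd d i) := rfl

@[simp] theorem frequency_apply (z : Euc (d + d)) (i : Fin d) :
    frequency z i = z (Fin.natAdd d i) := rfl

@[simp] theorem position_join (x y : Euc d) : position (join x y) = x := by ext; simp

@[simp] theorem frequency_join (x y : Euc d) : frequency (join x y) = y := by ext; simp

theorem join_position_frequency (z : Euc (d + d)) : join (position z) (frequency z) = z := by
  ext i
  refine Fin.addCases (fun i => ?_) (fun i => ?_) i <;> simp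

/-- The projection of `ℝ²ᵈ` to the first component. -/
def positionL : Euc (d + d) →L[ℝ] Euc d :=
  LinearMap.toContinuousLinearMap
    { toFun := position, map_add' := fun _ _ => by ext; simp, map_smul' := fun _ _ => by ext; simp }

/-- The projection of `ℝ²ᵈ` to the second component. -/
def frequencyL : Euc (d + d) →L[ℝ] Euc d :=
  LinearMap.toContinuousLinearMap
    { toFun := frequency, map_add' := fun _ _ => by ext; simp, map_smul' := fun _ _ => by ext; simp }

@[simp] theorem positionL_apply (z : Euc (d + d)) : positionL z = position z := rfl
@[simp] theorem frequencyL_apply (z : Euc (d + d)) : frequencyL z = frequency z := rfl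

/-- The inclusion `x ↦ (x, 0)`. -/
def inlL : Euc d →L[ℝ] Euc (d + d) :=
  LinearMap.toContinuousLinearMap
    { toFun := fun x => join x 0
      map_add' := fun _ _ => by ext i; refine Fin.addCases (fun i => ?_) (fun i => ?_) i <;> simp
      map_smul' := fun _ _ => by ext i; refine Fin.addCases (fun i => ?_) (fun i => ?_) i <;> simp }

/-- The inclusion `y ↦ (0, y)`. -/
def inrL : Euc d →L[ℝ] Euc (d + d) :=
  LinearMap.toContinuousLinearMap
    { toFun := fun x => join 0 x
      map_add' := fun _ _ => by ext i; refine Fin.addCases (fun i => ?_) (fun i => ?_) i <;> simp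
      map_smul' := fun _ _ => by ext i; refine Fin.addCases (fun i => ?_) (fun i => ?_) i <;> simp }

theorem inlL_add_inrL (x y : Euc d) : inlL x + inrL y = join x y := by
  change join x 0 + join 0 y = join x y
  ext i
  refine Fin.addCases (fun i => ?_) (fun i => ?_) i <;> simp

theorem norm_join_sq (x y : Euc d) : ‖join x y‖ ^ 2 = ‖x‖ ^ 2 + ‖y‖ ^ 2 := by
  simp [EuclideanSpace.norm_sq_eq, Fin.sum_univ_add]

theorem norm_le_norm_join_left (x y : Euc d) : ‖x‖ ≤ ‖join x y‖ := by
  refine abs_le_of_sq_le_sq' ?_ (norm_nonneg _) |>.2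
  rw [norm_join_sq]
  exact le_add_of_nonneg_right (sq_nonneg _)

theorem norm_le_norm_join_right (x y : Euc d) : ‖y‖ ≤ ‖join x y‖ := by
  refine abs_le_of_sq_le_sq' ?_ (norm_nonneg _) |>.2
  rw [norm_join_sq]
  exact le_add_of_nonneg_left (sq_nonneg _)

theorem continuous_join : Continuous fun p : Euc d × Euc d => join p.1 p.2 := by
  simp only [← inlL_add_inrL]
  fun_prop

theorem single_castAdd_eq (i : Fin d) :
    (EuclideanSpace.single (Fin.castAdd d i) (1 : ℝ) : Euc (d + d)) =
      join (EuclideanSpace.single i 1) 0 := by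
  ext j
  refine Fin.addCases (fun j => ?_) (fun j => ?_) j
  · simp [Fin.ext_iff]
  · have : (j.addNat d) ≠ Fin.castAdd d i := by
      simp only [ne_eq, Fin.ext_iff, Fin.val_addNat, Fin.val_castAdd]
      omega
    simp [this]

theorem single_natAdd_eq (i : Fin d) :
    (EuclideanSpace.single (Fin.natAdd d i) (1 : ℝ) : Euc (d + d)) =
      join 0 (EuclideanSpace.single i 1) := by
  ext j
  refine Fin.addCases (fun j => ?_) (fun j => ?_) j
  · have : Fin.castAdd d j ≠ i.addNat d := by
      simp only [ne_eq, Fin.ext_iff, Fin.val_addNat, Fin.val_castAdd]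
      omega
    simp [this]
  · simp [Fin.ext_iff]

/-- The map is a composite of volume-preserving identifications: forget the Euclidean norms, regard
a pair as a function on `Fin d ⊕ Fin d`, reindex, and restore the norm. -/
theorem measurePreserving_join :
    MeasurePreserving (fun p : Euc d × Euc d => join p.1 p.2) volume volume := by
  have h1 := (PiLp.volume_preserving_ofLp (Fin d)).prod (PiLp.volume_preserving_ofLp (Fin d))
  have h2 := (measurePreserving_sumPiEquivProdPi_symm
    (fun _ : Fin d ⊕ Fin d => (volume : Measure ℝ)))
  have h3 := measurePreserving_piCongrLeft (fun _ : Fin (d + d) => (volume : Measure ℝ)) finSumFinEquiv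
  have h4 := PiLp.volume_preserving_toLp (Fin (d + d))
  have h := h4.comp (h3.comp (h2.comp h1))
  have e : (fun p : Euc d × Euc d => join p.1 p.2) = WithLp.toLp 2 ∘
      ⇑(MeasurableEquiv.piCongrLeft (fun _ => ℝ) finSumFinEquiv) ∘
        ⇑(MeasurableEquiv.sumPiEquivProdPi fun _ => ℝ).symm ∘ Prod.map WithLp.ofLp WithLp.ofLp := by
    funext p
    ext j
    refine Fin.addCases (fun j => ?_) (fun j => ?_) j
    · rw [join_castAdd, ← finSumFinEquiv_apply_left]
      exact (Equiv.piCongrLeft_apply_apply (fun _ : Fin (d + d) => ℝ) finSumFinEquiv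
        ((MeasurableEquiv.sumPiEquivProdPi fun _ => ℝ).symm (p.1.ofLp, p.2.ofLp)) (Sum.inl j)).symm
    · rw [join_natAdd, ← finSumFinEquiv_apply_right]
      exact (Equiv.piCongrLeft_apply_apply (fun _ : Fin (d + d) => ℝ) finSumFinEquiv
        ((MeasurableEquiv.sumPiEquivProdPi fun _ => ℝ).symm (p.1.ofLp, p.2.ofLp)) (Sum.inr j)).symm
  rw [e]
  exact h

theorem measurableEmbedding_join :
    MeasurableEmbedding fun p : Euc d × Euc d => join p.1 p.2 := by
  refine Continuous.measurableEmbedding continuous_join fun p q h => ?_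
  refine Prod.ext ?_ ?_
  · simpa using congrArg position h
  · simpa using congrArg frequency h

/-- Fubini's theorem on the doubled space. -/
theorem integral_join {F : Euc (d + d) → ℂ} (hF : Integrable F) :
    ∫ z, F z = ∫ x, ∫ y, F (join x y) := by
  rw [← measurePreserving_join.integral_comp measurableEmbedding_join, Measure.volume_eq_prod,
    integral_prod]
  exact (measurePreserving_join.integrable_comp_emb measurableEmbedding_join).2 hF

end doubled

/-! ### Linear substitutions -/

theorem HasFDerivAt.gradOf_of_apply {n : ℕ} {F : Euc n → ℂ} {L : Euc n →L[ℝ] ℂ} {z : Euc n}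
    (h : HasFDerivAt F L z) {D : Fin n → ℂ} (hL : ∀ v, L v = ∑ i, (v i : ℂ) * D i) :
    HasFDerivAt F (gradOf D) z :=
  h.congr_fderiv (ContinuousLinearMap.ext fun v => (hL v).trans (gradOf_apply D v).symm)

theorem hasFDerivAt_comp_gradOf {m n : ℕ} {G : Euc n → ℂ} {D : Fin n → ℂ} (A : Euc m →L[ℝ] Euc n)
    (z : Euc m) (hG : HasFDerivAt G (gradOf D) (A z)) :
    HasFDerivAt (fun z => G (A z))
      (gradOf fun j => ∑ i, (A (EuclideanSpace.single j 1) i : ℂ) * D i) z := by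
  have h : HasFDerivAt (fun z => G (A z)) ((gradOf D).comp A) z := hG.comp z A.hasFDerivAt
  refine h.congr_fderiv ((eq_gradOf _).trans ?_)
  simp only [ContinuousLinearMap.comp_apply, gradOf_apply]

theorem HasFDerivAt.mul_gradOf {n : ℕ} {F G : Euc n → ℂ} {D E : Fin n → ℂ} {z : Euc n}
    (hF : HasFDerivAt F (gradOf D) z) (hG : HasFDerivAt G (gradOf E) z) :
    HasFDerivAt (fun z => F z * G z) (gradOf fun j => D j * G z + F z * E j) z := by
  refine HasFDerivAt.gradOf_of_apply (hF.mul hG) fun v => ?_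
  simp only [gradOf_apply, add_apply, smul_apply, smul_eq_mul, Finset.mul_sum,
    ← Finset.sum_add_distrib]
  exact Finset.sum_congr rfl fun i _ => by ring

/-! ### Complex conjugation -/

/-- The complex conjugate of a Schwartz function. -/
def conjS {n : ℕ} (f : Sch n) : Sch n := postcompCLM (𝕜 := ℝ) (Complex.conjCLE : ℂ →L[ℝ] ℂ) f

section conjS

variable {n : ℕ}

@[simp] theorem conjS_apply (f : Sch n) (x : Euc n) : conjS f x = conj (f x) := rfl

theorem conjS_add (f g : Sch n) : conjS (f + g) = conjS f + conjS g := by ext; simp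

theorem conjS_smul (c : ℂ) (f : Sch n) : conjS (c • f) = conj c • conjS f := by ext; simp

theorem letter_conjS (l : Letter n) (f : Sch n) : letter l (conjS f) = conjS (letter l f) := by
  ext x
  rcases l with i | i
  · simp
  · simp only [letter_inr, conjS_apply]
    refine pderiv_eq_of_hasFDerivAt (D := fun i => conj (pderiv i f x)) ?_ i
    have h := (Complex.conjCLE : ℂ →L[ℝ] ℂ).hasFDerivAt.comp x (hasFDerivAt_gradOf f x)
    exact HasFDerivAt.gradOf_of_apply h fun v => by simp [gradOf_apply]

theorem conjS_mem_wordBall {M : ℕ → ℝ} {f : Sch n} (hf : f ∈ wordBall n M) :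
    conjS f ∈ wordBall n M := by
  have key : ∀ w (f : Sch n), word w (conjS f) = conjS (word w f) := by
    intro w
    induction w with
    | nil => intro f; rfl
    | cons l w ih => intro f; rw [word_cons, letter_conjS, ih, word_cons]
  intro w x
  rw [key, conjS_apply, RCLike.norm_conj]
  exact hf w x

end conjS

/-! ### Tensor products -/

section tensor

variable {d : ℕ}

theorem hasFDerivAt_comp_position {G : Euc d → ℂ} {D : Fin d → ℂ} {z : Euc (d + d)}
    (hG : HasFDerivAt G (gradOf D) (position z)) :
    HasFDerivAt (fun z => G (position z)) (gradOf (Fin.addCases D fun _ => 0)) z := by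
  refine (hasFDerivAt_comp_gradOf positionL z hG).congr_fderiv (congrArg gradOf (funext fun j => ?_))
  refine Fin.addCases (fun j => ?_) (fun j => ?_) j
  · rw [single_castAdd_eq]
    simp [apply_ite Complex.ofReal]
  · rw [single_natAdd_eq, Fin.addCases_right]
    simp

theorem hasFDerivAt_comp_frequency {G : Euc d → ℂ} {D : Fin d → ℂ} {z : Euc (d + d)}
    (hG : HasFDerivAt G (gradOf D) (frequency z)) :
    HasFDerivAt (fun z => G (frequency z)) (gradOf (Fin.addCases (fun _ => 0) D)) z := by
  refine (hasFDerivAt_comp_gradOf frequencyL z hG).congr_fderiv (congrArg gradOf (funext fun j => ?_))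
  refine Fin.addCases (fun j => ?_) (fun j => ?_) j
  · rw [single_castAdd_eq]
    simp
  · rw [single_natAdd_eq, Fin.addCases_right]
    simp [apply_ite Complex.ofReal]

theorem hasFDerivAt_tensor (f g : Sch d) (z : Euc (d + d)) :
    HasFDerivAt (fun z => f (position z) * g (frequency z))
      (gradOf (Fin.addCases (fun i => pderiv i f (position z) * g (frequency z))
        fun i => f (position z) * pderiv i g (frequency z))) z := by
  refine (HasFDerivAt.mul_gradOf (hasFDerivAt_comp_position (hasFDerivAt_gradOf f _))
    (hasFDerivAt_comp_frequency (hasFDerivAt_gradOf g _))).congr_fderiv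
    (congrArg gradOf (funext fun j => ?_))
  refine Fin.addCases (fun j => ?_) (fun j => ?_) j
  · simp
  · simp only [Fin.addCases_right]
    simp

/-- Every letter on ℝ²ᵈ acts on one factor only, so the set of pure tensors is closed under letters.
-/
theorem exists_tensor (f g : Sch d) :
    ∃ h : Sch (d + d), ∀ z, h z = f (position z) * g (frequency z) := by
  refine exists_schwartz_of_closed
    (𝒜 := {G | ∃ f g : Sch d, G = fun z => f (position z) * g (frequency z)}) ?_ ?_ ?_ ⟨f, g, rfl⟩
  · rintro _ ⟨f, g, rfl⟩
    refine ⟨SchwartzMap.seminorm ℂ 0 0 f * SchwartzMap.seminorm ℂ 0 0 g, fun z => ?_⟩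
    rw [norm_mul]
    exact mul_le_mul (norm_le_seminorm ℂ f _) (norm_le_seminorm ℂ g _) (norm_nonneg _)
      (apply_nonneg _ _)
  · rintro _ ⟨f, g, rfl⟩ i
    refine Fin.addCases (fun i => ?_) (fun i => ?_) i
    · exact ⟨coordMul i f, g, by ext z; simp; ring⟩
    · exact ⟨f, coordMul i g, by ext z; simp; ring⟩
  · rintro _ ⟨f, g, rfl⟩
    refine ⟨Fin.addCases (fun i z => pderiv i f (position z) * g (frequency z))
      fun i z => f (position z) * pderiv i g (frequency z), fun i => ?_, fun z => ?_⟩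
    · refine Fin.addCases (fun i => ?_) (fun i => ?_) i
      · exact ⟨pderiv i f, g, by simp⟩
      · exact ⟨f, pderiv i g, by simp only [Fin.addCases_right]⟩
    · refine (hasFDerivAt_tensor f g z).congr_fderiv (congrArg gradOf (funext fun j => ?_))
      refine Fin.addCases (fun j => ?_) (fun j => ?_) j
      · simp
      · simp only [Fin.addCases_right]

/-- The tensor product `(f ⊗ g)(x, y) = f(x) g(y)`. -/
def tensor (f g : Sch d) : Sch (d + d) := (exists_tensor f g).choose

theorem tensor_apply (f g : Sch d) (z : Euc (d + d)) :
    tensor f g z = f (position z) * g (frequency z) := (exists_tensor f g).choose_spec z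

theorem coe_tensor (f g : Sch d) : ⇑(tensor f g) = fun z => f (position z) * g (frequency z) :=
  funext (tensor_apply f g)

/-- A letter for the first component. -/
def leftLetter : Letter d → Letter (d + d) := Sum.map (Fin.castAdd d) (Fin.castAdd d)

/-- A letter for the second component. -/
def rightLetter : Letter d → Letter (d + d) := Sum.map (Fin.natAdd d) (Fin.natAdd d)

theorem letter_cases {p : Letter (d + d) → Prop} (hl : ∀ l, p (leftLetter l))
    (hr : ∀ l, p (rightLetter l)) (l : Letter (d + d)) : p l := by
  rcases l with i | i
  · exact Fin.addCases (fun i => hl (Sum.inl i)) (fun i => hr (Sum.inl i)) i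
  · exact Fin.addCases (fun i => hl (Sum.inr i)) (fun i => hr (Sum.inr i)) i

theorem leftLetter_tensor (l : Letter d) (f g : Sch d) :
    letter (leftLetter l) (tensor f g) = tensor (letter l f) g := by
  ext z
  rcases l with i | i
  · simp [leftLetter, tensor_apply, mul_assoc]
  · have h := hasFDerivAt_tensor f g z
    rw [← coe_tensor] at h
    have := pderiv_eq_of_hasFDerivAt h (Fin.castAdd d i)
    simpa [leftLetter, tensor_apply] using this

theorem rightLetter_tensor (l : Letter d) (f g : Sch d) :
    letter (rightLetter l) (tensor f g) = tensor f (letter l g) := by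
  ext z
  rcases l with i | i
  · simp only [rightLetter, Sum.map_inl, letter_inl, tensor_apply, coordMul_apply, frequency_apply]
    ring
  · have h := hasFDerivAt_tensor f g z
    rw [← coe_tensor] at h
    have := pderiv_eq_of_hasFDerivAt h (Fin.natAdd d i)
    rw [Fin.addCases_right] at this
    simpa only [rightLetter, Sum.map_inr, letter_inr, tensor_apply] using this

/-- A word on ℝ²ᵈ splits into a word of length j acting on f and one of length k acting on g. The
induction records this by shifting M or N together with P. -/
theorem tensor_mem_wordBall {M N P : ℕ → ℝ} {f g : Sch d} (hf : f ∈ wordBall d M)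
    (hg : g ∈ wordBall d N) (hP : ∀ j k, M j * N k ≤ P (j + k)) :
    tensor f g ∈ wordBall (d + d) P := by
  intro w
  induction w generalizing f g M N P with
  | nil =>
    intro z
    rw [word_nil, tensor_apply, norm_mul]
    exact (mul_le_mul (norm_le_of_mem_wordBall hf _) (norm_le_of_mem_wordBall hg _) (norm_nonneg _)
      (nonneg_of_mem_wordBall hf [])).trans (hP 0 0)
  | cons l w ih =>
    refine letter_cases (p := fun l => ∀ z, ‖word (l :: w) (tensor f g) z‖ ≤ _)
      (fun l => ?_) (fun l => ?_) l
    · rw [word_cons, leftLetter_tensor]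
      refine ih (P := fun m => P (m + 1)) (letter_mem_wordBall hf l) hg fun j k => ?_
      rw [add_right_comm]
      exact hP _ _
    · rw [word_cons, rightLetter_tensor]
      exact ih (P := fun m => P (m + 1)) hf (letter_mem_wordBall hg l) fun j k => hP _ _

end tensor

/-! ### Slices -/

section slice

variable {d : ℕ}

theorem hasTemperateGrowth_join (x : Euc d) : Function.HasTemperateGrowth fun y => join x y := by
  simp only [← inlL_add_inrL]
  exact (Function.HasTemperateGrowth.const _).add inrL.hasTemperateGrowth

/-- The function `y ↦ Ψ(x, y)`. -/
def slice (x : Euc d) : Sch (d + d) →L[ℂ] Sch d :=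
  -- Properness of y ↦ (x, y): |y| ≤ 1 · (1 + |(x, y)|)^1.
  compCLM ℂ (hasTemperateGrowth_join x) ⟨1, 1, fun y => by
    have := norm_le_norm_join_right x y
    linarith⟩

@[simp] theorem slice_apply (x y : Euc d) (Ψ : Sch (d + d)) : slice x Ψ y = Ψ (join x y) := rfl

theorem letter_slice (l : Letter d) (x : Euc d) (Ψ : Sch (d + d)) :
    letter l (slice x Ψ) = slice x (letter (rightLetter l) Ψ) := by
  ext y
  rcases l with i | i
  · simp [rightLetter]
  · simp only [letter_inr, slice_apply, rightLetter, Sum.map_inr, pderiv_eq_fderiv]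
    have h : HasFDerivAt (fun y => join x y) (inrL : Euc d →L[ℝ] Euc (d + d)) y := by
      simp only [← inlL_add_inrL]
      exact inrL.hasFDerivAt.const_add _
    have h' : HasFDerivAt (slice x Ψ) ((fderiv ℝ Ψ (join x y)).comp inrL) y :=
      (Ψ.differentiableAt (x := join x y)).hasFDerivAt.comp y h
    rw [h'.fderiv, single_natAdd_eq]
    rfl

theorem word_slice (w : List (Letter d)) (x : Euc d) (Ψ : Sch (d + d)) :
    word w (slice x Ψ) = slice x (word (w.map rightLetter) Ψ) := by
  induction w generalizing Ψ with
  | nil => rfl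
  | cons l w ih => rw [word_cons, letter_slice, ih, List.map_cons, word_cons]

theorem slice_mem_wordBall {M : ℕ → ℝ} {Ψ : Sch (d + d)} (hΨ : Ψ ∈ wordBall (d + d) M) (x : Euc d) :
    slice x Ψ ∈ wordBall d M := fun w y => by
  rw [word_slice, slice_apply]
  simpa using hΨ (w.map rightLetter) (join x y)

end slice

end

/-! ### Differentiation under the integral and averages of linear substitutions -/

section
/-! ### Spans of closed families, and integrals with parameters -/

/-- Boundedness and both closure conditions are linear in the function, so they pass from generators
to their span, and the criterion for closed sets applies there. -/
theorem exists_schwartz_of_span {n : ℕ} {𝒜 : Set (Euc n → ℂ)}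
    (hb : ∀ G ∈ 𝒜, ∃ C, ∀ x, ‖G x‖ ≤ C)
    (hX : ∀ G ∈ 𝒜, ∀ i : Fin n, (fun x => (x i : ℂ) * G x) ∈ Submodule.span ℂ 𝒜)
    (hD : ∀ G ∈ 𝒜, ∃ D : Fin n → Euc n → ℂ, (∀ i, D i ∈ Submodule.span ℂ 𝒜) ∧
      ∀ x, HasFDerivAt G (gradOf fun i => D i x) x)
    {G : Euc n → ℂ} (hG : G ∈ 𝒜) : ∃ g : Sch n, ∀ x, g x = G x := by
  refine exists_schwartz_of_closed (𝒜 := (Submodule.span ℂ 𝒜 : Set (Euc n → ℂ))) ?_ ?_ ?_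
    (Submodule.subset_span hG)
  · intro G hG
    induction hG using Submodule.span_induction with
    | mem G hG => exact hb G hG
    | zero => exact ⟨0, by simp⟩
    | add G H _ _ hG hH =>
      obtain ⟨A, hA⟩ := hG
      obtain ⟨B, hB⟩ := hH
      exact ⟨A + B, fun x => (norm_add_le _ _).trans (add_le_add (hA x) (hB x))⟩
    | smul c G _ hG =>
      obtain ⟨A, hA⟩ := hG
      refine ⟨‖c‖ * A, fun x => ?_⟩
      rw [Pi.smul_apply, norm_smul]
      exact mul_le_mul_of_nonneg_left (hA x) (norm_nonneg c)
  · intro G hG i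
    induction hG using Submodule.span_induction with
    | mem G hG => exact hX G hG i
    | zero =>
      simp only [Pi.zero_apply, mul_zero]
      exact Submodule.zero_mem _
    | add G H _ _ hG hH =>
      simp only [Pi.add_apply, mul_add]
      exact Submodule.add_mem _ hG hH
    | smul c G _ hG =>
      simp only [Pi.smul_apply, smul_eq_mul, mul_left_comm _ c]
      exact Submodule.smul_mem _ c hG
  · intro G hG
    induction hG using Submodule.span_induction with
    | mem G hG => exact hD G hG
    | zero =>
      refine ⟨0, fun i => Submodule.zero_mem _, fun x => ?_⟩
      exact HasFDerivAt.gradOf_of_apply (hasFDerivAt_const (0 : ℂ) x) (by simp)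
    | add G H _ _ hG hH =>
      obtain ⟨D, hD, hd⟩ := hG
      obtain ⟨E, hE, he⟩ := hH
      refine ⟨D + E, fun i => Submodule.add_mem _ (hD i) (hE i), fun x => ?_⟩
      refine HasFDerivAt.gradOf_of_apply ((hd x).add (he x)) fun v => ?_
      simp [gradOf_apply, mul_add, Finset.sum_add_distrib]
    | smul c G _ hG =>
      obtain ⟨D, hD, hd⟩ := hG
      refine ⟨c • D, fun i => Submodule.smul_mem _ c (hD i), fun x => ?_⟩
      refine HasFDerivAt.gradOf_of_apply ((hd x).const_smul c) fun v => ?_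
      simp [gradOf_apply, Finset.mul_sum, mul_left_comm]

/-- Writing the derivative through finitely many scalar functions with fixed coefficient maps `L i`
reduces measurability and domination to scalar statements. -/
theorem hasFDerivAt_integral_sum {ι H α : Type*} [Fintype ι] [NormedAddCommGroup H]
    [NormedSpace ℝ H] [MeasurableSpace α] {μ : Measure α} (L : ι → ℂ →L[ℝ] H →L[ℝ] ℂ)
    {F : H → α → ℂ} {D : ι → H → α → ℂ} {bound : ι → α → ℝ}
    (hF : ∀ z, Integrable (F z) μ) (hDm : ∀ i z, AEStronglyMeasurable (D i z) μ)
    (hb : ∀ᵐ a ∂μ, ∀ i z, ‖D i z a‖ ≤ bound i a) (hbi : ∀ i, Integrable (bound i) μ)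
    (hd : ∀ a z, HasFDerivAt (fun z => F z a) (∑ i, L i (D i z a)) z) (z : H) :
    HasFDerivAt (fun z => ∫ a, F z a ∂μ) (∑ i, L i (∫ a, D i z a ∂μ)) z := by
  have hDi : ∀ i, Integrable (D i z) μ := fun i =>
    (hbi i).mono' (hDm i z) (hb.mono fun a ha => ha i z)
  have hint : ∀ i, Integrable (fun a => L i (D i z a)) μ := fun i => (L i).integrable_comp (hDi i)
  have hs : Integrable (fun a => ∑ i, L i (D i z a)) μ :=
    integrable_finsetSum Finset.univ (f := fun i a => L i (D i z a)) fun i _ => hint i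
  have hbs : Integrable (fun a => ∑ i, ‖L i‖ * bound i a) μ :=
    integrable_finsetSum Finset.univ (f := fun i a => ‖L i‖ * bound i a) fun i _ =>
      (hbi i).const_mul _
  have hbb : ∀ᵐ a ∂μ, ∀ z ∈ (Set.univ : Set H), ‖∑ i, L i (D i z a)‖ ≤ ∑ i, ‖L i‖ * bound i a := by
    filter_upwards [hb] with a ha z _
    exact norm_sum_le_of_le _ fun i _ =>
      ((L i).le_opNorm _).trans (mul_le_mul_of_nonneg_left (ha i z) (norm_nonneg _))
  have he : ∫ a, ∑ i, L i (D i z a) ∂μ = ∑ i, L i (∫ a, D i z a ∂μ) := by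
    rw [integral_finsetSum Finset.univ (f := fun i a => L i (D i z a)) fun i _ => hint i]
    exact Finset.sum_congr rfl fun i _ => (L i).integral_comp_comm (hDi i)
  have hFm : ∀ᶠ z in nhds z, AEStronglyMeasurable (F z) μ :=
    Filter.Eventually.of_forall fun z => (hF z).aestronglyMeasurable
  have hdd : ∀ᵐ a ∂μ, ∀ z ∈ (Set.univ : Set H),
      HasFDerivAt (fun z => F z a) (∑ i, L i (D i z a)) z :=
    Filter.Eventually.of_forall fun a z _ => hd a z
  have h := hasFDerivAt_integral_of_dominated_of_fderiv_le (𝕜 := ℝ) (μ := μ) (F := F)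
    (F' := fun z a => ∑ i, L i (D i z a)) (x₀ := z) (s := Set.univ)
    (bound := fun a => ∑ i, ‖L i‖ * bound i a) Filter.univ_mem hFm (hF z) hs.1 hbb hbs hdd
  exact he ▸ h

theorem hasFDerivAt_integral_gradOf {n : ℕ} {α : Type*} [MeasurableSpace α] {μ : Measure α}
    {F : Euc n → α → ℂ} {D : Fin n → Euc n → α → ℂ} {bound : Fin n → α → ℝ}
    (hF : ∀ z, Integrable (F z) μ) (hDm : ∀ i z, AEStronglyMeasurable (D i z) μ)
    (hb : ∀ᵐ a ∂μ, ∀ i z, ‖D i z a‖ ≤ bound i a) (hbi : ∀ i, Integrable (bound i) μ)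
    (hd : ∀ a z, HasFDerivAt (fun z => F z a) (gradOf fun i => D i z a) z) (z : Euc n) :
    HasFDerivAt (fun z => ∫ a, F z a ∂μ) (gradOf fun i => ∫ a, D i z a ∂μ) z :=
  hasFDerivAt_integral_sum
    (fun i => ContinuousLinearMap.smulRightL ℝ (Euc n) ℂ (EuclideanSpace.proj i)) hF hDm hb hbi hd z

/-! ### Bounded sets of Schwartz functions -/

/-- Each word is a continuous operator, hence bounded on S in the sup norm, and there are finitely
many words of each length; summing their bounds gives a weight that depends on the length only. -/
theorem exists_wordBall_of_isVonNBounded {n : ℕ} {S : Set (Sch n)} (hS : Bornology.IsVonNBounded ℂ S) :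
    ∃ M, S ⊆ wordBall n M := by
  have h : ∀ w : List (Letter n), ∃ C, ∀ f ∈ S, SchwartzMap.seminorm ℂ 0 0 (word w f) ≤ C := by
    intro w
    have h1 := hS.image (word w)
    obtain ⟨r, -, hr⟩ :=
      ((schwartz_withSeminorms ℂ (Euc n) ℂ).isVonNBounded_iff_seminorm_bounded.1 h1) (0, 0)
    exact ⟨r, fun f hf => (hr _ ⟨f, hf, rfl⟩).le⟩
  choose C hC using h
  have hfin : ∀ m, {w : List (Letter n) | w.length = m}.Finite := fun m => List.finite_length_eq _ m
  refine ⟨fun m => ∑ w ∈ (hfin m).toFinset, |C w|, fun f hf w x => ?_⟩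
  refine ((norm_le_seminorm ℂ _ x).trans (hC w f hf)).trans ((le_abs_self _).trans ?_)
  exact Finset.single_le_sum (f := fun w => |C w|) (fun _ _ => abs_nonneg _) (by simp)

theorem exists_mem_wordBall {n : ℕ} (f : Sch n) : ∃ M, f ∈ wordBall n M := by
  obtain ⟨M, hM⟩ := exists_wordBall_of_isVonNBounded (Bornology.isVonNBounded_singleton (𝕜 := ℂ) f)
  exact ⟨M, hM rfl⟩

theorem integrable_decay {d : ℕ} : Integrable fun y : Euc d => (1 + ‖y‖) ^ (-((d + 1 : ℕ) : ℝ)) :=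
  integrable_one_add_norm (by simp)

theorem rpow_decay_mono {x y : ℝ} (hx : 0 ≤ x) (h : x ≤ y) (r : ℕ) :
    (1 + y) ^ (-(r : ℝ)) ≤ (1 + x) ^ (-(r : ℝ)) :=
  Real.rpow_le_rpow_of_nonpos (by linarith) (by linarith) (by simp)

theorem decayConst_nonneg {n : ℕ} {M : ℕ → ℝ} {f : Sch n} (hf : f ∈ wordBall n M) (r : ℕ) :
    0 ≤ decayConst n r M := by
  have := decay_of_mem_wordBall r hf 0
  exact le_trans (by positivity) this

theorem norm_slice_le {d : ℕ} {M : ℕ → ℝ} {Ψ : Sch (d + d)} (hΨ : Ψ ∈ wordBall (d + d) M)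
    (r : ℕ) (x y : Euc d) : ‖Ψ (join x y)‖ ≤ decayConst (d + d) r M * (1 + ‖y‖) ^ (-(r : ℝ)) :=
  (norm_le_decay r hΨ _).trans (mul_le_mul_of_nonneg_left
    (rpow_decay_mono (norm_nonneg _) (norm_le_norm_join_right x y) r) (decayConst_nonneg hΨ r))

/-! ### Averages over a family of linear substitutions -/

/-- A continuous family of invertible linear maps of `ℝⁿ`, with the inverse maps. -/
structure LinearFamily (n : ℕ) where
  /-- the linear maps -/
  map : ℝ → Euc n →L[ℝ] Euc n
  /-- the inverse maps -/
  inv : ℝ → Euc n →L[ℝ] Euc n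
  continuous_map : Continuous map
  continuous_inv : Continuous inv
  inv_map : ∀ t z, inv t (map t z) = z

namespace LinearFamily

variable {n : ℕ} (A : LinearFamily n)

/-- `L` bounds the norms of the maps and of their inverses for `0 ≤ t ≤ 1`. -/
def BoundedBy (L : ℝ) : Prop := ∀ t ∈ Set.Icc (0 : ℝ) 1, ‖A.map t‖ ≤ L ∧ ‖A.inv t‖ ≤ L

theorem exists_boundedBy : ∃ L, A.BoundedBy L := by
  obtain ⟨L, hL⟩ := isCompact_Icc.exists_bound_of_continuousOn (A.continuous_map.continuousOn)
  obtain ⟨L', hL'⟩ := isCompact_Icc.exists_bound_of_continuousOn (A.continuous_inv.continuousOn)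
  exact ⟨max L L', fun t ht => ⟨(hL t ht).trans (le_max_left _ _), (hL' t ht).trans (le_max_right _ _)⟩⟩

/-- The entries of the maps. -/
def mapCoeff (i j : Fin n) : C(ℝ, ℝ) :=
  ⟨fun t => A.map t (EuclideanSpace.single i 1) j, by
    have := A.continuous_map
    fun_prop⟩

/-- The entries of the inverse maps. -/
def invCoeff (i j : Fin n) : C(ℝ, ℝ) :=
  ⟨fun t => A.inv t (EuclideanSpace.single i 1) j, by
    have := A.continuous_inv
    fun_prop⟩

variable {A} in
theorem BoundedBy.abs_mapCoeff_le {L : ℝ} (hL : A.BoundedBy L) (i j : Fin n) {t : ℝ}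
    (ht : t ∈ Set.Icc (0 : ℝ) 1) : |A.mapCoeff i j t| ≤ L := by
  refine (norm_coord_le _ j).trans (((A.map t).le_opNorm _).trans ?_)
  simpa using (hL t ht).1

variable {A} in
theorem BoundedBy.abs_invCoeff_le {L : ℝ} (hL : A.BoundedBy L) (i j : Fin n) {t : ℝ}
    (ht : t ∈ Set.Icc (0 : ℝ) 1) : |A.invCoeff i j t| ≤ L := by
  refine (norm_coord_le _ j).trans (((A.inv t).le_opNorm _).trans ?_)
  simpa using (hL t ht).2

/-- This is z = A_t⁻¹(A_t z) in coordinates. It moves a coordinate of z inside the integral as a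
combination of coordinates at A_t z, and is the reason for carrying the inverses. -/
theorem coord_eq_sum (t : ℝ) (z : Euc n) (i : Fin n) :
    z i = ∑ j, A.invCoeff j i t * A.map t z j := by
  have hv : A.map t z = ∑ j, A.map t z j • EuclideanSpace.single j (1 : ℝ) := by
    ext j
    simp [Finset.sum_apply, Pi.single_apply]
  conv_lhs => rw [← A.inv_map t z, hv, map_sum]
  simp [invCoeff, mul_comm]

/-- The integral `∫₀¹ κ(t) Ψ(A_t z) dt`. -/
def avgFun (κ : C(ℝ, ℝ)) (Ψ : Sch n) (z : Euc n) : ℂ :=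
  ∫ t in Set.Ioc (0 : ℝ) 1, (κ t : ℂ) * Ψ (A.map t z)

theorem continuous_avg_integrand (κ : C(ℝ, ℝ)) (Ψ : Sch n) (z : Euc n) :
    Continuous fun t => (κ t : ℂ) * Ψ (A.map t z) := by
  have := A.continuous_map
  have := Ψ.continuous
  fun_prop

theorem integrable_avg_integrand (κ : C(ℝ, ℝ)) (Ψ : Sch n) (z : Euc n) :
    Integrable (fun t => (κ t : ℂ) * Ψ (A.map t z)) (volume.restrict (Set.Ioc (0 : ℝ) 1)) :=
  (A.continuous_avg_integrand κ Ψ z).integrableOn_Ioc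

theorem norm_avgFun_le {κ : C(ℝ, ℝ)} {c : ℝ} (hκ : ∀ t ∈ Set.Icc (0 : ℝ) 1, |κ t| ≤ c)
    {Ψ : Sch n} {C : ℝ} (hΨ : ∀ x, ‖Ψ x‖ ≤ C) (z : Euc n) : ‖A.avgFun κ Ψ z‖ ≤ c * C := by
  have h := norm_setIntegral_le_of_norm_le_const (μ := volume) (s := Set.Ioc (0 : ℝ) 1)
    (f := fun t => (κ t : ℂ) * Ψ (A.map t z)) (C := c * C) (by simp) fun t ht => by
      rw [norm_mul, Complex.norm_real, Real.norm_eq_abs]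
      have hc := hκ t (Set.Ioc_subset_Icc_self ht)
      exact mul_le_mul hc (hΨ _) (norm_nonneg _) ((abs_nonneg _).trans hc)
  simpa [avgFun] using h

theorem exists_bound_coeff (κ : C(ℝ, ℝ)) : ∃ c, ∀ t ∈ Set.Icc (0 : ℝ) 1, |κ t| ≤ c :=
  isCompact_Icc.exists_bound_of_continuousOn κ.continuous.continuousOn

theorem coord_mul_avgFun (κ : C(ℝ, ℝ)) (Ψ : Sch n) (z : Euc n) (i : Fin n) :
    (z i : ℂ) * A.avgFun κ Ψ z = ∑ j, A.avgFun (κ * A.invCoeff j i) (coordMul j Ψ) z := by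
  simp only [avgFun]
  rw [← integral_const_mul, ← integral_finsetSum _ fun j _ => A.integrable_avg_integrand _ _ _]
  refine integral_congr_ae (Filter.Eventually.of_forall fun t => ?_)
  simp only [ContinuousMap.mul_apply, coordMul_apply]
  rw [A.coord_eq_sum t z i]
  push_cast
  rw [Finset.sum_mul]
  exact Finset.sum_congr rfl fun j _ => by ring

theorem hasFDerivAt_avgFun (κ : C(ℝ, ℝ)) (Ψ : Sch n) (z : Euc n) :
    HasFDerivAt (A.avgFun κ Ψ)
      (gradOf fun i => ∑ j, A.avgFun (κ * A.mapCoeff i j) (pderiv j Ψ) z) z := by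
  choose c hc using fun i j => exists_bound_coeff (κ * A.mapCoeff i j)
  have h := hasFDerivAt_integral_gradOf (μ := volume.restrict (Set.Ioc (0 : ℝ) 1))
    (F := fun z t => (κ t : ℂ) * Ψ (A.map t z))
    (D := fun i z t => ∑ j, ((κ * A.mapCoeff i j) t : ℂ) * pderiv j Ψ (A.map t z))
    (bound := fun i t => ∑ j, c i j * SchwartzMap.seminorm ℂ 0 0 (pderiv j Ψ))
    (fun z => A.integrable_avg_integrand κ Ψ z)
    (fun i z => (integrable_finsetSum _ fun j _ =>
      A.integrable_avg_integrand _ _ _).aestronglyMeasurable) ?_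
    (fun i => integrable_const _) ?_ z
  · refine h.congr_fderiv (congrArg gradOf (funext fun i => ?_))
    exact integral_finsetSum _ fun j _ => A.integrable_avg_integrand _ _ _
  · refine (ae_restrict_iff' measurableSet_Ioc).2 (Filter.Eventually.of_forall fun t ht i z => ?_)
    refine norm_sum_le_of_le _ fun j _ => ?_
    rw [norm_mul, Complex.norm_real, Real.norm_eq_abs]
    have hc := hc i j t (Set.Ioc_subset_Icc_self ht)
    exact mul_le_mul hc (norm_le_seminorm ℂ _ _) (norm_nonneg _) ((abs_nonneg _).trans hc)
  · intro t z
    refine HasFDerivAt.gradOf_of_apply ((hasFDerivAt_comp_gradOf (A.map t) z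
      (hasFDerivAt_gradOf Ψ _)).const_mul (κ t : ℂ)) fun v => ?_
    simp only [smul_apply, gradOf_apply, smul_eq_mul, Finset.mul_sum, ContinuousMap.mul_apply]
    refine Finset.sum_congr rfl fun i _ => Finset.sum_congr rfl fun j _ => ?_
    simp only [mapCoeff, ContinuousMap.coe_mk]
    push_cast
    ring

/-- A letter turns an average into a sum of averages whose coefficient κ is multiplied by a matrix
entry of A_t or of its inverse. Allowing every κ therefore makes the span stable under letters,
although only κ = 1 is wanted in the end. -/
theorem exists_avg (κ : C(ℝ, ℝ)) (Ψ : Sch n) : ∃ g : Sch n, ∀ z, g z = A.avgFun κ Ψ z := by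
  refine exists_schwartz_of_span (𝒜 := {G | ∃ κ Ψ, G = A.avgFun κ Ψ}) ?_ ?_ ?_ ⟨κ, Ψ, rfl⟩
  · rintro _ ⟨κ, Ψ, rfl⟩
    obtain ⟨c, hc⟩ := exists_bound_coeff κ
    exact ⟨_, A.norm_avgFun_le hc (norm_le_seminorm ℂ Ψ)⟩
  · rintro _ ⟨κ, Ψ, rfl⟩ i
    have : (fun x : Euc n => (x i : ℂ) * A.avgFun κ Ψ x) =
        ∑ j, A.avgFun (κ * A.invCoeff j i) (coordMul j Ψ) := by
      ext z
      rw [A.coord_mul_avgFun, Finset.sum_apply]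
    rw [this]
    exact Submodule.sum_mem _ fun j _ => Submodule.subset_span ⟨_, _, rfl⟩
  · rintro _ ⟨κ, Ψ, rfl⟩
    refine ⟨fun i => ∑ j, A.avgFun (κ * A.mapCoeff i j) (pderiv j Ψ), fun i =>
      Submodule.sum_mem _ fun j _ => Submodule.subset_span ⟨_, _, rfl⟩, fun z => ?_⟩
    simpa only [Finset.sum_apply] using A.hasFDerivAt_avgFun κ Ψ z

/-- The average `∫₀¹ κ(t) Ψ(A_t z) dt` as a Schwartz function. -/
def avg (κ : C(ℝ, ℝ)) (Ψ : Sch n) : Sch n := (A.exists_avg κ Ψ).choose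

theorem avg_apply (κ : C(ℝ, ℝ)) (Ψ : Sch n) (z : Euc n) : A.avg κ Ψ z = A.avgFun κ Ψ z :=
  (A.exists_avg κ Ψ).choose_spec z

theorem coordMul_avg (κ : C(ℝ, ℝ)) (Ψ : Sch n) (i : Fin n) :
    coordMul i (A.avg κ Ψ) = ∑ j, A.avg (κ * A.invCoeff j i) (coordMul j Ψ) := by
  ext z
  rw [coordMul_apply, avg_apply, coord_mul_avgFun, sum_apply]
  simp only [avg_apply]

theorem pderiv_avg (κ : C(ℝ, ℝ)) (Ψ : Sch n) (i : Fin n) :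
    pderiv i (A.avg κ Ψ) = ∑ j, A.avg (κ * A.mapCoeff i j) (pderiv j Ψ) := by
  ext z
  have h := A.hasFDerivAt_avgFun κ Ψ z
  rw [← funext (A.avg_apply κ Ψ)] at h
  rw [pderiv_eq_of_hasFDerivAt h, sum_apply]
  simp only [avg_apply]

/-- Each letter produces n averages and multiplies the bound of the coefficient by L, so a word of
length m costs (nL)^m. -/
theorem norm_word_avg_le {L : ℝ} (hL : A.BoundedBy L) (w : List (Letter n)) {M : ℕ → ℝ} {Ψ : Sch n}
    (hΨ : Ψ ∈ wordBall n M) {κ : C(ℝ, ℝ)} {c : ℝ} (hκ : ∀ t ∈ Set.Icc (0 : ℝ) 1, |κ t| ≤ c)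
    (z : Euc n) : ‖word w (A.avg κ Ψ) z‖ ≤ c * (n * L) ^ w.length * M w.length := by
  induction w generalizing M Ψ κ c with
  | nil =>
    rw [word_nil, avg_apply]
    simpa using A.norm_avgFun_le hκ (norm_le_of_mem_wordBall hΨ) z
  | cons l w ih =>
    have hmul : ∀ θ : C(ℝ, ℝ), (∀ t ∈ Set.Icc (0 : ℝ) 1, |θ t| ≤ L) →
        ∀ t ∈ Set.Icc (0 : ℝ) 1, |(κ * θ) t| ≤ c * L := fun θ hθ t ht => by
      rw [ContinuousMap.mul_apply, abs_mul]
      exact mul_le_mul (hκ t ht) (hθ t ht) (abs_nonneg _) ((abs_nonneg _).trans (hκ t ht))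
    have hsum : ∀ (θ : Fin n → C(ℝ, ℝ)) (l : Fin n → Letter n),
        (∀ j, ∀ t ∈ Set.Icc (0 : ℝ) 1, |θ j t| ≤ L) →
        ‖word w (∑ j, A.avg (κ * θ j) (letter (l j) Ψ)) z‖ ≤
          c * (n * L) ^ (w.length + 1) * M (w.length + 1) := fun θ l hθ => by
      rw [map_sum, sum_apply]
      refine (norm_sum_le_of_le _ fun j _ =>
        ih (letter_mem_wordBall hΨ (l j)) (hmul _ (hθ j))).trans (le_of_eq ?_)
      simp only [Finset.sum_const, Finset.card_univ, Fintype.card_fin, nsmul_eq_mul]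
      ring
    rw [word_cons, List.length_cons]
    rcases l with i | i
    · rw [letter_inl, coordMul_avg]
      exact hsum (fun j => A.invCoeff j i) (fun j => Sum.inl j) fun j t ht => hL.abs_invCoeff_le j i ht
    · rw [letter_inr, pderiv_avg]
      exact hsum (fun j => A.mapCoeff i j) (fun j => Sum.inr j) fun j t ht => hL.abs_mapCoeff_le i j ht

theorem avg_mem_wordBall {L : ℝ} (hL : A.BoundedBy L) {M : ℕ → ℝ} {Ψ : Sch n}
    (hΨ : Ψ ∈ wordBall n M) : A.avg 1 Ψ ∈ wordBall n fun m => (n * L) ^ m * M m := fun w z => by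
  simpa using A.norm_word_avg_le hL w hΨ (κ := 1) (c := 1) (by simp) z

theorem avg_one_apply (Ψ : Sch n) (z : Euc n) :
    A.avg 1 Ψ z = ∫ t in Set.Ioc (0 : ℝ) 1, Ψ (A.map t z) := by
  simp [avg_apply, avgFun]

end LinearFamily

end

section
/-! ### The partial Fourier transform -/

section partialFourier

variable {d : ℕ}

/-- The normalizing constant `(2π)^{-d/2}`. -/
def fourierConst (d : ℕ) : ℂ := (((2 * Real.pi) ^ (-(d : ℝ) / 2) : ℝ) : ℂ)

/-- The character `e^{-i⟨y, ξ⟩}`. -/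
def expChar (y ξ : Euc d) : ℂ := Complex.exp (-Complex.I * (inner ℝ y ξ : ℝ))

theorem norm_expChar (y ξ : Euc d) : ‖expChar y ξ‖ = 1 := by
  rw [expChar, Complex.norm_exp]
  simp

theorem continuous_expChar : Continuous fun p : Euc d × Euc d => expChar p.1 p.2 := by
  unfold expChar
  fun_prop

theorem expChar_comm (y ξ : Euc d) : expChar y ξ = expChar ξ y := by
  rw [expChar, expChar, real_inner_comm]

theorem hasFDerivAt_expChar (y ξ : Euc d) :
    HasFDerivAt (fun ξ => expChar y ξ) (gradOf fun i => -Complex.I * y i * expChar y ξ) ξ := by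
  have h1 : HasFDerivAt (fun ξ : Euc d => (inner ℝ y ξ : ℝ)) (innerSL ℝ y) ξ :=
    (innerSL ℝ y).hasFDerivAt
  have h2 := ((Complex.ofRealCLM.hasFDerivAt.comp ξ h1).const_mul (-Complex.I)).cexp
  refine HasFDerivAt.gradOf_of_apply h2 fun v => ?_
  change expChar y ξ * (-Complex.I * ((inner ℝ y v : ℝ) : ℂ)) = _
  simp only [PiLp.inner_apply, RCLike.inner_apply, conj_trivial, Complex.ofReal_sum,
    Complex.ofReal_mul, Finset.mul_sum]
  exact Finset.sum_congr rfl fun i _ => by ring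

/-- The integrand of the partial Fourier transform. -/
def partialFourierIntegrand (Ψ : Sch (d + d)) (z : Euc (d + d)) (y : Euc d) : ℂ :=
  Ψ (join (position z) y) * expChar y (frequency z)

theorem continuous_partialFourierIntegrand (Ψ : Sch (d + d)) (z : Euc (d + d)) :
    Continuous (partialFourierIntegrand Ψ z) :=
  (slice (position z) Ψ).continuous.mul
    (continuous_expChar.comp (continuous_id.prodMk continuous_const))

theorem norm_partialFourierIntegrand_le {M : ℕ → ℝ} {Ψ : Sch (d + d)}
    (hΨ : Ψ ∈ wordBall (d + d) M) (z : Euc (d + d)) (y : Euc d) :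
    ‖partialFourierIntegrand Ψ z y‖ ≤
      decayConst (d + d) (d + 1) M * (1 + ‖y‖) ^ (-((d + 1 : ℕ) : ℝ)) := by
  rw [partialFourierIntegrand, norm_mul, norm_expChar, mul_one]
  exact norm_slice_le hΨ _ _ _

theorem integrable_partialFourierIntegrand (Ψ : Sch (d + d)) (z : Euc (d + d)) :
    Integrable (partialFourierIntegrand Ψ z) := by
  obtain ⟨M, hM⟩ := exists_mem_wordBall Ψ
  exact (integrable_decay.const_mul _).mono'
    (continuous_partialFourierIntegrand Ψ z).aestronglyMeasurable
    (Filter.Eventually.of_forall (norm_partialFourierIntegrand_le hM z))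

/-- The partial Fourier transform in the second variable, as a function. -/
def partialFourierFun (Ψ : Sch (d + d)) (z : Euc (d + d)) : ℂ :=
  fourierConst d * ∫ y, partialFourierIntegrand Ψ z y

/-- The constant in the bound for the partial Fourier transform. -/
def partialFourierBound (d : ℕ) : ℝ :=
  ‖fourierConst d‖ * ∫ y : Euc d, (1 + ‖y‖) ^ (-((d + 1 : ℕ) : ℝ))

theorem partialFourierBound_nonneg (d : ℕ) : 0 ≤ partialFourierBound d :=
  mul_nonneg (norm_nonneg _) (integral_nonneg fun _ => by positivity)

theorem norm_partialFourierFun_le {M : ℕ → ℝ} {Ψ : Sch (d + d)}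
    (hΨ : Ψ ∈ wordBall (d + d) M) (z : Euc (d + d)) :
    ‖partialFourierFun Ψ z‖ ≤ partialFourierBound d * decayConst (d + d) (d + 1) M := by
  rw [partialFourierFun, norm_mul, partialFourierBound, mul_assoc, mul_comm (integral _ _),
    ← integral_const_mul]
  gcongr
  exact norm_integral_le_of_norm_le (integrable_decay.const_mul _)
    (Filter.Eventually.of_forall (norm_partialFourierIntegrand_le hΨ z))

theorem partialFourierFun_smul (c : ℂ) (Ψ : Sch (d + d)) (z : Euc (d + d)) :
    partialFourierFun (c • Ψ) z = c * partialFourierFun Ψ z := by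
  simp only [partialFourierFun, partialFourierIntegrand, smul_apply, smul_eq_mul, mul_assoc]
  rw [integral_const_mul]
  ring

theorem position_mul_partialFourierFun (Ψ : Sch (d + d)) (z : Euc (d + d)) (i : Fin d) :
    (z (Fin.castAdd d i) : ℂ) * partialFourierFun Ψ z =
      partialFourierFun (coordMul (Fin.castAdd d i) Ψ) z := by
  simp only [partialFourierFun, partialFourierIntegrand, coordMul_apply, join_castAdd, mul_assoc,
    position_apply]
  rw [integral_const_mul]
  ring

theorem hasFDerivAt_join_left (Ψ : Sch (d + d)) (x y : Euc d) :
    HasFDerivAt (fun x => Ψ (join x y)) (gradOf fun i => pderiv (Fin.castAdd d i) Ψ (join x y)) x := by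
  have h : HasFDerivAt (fun x => join x y) (inlL : Euc d →L[ℝ] Euc (d + d)) x := by
    simp only [← inlL_add_inrL]
    exact inlL.hasFDerivAt.add_const _
  have h' : HasFDerivAt (fun x => Ψ (join x y)) ((fderiv ℝ Ψ (join x y)).comp inlL) x :=
    (Ψ.differentiableAt (x := join x y)).hasFDerivAt.comp x h
  refine h'.congr_fderiv ((eq_gradOf _).trans (congrArg gradOf (funext fun i => ?_)))
  rw [pderiv_eq_fderiv, single_castAdd_eq]
  rfl

/-- Integration by parts in y, based on ξᵢ e^{-i⟨y,ξ⟩} = i ∂_{yᵢ} e^{-i⟨y,ξ⟩}. -/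
theorem frequency_mul_partialFourierFun (Ψ : Sch (d + d)) (z : Euc (d + d)) (i : Fin d) :
    (z (Fin.natAdd d i) : ℂ) * partialFourierFun Ψ z =
      -Complex.I * partialFourierFun (pderiv (Fin.natAdd d i) Ψ) z := by
  have hline : ∀ (G : Euc d → ℂ) (D : Fin d → ℂ) (y : Euc d), HasFDerivAt G (gradOf D) y →
      HasLineDerivAt ℝ G (D i) y (EuclideanSpace.single i 1) := fun G D y h => by
    have := h.hasLineDerivAt (EuclideanSpace.single i 1)
    rwa [gradOf_single] at this
  have hs : pderiv i (slice (position z) Ψ) = slice (position z) (pderiv (Fin.natAdd d i) Ψ) :=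
    letter_slice (Sum.inr i) (position z) Ψ
  have hI : Integrable fun y => Ψ (join (position z) y) *
      (-Complex.I * frequency z i * expChar y (frequency z)) := by
    convert (integrable_partialFourierIntegrand Ψ z).const_mul (-Complex.I * frequency z i) using 2
    rw [partialFourierIntegrand]
    ring
  have h := integral_bilinear_hasLineDerivAt_right_eq_neg_left_of_integrable
    (μ := (volume : Measure (Euc d))) (B := ContinuousLinearMap.mul ℝ ℂ)
    (f := slice (position z) Ψ) (f' := pderiv i (slice (position z) Ψ))
    (g := fun y => expChar y (frequency z))
    (g' := fun y => -Complex.I * frequency z i * expChar y (frequency z))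
    (v := EuclideanSpace.single i 1) ?_ hI (integrable_partialFourierIntegrand Ψ z)
    (fun y _ => hline _ _ y (hasFDerivAt_gradOf _ y)) (fun y _ => ?_)
  · rw [hs] at h
    simp only [ContinuousLinearMap.mul_apply', slice_apply] at h
    have e : ∀ y, Ψ (join (position z) y) * (-Complex.I * frequency z i * expChar y (frequency z)) =
        -Complex.I * frequency z i * partialFourierIntegrand Ψ z y := fun y => by
      rw [partialFourierIntegrand]
      ring
    simp only [e, integral_const_mul] at h
    simp only [partialFourierFun]
    change _ = -Complex.I * (_ * ∫ y, pderiv (Fin.natAdd d i) Ψ (join (position z) y) *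
      expChar y (frequency z))
    rw [← neg_eq_iff_eq_neg.2 h]
    simp only [frequency_apply]
    linear_combination ((z (Fin.natAdd d i) : ℂ) * fourierConst d *
      ∫ y, partialFourierIntegrand Ψ z y) * Complex.I_sq
  · rw [hs]
    exact integrable_partialFourierIntegrand (pderiv (Fin.natAdd d i) Ψ) z
  · have h := hasFDerivAt_expChar (frequency z) y
    simp only [expChar_comm (frequency z)] at h
    exact hline _ _ y h

/-- The Schwartz functions whose partial Fourier transforms are the partial derivatives of the
partial Fourier transform of `Ψ`. -/
def partialFourierDeriv (Ψ : Sch (d + d)) (i : Fin (d + d)) : Sch (d + d) :=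
  Fin.addCases (fun i => pderiv (Fin.castAdd d i) Ψ)
    (fun i => -Complex.I • coordMul (Fin.natAdd d i) Ψ) i

theorem hasFDerivAt_partialFourierFun (Ψ : Sch (d + d)) (z : Euc (d + d)) :
    HasFDerivAt (partialFourierFun Ψ)
      (gradOf fun i => partialFourierFun (partialFourierDeriv Ψ i) z) z := by
  choose M hM using fun i => exists_mem_wordBall (partialFourierDeriv Ψ i)
  have h := hasFDerivAt_integral_gradOf (μ := volume) (F := partialFourierIntegrand Ψ)
    (D := fun i z y => partialFourierIntegrand (partialFourierDeriv Ψ i) z y)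
    (bound := fun i y => decayConst (d + d) (d + 1) (M i) * (1 + ‖y‖) ^ (-((d + 1 : ℕ) : ℝ)))
    (integrable_partialFourierIntegrand Ψ)
    (fun i z => (continuous_partialFourierIntegrand _ z).aestronglyMeasurable)
    (Filter.Eventually.of_forall fun y i z => norm_partialFourierIntegrand_le (hM i) z y)
    (fun i => integrable_decay.const_mul _) ?_ z
  · refine HasFDerivAt.gradOf_of_apply (h.const_mul (fourierConst d)) fun v => ?_
    simp only [smul_apply, gradOf_apply, smul_eq_mul, Finset.mul_sum, partialFourierFun]
    exact Finset.sum_congr rfl fun i _ => by ring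
  · intro y z
    refine (HasFDerivAt.mul_gradOf (hasFDerivAt_comp_position (hasFDerivAt_join_left Ψ _ y))
      (hasFDerivAt_comp_frequency (hasFDerivAt_expChar y _))).congr_fderiv
      (congrArg gradOf (funext fun i => ?_))
    refine Fin.addCases (fun i => ?_) (fun i => ?_) i
    · simp [partialFourierDeriv, partialFourierIntegrand]
    · simp only [partialFourierDeriv, partialFourierIntegrand, Fin.addCases_right, smul_apply,
        coordMul_apply, join_natAdd, smul_eq_mul]
      ring

theorem exists_partialFourier (Ψ : Sch (d + d)) :
    ∃ g : Sch (d + d), ∀ z, g z = partialFourierFun Ψ z := by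
  refine exists_schwartz_of_closed (𝒜 := Set.range partialFourierFun) ?_ ?_ ?_ ⟨Ψ, rfl⟩
  · rintro _ ⟨Ψ, rfl⟩
    obtain ⟨M, hM⟩ := exists_mem_wordBall Ψ
    exact ⟨_, norm_partialFourierFun_le hM⟩
  · rintro _ ⟨Ψ, rfl⟩ i
    refine Fin.addCases (fun i => ?_) (fun i => ?_) i
    · exact ⟨_, funext fun z => (position_mul_partialFourierFun Ψ z i).symm⟩
    · refine ⟨-Complex.I • pderiv (Fin.natAdd d i) Ψ, funext fun z => ?_⟩
      rw [partialFourierFun_smul, frequency_mul_partialFourierFun]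
  · rintro _ ⟨Ψ, rfl⟩
    exact ⟨_, fun i => ⟨partialFourierDeriv Ψ i, rfl⟩, hasFDerivAt_partialFourierFun Ψ⟩

/-- The partial Fourier transform in the second variable. -/
def partialFourier (Ψ : Sch (d + d)) : Sch (d + d) := (exists_partialFourier Ψ).choose

theorem partialFourier_apply (Ψ : Sch (d + d)) (z : Euc (d + d)) :
    partialFourier Ψ z = partialFourierFun Ψ z := (exists_partialFourier Ψ).choose_spec z

/-- Position letters commute with the transform; in the frequency variable, coordinate and
derivative are exchanged up to the factor -i. -/
theorem exists_letter_partialFourier (l : Letter (d + d)) (Ψ : Sch (d + d)) :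
    ∃ (c : ℂ) (l' : Letter (d + d)), ‖c‖ = 1 ∧
      letter l (partialFourier Ψ) = c • partialFourier (letter l' Ψ) := by
  have hp : ∀ i, pderiv i (partialFourier Ψ) = partialFourier (partialFourierDeriv Ψ i) := by
    intro i
    ext z
    have h := hasFDerivAt_partialFourierFun Ψ z
    rw [← funext (partialFourier_apply Ψ)] at h
    rw [pderiv_eq_of_hasFDerivAt h, partialFourier_apply]
  rcases l with i | i
  · refine Fin.addCases (fun i => ?_) (fun i => ?_) i
    · refine ⟨1, Sum.inl (Fin.castAdd d i), by simp, ?_⟩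
      ext z
      simp only [letter_inl, coordMul_apply, partialFourier_apply, one_smul]
      exact position_mul_partialFourierFun Ψ z i
    · refine ⟨-Complex.I, Sum.inr (Fin.natAdd d i), by simp, ?_⟩
      ext z
      simp only [letter_inl, letter_inr, coordMul_apply, partialFourier_apply, smul_apply,
        smul_eq_mul]
      exact frequency_mul_partialFourierFun Ψ z i
  · refine Fin.addCases (fun i => ?_) (fun i => ?_) i
    · refine ⟨1, Sum.inr (Fin.castAdd d i), by simp, ?_⟩
      rw [letter_inr, hp, one_smul]
      simp [partialFourierDeriv]
    · refine ⟨-Complex.I, Sum.inl (Fin.natAdd d i), by simp, ?_⟩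
      rw [letter_inr, letter_inl, hp]
      ext z
      rw [smul_apply, partialFourier_apply, partialFourier_apply, smul_eq_mul,
        ← partialFourierFun_smul]
      simp only [partialFourierDeriv, Fin.addCases_right]

/-- Up to a unimodular factor, a word of the transform is the transform of a word of the same
length. The sup norm of the latter needs decay of order d + 1 in y for integrability, which costs at
most d + 1 more letters. -/
theorem partialFourier_mem_wordBall {M : ℕ → ℝ} {Ψ : Sch (d + d)} (hΨ : Ψ ∈ wordBall (d + d) M) :
    partialFourier Ψ ∈ wordBall (d + d) fun m =>
      partialFourierBound d * decayConst (d + d) (d + 1) fun k => M (k + m) := by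
  have key : ∀ w (Ψ : Sch (d + d)), ∃ (c : ℂ) (v : List (Letter (d + d))), ‖c‖ = 1 ∧
      v.length = w.length ∧ word w (partialFourier Ψ) = c • partialFourier (word v Ψ) := by
    intro w
    induction w with
    | nil => exact fun Ψ => ⟨1, [], by simp⟩
    | cons l w ih =>
      intro Ψ
      obtain ⟨c, l', hc, h⟩ := exists_letter_partialFourier l Ψ
      obtain ⟨c', v, hc', hv, h'⟩ := ih (letter l' Ψ)
      refine ⟨c * c', l' :: v, by simp [hc, hc'], by simp [hv], ?_⟩
      rw [word_cons, h, map_smul, h', word_cons, smul_smul]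
  intro w z
  obtain ⟨c, v, hc, hv, h⟩ := key w Ψ
  rw [h, smul_apply, norm_smul, hc, one_mul, partialFourier_apply, ← hv]
  exact norm_partialFourierFun_le (word_mem_wordBall hΨ v) z

end partialFourier

end

/-! ### Weight classes, and functionals acting in one of two variables -/

section
/-! ### Commutation relations -/

section commutation

variable {n : ℕ}

theorem pderiv_comm (i j : Fin n) (f : Sch n) : pderiv i (pderiv j f) = pderiv j (pderiv i f) := by
  ext x
  have key : ∀ i j : Fin n, pderiv i (pderiv j f) x =
      fderiv ℝ (fderiv ℝ f) x (EuclideanSpace.single i 1) (EuclideanSpace.single j 1) := by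
    intro i j
    have hd : DifferentiableAt ℝ (fderiv ℝ f) x :=
      ((f.smooth 2).fderiv_right (m := 1) (by norm_num)).differentiable (by norm_num) x
    rw [pderiv_eq_fderiv, funext (pderiv_eq_fderiv j f),
      fderiv_clm_apply hd (differentiableAt_const _)]
    simp
  have hs : IsSymmSndFDerivAt ℝ f x :=
    (f.contDiffAt 2).isSymmSndFDerivAt (by simp)
  rw [key, key]
  exact hs _ _

theorem pderiv_coordMul (i j : Fin n) (f : Sch n) :
    pderiv i (coordMul j f) = coordMul j (pderiv i f) + if i = j then f else 0 := by
  ext x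
  have h1 : HasFDerivAt (fun x : Euc n => ((x j : ℝ) : ℂ))
      (gradOf fun i => if i = j then 1 else 0) x := by
    refine HasFDerivAt.gradOf_of_apply
      (Complex.ofRealCLM.comp (EuclideanSpace.proj j : Euc n →L[ℝ] ℝ)).hasFDerivAt fun v => ?_
    simp
  have h2 := HasFDerivAt.mul_gradOf h1 (hasFDerivAt_gradOf f x)
  rw [← funext (coordMul_apply j f)] at h2
  rw [pderiv_eq_of_hasFDerivAt h2, add_apply, coordMul_apply]
  split_ifs <;> simp [add_comm]

end commutation

/-! ### Taylor estimates -/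

section taylor

variable {d : ℕ}

theorem norm_join_sub_le {M : ℕ → ℝ} {Φ : Sch (d + d)} (hΦ : Φ ∈ wordBall (d + d) M) (x x' y : Euc d) :
    ‖Φ (join x' y) - Φ (join x y)‖ ≤ d * M 1 * ‖x' - x‖ := by
  refine convex_univ.norm_image_sub_le_of_norm_hasFDerivWithin_le
    (f := fun x => Φ (join x y)) (fun x _ => (hasFDerivAt_join_left Φ x y).hasFDerivWithinAt)
    (fun x _ => ?_) (Set.mem_univ _) (Set.mem_univ _)
  refine (norm_gradOf_le _).trans ((Finset.sum_le_sum fun i _ =>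
    norm_le_of_mem_wordBall (letter_mem_wordBall hΦ (Sum.inr (Fin.castAdd d i))) _).trans ?_)
  simp

/-- The mean value inequality for z ↦ Φ(z, y) - L x z on a ball about x, whose derivative L z - L x
is controlled by `norm_join_sub_le` for the partial derivatives. The bound is uniform in y, so it
can be combined with words in y. -/
theorem norm_taylor_le {M : ℕ → ℝ} {Φ : Sch (d + d)} (hΦ : Φ ∈ wordBall (d + d) M) (x x' y : Euc d) :
    ‖Φ (join x' y) - Φ (join x y) -
      ∑ i, ((x' - x) i : ℂ) * pderiv (Fin.castAdd d i) Φ (join x y)‖ ≤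
      ‖x' - x‖ ^ 2 * (d * d * M 2) := by
  let L : Euc d → Euc d →L[ℝ] ℂ := fun x => gradOf fun i => pderiv (Fin.castAdd d i) Φ (join x y)
  have hL : ∀ z ∈ Metric.closedBall x ‖x' - x‖, ‖L z - L x‖ ≤ d * (d * M 2 * ‖x' - x‖) := by
    intro z hz
    have e : L z - L x = gradOf fun i => pderiv (Fin.castAdd d i) Φ (join z y) -
        pderiv (Fin.castAdd d i) Φ (join x y) := by
      ext v
      simp [L, gradOf_apply, mul_sub]
    rw [e]
    refine (norm_gradOf_le _).trans ((Finset.sum_le_sum fun i _ =>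
      (norm_join_sub_le (letter_mem_wordBall hΦ (Sum.inr (Fin.castAdd d i))) x z y).trans
      (mul_le_mul_of_nonneg_left (mem_closedBall_iff_norm.1 hz) ?_)).trans (by simp))
    exact mul_nonneg d.cast_nonneg ((norm_nonneg _).trans
      (hΦ [Sum.inr (Fin.castAdd d i), Sum.inr (Fin.castAdd d i)] 0))
  have h := (convex_closedBall x ‖x' - x‖).norm_image_sub_le_of_norm_hasFDerivWithin_le
    (f := fun z => Φ (join z y) - L x z) (f' := fun z => L z - L x)
    (fun z _ => ((hasFDerivAt_join_left Φ z y).sub (L x).hasFDerivAt).hasFDerivWithinAt) hL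
    (Metric.mem_closedBall_self (norm_nonneg _)) (y := x') (by simp [dist_eq_norm])
  have e : Φ (join x' y) - L x x' - (Φ (join x y) - L x x) = Φ (join x' y) - Φ (join x y) -
      ∑ i, ((x' - x) i : ℂ) * pderiv (Fin.castAdd d i) Φ (join x y) := by
    rw [← gradOf_apply, map_sub]
    ring
  rw [← e]
  exact h.trans (le_of_eq (by ring))

theorem pderiv_word_rightLetter (i : Fin d) (w : List (Letter d)) (Φ : Sch (d + d)) :
    pderiv (Fin.castAdd d i) (word (w.map rightLetter) Φ) =
      word (w.map rightLetter) (pderiv (Fin.castAdd d i) Φ) := by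
  induction w generalizing Φ with
  | nil => rfl
  | cons l w ih =>
    rw [List.map_cons, word_cons, ih, word_cons]
    congr 1
    rcases l with j | j
    · have : Fin.castAdd d i ≠ Fin.natAdd d j := by
        simp only [ne_eq, Fin.ext_iff, Fin.val_natAdd, Fin.val_castAdd]
        omega
      simp only [rightLetter, Sum.map_inl, letter_inl]
      rw [pderiv_coordMul, if_neg this, add_zero]
    · exact pderiv_comm _ _ _

end taylor

/-! ### Classes of weights -/

/-- The classes of weights that define the spaces of test functions: a set of test functions is
bounded if it is contained in `wordBall n M` for a weight `M` of the class. -/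
structure WeightClass (𝒲 : Set (ℕ → ℝ)) : Prop where
  add : ∀ {M N : ℕ → ℝ}, M ∈ 𝒲 → N ∈ 𝒲 → (fun m => M m + N m) ∈ 𝒲
  scale : ∀ {M : ℕ → ℝ} (C c : ℝ), M ∈ 𝒲 → 0 ≤ C → 0 ≤ c → (fun m => C * (c ^ m * M m)) ∈ 𝒲
  shift : ∀ {M : ℕ → ℝ}, M ∈ 𝒲 → (fun m => M (m + 1)) ∈ 𝒲
  split : ∀ {M : ℕ → ℝ}, M ∈ 𝒲 → ∃ M' ∈ 𝒲, (∀ m, 0 < M' m) ∧ ∀ j k, M (j + k) ≤ M' j * M' k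
  mul : ∀ {M N : ℕ → ℝ}, M ∈ 𝒲 → N ∈ 𝒲 → (∀ m, 0 < M m) → (∀ m, 0 < N m) →
    ∃ P ∈ 𝒲, ∀ j k, M j * N k ≤ P (j + k)
  gaussian : (fun m => 2 ^ m * √(m.factorial : ℝ)) ∈ 𝒲

namespace WeightClass

variable {𝒲 : Set (ℕ → ℝ)} (h𝒲 : WeightClass 𝒲)

theorem const_mul (h𝒲 : WeightClass 𝒲) {M : ℕ → ℝ} (hM : M ∈ 𝒲) {C : ℝ} (hC : 0 ≤ C) :
    (fun m => C * M m) ∈ 𝒲 := by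
  simpa using h𝒲.scale C 1 hM hC zero_le_one

/-- The case j = 0 of `split`. -/
theorem exists_pos (h𝒲 : WeightClass 𝒲) {M : ℕ → ℝ} (hM : M ∈ 𝒲) :
    ∃ M' ∈ 𝒲, (∀ m, 0 < M' m) ∧ ∀ m, M m ≤ M' m := by
  obtain ⟨M', hM', hpos, h⟩ := h𝒲.split hM
  exact ⟨fun m => M' 0 * M' m, h𝒲.const_mul hM' (hpos 0).le, fun m => mul_pos (hpos _) (hpos _),
    fun m => by simpa using h 0 m⟩

theorem shift_add (h𝒲 : WeightClass 𝒲) {M : ℕ → ℝ} (hM : M ∈ 𝒲) (k : ℕ) :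
    (fun m => M (m + k)) ∈ 𝒲 := by
  induction k with
  | zero => exact hM
  | succ k ih =>
    convert h𝒲.shift ih using 3 with m
    ring

/-- `decayConst` is a finite combination of shifts of M with nonnegative coefficients. -/
theorem decay (h𝒲 : WeightClass 𝒲) (n r : ℕ) {M : ℕ → ℝ} (hM : M ∈ 𝒲) :
    (fun m => decayConst n r fun k => M (k + m)) ∈ 𝒲 := by
  induction r generalizing M with
  | zero => simpa [decayConst] using hM
  | succ r ih =>
    refine h𝒲.add (ih hM) (h𝒲.const_mul ?_ n.cast_nonneg)
    convert ih (h𝒲.shift hM) using 5 with m k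
    exact add_right_comm _ _ _

theorem exists_common (h𝒲 : WeightClass 𝒲) {M N : ℕ → ℝ} (hM : M ∈ 𝒲) (hN : N ∈ 𝒲) :
    ∃ P ∈ 𝒲, (∀ m, 0 < P m) ∧ (∀ m, M m ≤ P m) ∧ ∀ m, N m ≤ P m := by
  obtain ⟨M', hM', hMpos, hM''⟩ := h𝒲.exists_pos hM
  obtain ⟨N', hN', hNpos, hN''⟩ := h𝒲.exists_pos hN
  exact ⟨_, h𝒲.add hM' hN', fun m => add_pos (hMpos m) (hNpos m),
    fun m => (hM'' m).trans (le_add_of_nonneg_right (hNpos m).le),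
    fun m => (hN'' m).trans (le_add_of_nonneg_left (hMpos m).le)⟩

/-- The test functions of the class. -/
def carrier (h𝒲 : WeightClass 𝒲) (n : ℕ) : Submodule ℂ (Sch n) where
  carrier := {f | ∃ M ∈ 𝒲, f ∈ wordBall n M}
  zero_mem' := ⟨_, h𝒲.gaussian, zero_mem_wordBall fun m => by positivity⟩
  add_mem' := by
    rintro f g ⟨M, hM, hf⟩ ⟨N, hN, hg⟩
    exact ⟨_, h𝒲.add hM hN, add_mem_wordBall hf hg⟩
  smul_mem' := by
    rintro c f ⟨M, hM, hf⟩
    exact ⟨_, h𝒲.const_mul hM (norm_nonneg c), smul_mem_wordBall hf c⟩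

theorem exists_tensor_bound (h𝒲 : WeightClass 𝒲) {M N : ℕ → ℝ} (hM : M ∈ 𝒲) (hN : N ∈ 𝒲) :
    ∃ P ∈ 𝒲, ∀ (d : ℕ) (f g : Sch d), f ∈ wordBall d M → g ∈ wordBall d N →
      tensor f g ∈ wordBall (d + d) P := by
  obtain ⟨M', hM', hMpos, hM''⟩ := h𝒲.exists_pos hM
  obtain ⟨N', hN', hNpos, hN''⟩ := h𝒲.exists_pos hN
  obtain ⟨P, hP, h⟩ := h𝒲.mul hM' hN' hMpos hNpos
  exact ⟨P, hP, fun d f g hf hg =>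
    tensor_mem_wordBall (wordBall_mono hM'' hf) (wordBall_mono hN'' hg) h⟩

theorem exists_avg_bound (h𝒲 : WeightClass 𝒲) {n : ℕ} (L : ℝ) {M : ℕ → ℝ} (hM : M ∈ 𝒲) :
    ∃ P ∈ 𝒲, ∀ A : LinearFamily n, A.BoundedBy L → ∀ Ψ ∈ wordBall n M, A.avg 1 Ψ ∈ wordBall n P := by
  rcases le_or_gt 0 L with hL | hL
  · refine ⟨_, h𝒲.scale 1 (n * L) hM zero_le_one (by positivity), fun A hA Ψ hΨ => ?_⟩
    simpa using A.avg_mem_wordBall hA hΨ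
  -- No family is bounded by a negative L, so the claim is void here.
  · refine ⟨M, hM, fun A hA => ?_⟩
    exact absurd ((norm_nonneg _).trans (hA 0 (by simp)).1) (not_le.2 hL)

theorem exists_partialFourier_bound (h𝒲 : WeightClass 𝒲) {d : ℕ} {M : ℕ → ℝ} (hM : M ∈ 𝒲) :
    ∃ P ∈ 𝒲, ∀ Ψ ∈ wordBall (d + d) M, partialFourier Ψ ∈ wordBall (d + d) P :=
  ⟨_, h𝒲.const_mul (h𝒲.decay (d + d) (d + 1) hM) (partialFourierBound_nonneg d),
    fun _ hΨ => partialFourier_mem_wordBall hΨ⟩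

end WeightClass

/-! ### Functionals that are bounded on bounded sets -/

/-- The linear functional `u` is bounded on the bounded sets of the class. -/
def BoundedOn (𝒲 : Set (ℕ → ℝ)) {n : ℕ} (u : Sch n →ₗ[ℂ] ℂ) : Prop :=
  ∀ M ∈ 𝒲, ∃ C, ∀ f ∈ wordBall n M, ‖u f‖ ≤ C

/-- Homogeneity. It turns a bound on one ball into bounds proportional to the size of f; for a = 0
the function f vanishes. -/
theorem norm_map_le_of_mem_wordBall_mul {n : ℕ} {u : Sch n →ₗ[ℂ] ℂ} {M : ℕ → ℝ} {C : ℝ}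
    (hC : ∀ f ∈ wordBall n M, ‖u f‖ ≤ C) {a : ℝ} (ha : 0 ≤ a) {f : Sch n}
    (hf : f ∈ wordBall n fun m => a * M m) : ‖u f‖ ≤ a * C := by
  rcases ha.eq_or_lt with rfl | ha
  · have : f = 0 := by
      ext x
      have := norm_le_of_mem_wordBall hf x
      simpa using this
    simp [this]
  · have h : ((a⁻¹ : ℝ) : ℂ) • f ∈ wordBall n M := by
      have := smul_mem_wordBall hf ((a⁻¹ : ℝ) : ℂ)
      refine wordBall_mono (fun m => le_of_eq ?_) this
      rw [Complex.norm_real, Real.norm_eq_abs, abs_of_pos (inv_pos.2 ha), inv_mul_cancel_left₀ ha.ne']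
    have := hC _ h
    rw [map_smul, norm_smul, Complex.norm_real, Real.norm_eq_abs, abs_of_pos (inv_pos.2 ha),
      inv_mul_le_iff₀ ha] at this
    exact this

section slicePairing

variable {d : ℕ} {𝒲 : Set (ℕ → ℝ)} {v : Sch d →ₗ[ℂ] ℂ}

/-- The first-order Taylor remainder of x' ↦ Θ(x', ·) at x lies in |x' - x|² times the fixed word
ball with weight d² M(m + 2), on which v is bounded. Hence the remainder of the pairing is O(|x' -
x|²). -/
theorem hasFDerivAt_slicePairing (h𝒲 : WeightClass 𝒲) (hv : BoundedOn 𝒲 v) {Θ : Sch (d + d)}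
    (hΘ : Θ ∈ h𝒲.carrier (d + d)) (x : Euc d) :
    HasFDerivAt (fun x => v (slice x Θ))
      (gradOf fun i => v (slice x (pderiv (Fin.castAdd d i) Θ))) x := by
  obtain ⟨M, hM, hΘ⟩ := hΘ
  obtain ⟨C, hC⟩ := hv (fun m => d * d * M (m + 2))
    (h𝒲.const_mul (h𝒲.shift_add hM 2) (by positivity))
  rw [hasFDerivAt_iff_isLittleO]
  have hO : (fun x' => v (slice x' Θ) - v (slice x Θ) -
      gradOf (fun i => v (slice x (pderiv (Fin.castAdd d i) Θ))) (x' - x)) =O[nhds x]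
      fun x' => ‖x' - x‖ ^ 2 := by
    refine Asymptotics.IsBigO.of_bound C (Filter.Eventually.of_forall fun x' => ?_)
    have e : v (slice x' Θ) - v (slice x Θ) -
        gradOf (fun i => v (slice x (pderiv (Fin.castAdd d i) Θ))) (x' - x) =
        v (slice x' Θ - slice x Θ -
          ∑ i, ((x' - x) i : ℂ) • slice x (pderiv (Fin.castAdd d i) Θ)) := by
      simp [gradOf_apply]
    rw [e, norm_pow, norm_norm, mul_comm]
    refine norm_map_le_of_mem_wordBall_mul hC (sq_nonneg _) fun w y => ?_
    have h := norm_taylor_le (word_mem_wordBall hΘ (w.map rightLetter)) x x' y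
    simp only [pderiv_word_rightLetter, List.length_map] at h
    simp only [map_sub, map_sum, map_smul, word_slice, sub_apply, sum_apply, smul_apply, slice_apply,
      smul_eq_mul, add_comm w.length]
    exact h
  refine hO.trans_isLittleO ?_
  have := Asymptotics.isLittleO_pow_sub_sub x (m := 2) (by norm_num) (E' := Euc d)
  exact this

theorem letter_leftLetter_slice_eq (i : Fin d) (x : Euc d) (Θ : Sch (d + d)) :
    slice x (coordMul (Fin.castAdd d i) Θ) = (x i : ℂ) • slice x Θ := by
  ext y
  simp

theorem exists_slicePairing (h𝒲 : WeightClass 𝒲) (hv : BoundedOn 𝒲 v) {Ψ : Sch (d + d)}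
    (hΨ : Ψ ∈ h𝒲.carrier (d + d)) : ∃ g : Sch d, ∀ x, g x = v (slice x Ψ) := by
  refine exists_schwartz_of_closed
    (𝒜 := (fun Θ x => v (slice x Θ)) '' (h𝒲.carrier (d + d))) ?_ ?_ ?_ ⟨Ψ, hΨ, rfl⟩
  · rintro _ ⟨Θ, ⟨M, hM, hΘ⟩, rfl⟩
    obtain ⟨C, hC⟩ := hv M hM
    exact ⟨C, fun x => hC _ (slice_mem_wordBall hΘ x)⟩
  · rintro _ ⟨Θ, ⟨M, hM, hΘ⟩, rfl⟩ i
    refine ⟨_, ⟨_, h𝒲.shift hM, letter_mem_wordBall hΘ (Sum.inl (Fin.castAdd d i))⟩, ?_⟩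
    ext x
    simp only [letter_inl, letter_leftLetter_slice_eq, map_smul, smul_eq_mul]
  · rintro _ ⟨Θ, hΘ, rfl⟩
    refine ⟨_, fun i => ⟨_, ?_, rfl⟩, hasFDerivAt_slicePairing h𝒲 hv hΘ⟩
    obtain ⟨M, hM, hΘ⟩ := hΘ
    exact ⟨_, h𝒲.shift hM, letter_mem_wordBall hΘ (Sum.inr (Fin.castAdd d i))⟩

open Classical in
/-- The function `x ↦ v(Ψ(x, ·))`. -/
def slicePairing (v : Sch d →ₗ[ℂ] ℂ) (Ψ : Sch (d + d)) : Sch d :=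
  -- The value 0 is not reached when v is bounded on a weight class and Ψ belongs to its carrier, by
  -- `exists_slicePairing`.
  if h : ∃ g : Sch d, ∀ x, g x = v (slice x Ψ) then h.choose else 0

theorem slicePairing_apply (h𝒲 : WeightClass 𝒲) (hv : BoundedOn 𝒲 v) {Ψ : Sch (d + d)}
    (hΨ : Ψ ∈ h𝒲.carrier (d + d)) (x : Euc d) : slicePairing v Ψ x = v (slice x Ψ) := by
  rw [slicePairing, dif_pos (exists_slicePairing h𝒲 hv hΨ)]
  exact (exists_slicePairing h𝒲 hv hΨ).choose_spec x

theorem letter_slicePairing (h𝒲 : WeightClass 𝒲) (hv : BoundedOn 𝒲 v) {Ψ : Sch (d + d)}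
    (hΨ : Ψ ∈ h𝒲.carrier (d + d)) (l : Letter d) :
    letter l (slicePairing v Ψ) = slicePairing v (letter (leftLetter l) Ψ) := by
  have hl : letter (leftLetter l) Ψ ∈ h𝒲.carrier (d + d) := by
    obtain ⟨M, hM, hΨ⟩ := hΨ
    exact ⟨_, h𝒲.shift hM, letter_mem_wordBall hΨ _⟩
  ext x
  rw [slicePairing_apply h𝒲 hv hl]
  rcases l with i | i
  · rw [letter_inl, coordMul_apply, slicePairing_apply h𝒲 hv hΨ, leftLetter, Sum.map_inl, letter_inl,
      letter_leftLetter_slice_eq, map_smul, smul_eq_mul]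
  · have h := hasFDerivAt_slicePairing h𝒲 hv hΨ x
    rw [← funext (slicePairing_apply h𝒲 hv hΨ)] at h
    exact pderiv_eq_of_hasFDerivAt h i

theorem word_slicePairing (h𝒲 : WeightClass 𝒲) (hv : BoundedOn 𝒲 v) (w : List (Letter d))
    {Ψ : Sch (d + d)} (hΨ : Ψ ∈ h𝒲.carrier (d + d)) :
    word w (slicePairing v Ψ) = slicePairing v (word (w.map leftLetter) Ψ) := by
  induction w generalizing Ψ with
  | nil => rfl
  | cons l w ih =>
    rw [word_cons, letter_slicePairing h𝒲 hv hΨ, List.map_cons, word_cons, ih]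
    obtain ⟨M, hM, hΨ⟩ := hΨ
    exact ⟨_, h𝒲.shift hM, letter_mem_wordBall hΨ _⟩

/-- A word of length j in x passes through v onto Ψ. The slices of the new function have weight M(j
+ m) ≤ M'(j) M'(m) in the word length m, so v of them is at most M'(j) C. -/
theorem slicePairing_mem_wordBall (h𝒲 : WeightClass 𝒲) (hv : BoundedOn 𝒲 v) {M M' : ℕ → ℝ}
    (hM : M ∈ 𝒲) (hpos : ∀ m, 0 < M' m) (hsplit : ∀ j k, M (j + k) ≤ M' j * M' k) {C : ℝ}
    (hC : ∀ f ∈ wordBall d M', ‖v f‖ ≤ C) {Ψ : Sch (d + d)} (hΨ : Ψ ∈ wordBall (d + d) M) :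
    slicePairing v Ψ ∈ wordBall d fun m => C * M' m := fun w x => by
  have h := word_mem_wordBall hΨ (w.map leftLetter)
  rw [List.length_map] at h
  rw [word_slicePairing h𝒲 hv w ⟨M, hM, hΨ⟩,
    slicePairing_apply h𝒲 hv ⟨_, h𝒲.shift_add hM w.length, h⟩]
  refine le_of_le_of_eq ?_ (mul_comm (M' w.length) C)
  refine norm_map_le_of_mem_wordBall_mul hC (hpos _).le ?_
  refine wordBall_mono (fun m => ?_) (slice_mem_wordBall h x)
  rw [add_comm]
  exact hsplit _ _

end slicePairing

end

/-! ### Interchanging functionals with integrals -/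

section
/-! ### Functionals commute with integrals -/

section functionalFubini

variable {d : ℕ}

theorem norm_join_le_left {M : ℕ → ℝ} {Ψ : Sch (d + d)} (hΨ : Ψ ∈ wordBall (d + d) M)
    (r : ℕ) (x y : Euc d) : ‖Ψ (join x y)‖ ≤ decayConst (d + d) r M * (1 + ‖x‖) ^ (-(r : ℝ)) :=
  (norm_le_decay r hΨ _).trans (mul_le_mul_of_nonneg_left
    (rpow_decay_mono (norm_nonneg _) (norm_le_norm_join_left x y) r) (decayConst_nonneg hΨ r))

theorem continuous_join_left (Ψ : Sch (d + d)) (y : Euc d) : Continuous fun x => Ψ (join x y) :=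
  Ψ.continuous.comp (continuous_join.comp (continuous_id.prodMk continuous_const))

theorem integrable_join_left (Ψ : Sch (d + d)) (y : Euc d) : Integrable fun x => Ψ (join x y) := by
  obtain ⟨M, hM⟩ := exists_mem_wordBall Ψ
  exact (integrable_decay.const_mul _).mono' (continuous_join_left Ψ y).aestronglyMeasurable
    (Filter.Eventually.of_forall fun x => norm_join_le_left hM (d + 1) x y)

theorem letter_eq_integral {Φ : Sch (d + d)} {k : Sch d} (hk : ∀ y, k y = ∫ x, Φ (join x y))
    (l : Letter d) (y : Euc d) : letter l k y = ∫ x, letter (rightLetter l) Φ (join x y) := by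
  rcases l with i | i
  · simp only [letter_inl, coordMul_apply, hk, rightLetter, Sum.map_inl, join_natAdd]
    rw [integral_const_mul]
  · have hp : ∀ i x y, pderiv i (slice x Φ) y = pderiv (Fin.natAdd d i) Φ (join x y) :=
      fun i x y => congrArg (fun f : Sch d => f y) (letter_slice (Sum.inr i) x Φ)
    choose M hM using fun i : Fin d => exists_mem_wordBall (pderiv (Fin.natAdd d i) Φ)
    have h := hasFDerivAt_integral_gradOf (μ := volume) (F := fun y x => Φ (join x y))
      (D := fun i y x => pderiv (Fin.natAdd d i) Φ (join x y))
      (bound := fun i x => decayConst (d + d) (d + 1) (M i) * (1 + ‖x‖) ^ (-((d + 1 : ℕ) : ℝ)))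
      (integrable_join_left Φ) (fun i y => (continuous_join_left _ y).aestronglyMeasurable)
      (Filter.Eventually.of_forall fun x i y => norm_join_le_left (hM i) (d + 1) x y)
      (fun i => integrable_decay.const_mul _) (fun x y => ?_) y
    · rw [← funext hk] at h
      exact pderiv_eq_of_hasFDerivAt h i
    · have h := hasFDerivAt_gradOf (slice x Φ) y
      simp only [hp] at h
      exact h

theorem word_eq_integral (w : List (Letter d)) {Φ : Sch (d + d)} {k : Sch d}
    (hk : ∀ y, k y = ∫ x, Φ (join x y)) (y : Euc d) :
    word w k y = ∫ x, word w (slice x Φ) y := by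
  simp only [word_slice, slice_apply]
  induction w generalizing Φ k with
  | nil => exact hk y
  | cons l w ih => exact ih (letter_eq_integral hk l)

/-- The index set for the values `w f(x)`, as a discrete space. -/
def WordIndex (d : ℕ) : Type := List (Letter d) × Euc d

instance : TopologicalSpace (WordIndex d) := ⊥
instance : DiscreteTopology (WordIndex d) := ⟨rfl⟩

/-- The functions that are bounded by a multiple of the weight `M`. -/
def gaugeSubmodule (d : ℕ) (M : ℕ → ℝ) : Submodule ℂ (Sch d) where
  carrier := {f | ∃ C, 0 ≤ C ∧ f ∈ wordBall d fun m => C * M m}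
  zero_mem' := ⟨0, le_rfl, zero_mem_wordBall fun m => by simp⟩
  add_mem' := by
    rintro f g ⟨A, hA, hf⟩ ⟨B, hB, hg⟩
    refine ⟨A + B, add_nonneg hA hB, ?_⟩
    simpa only [add_mul] using add_mem_wordBall hf hg
  smul_mem' := by
    rintro c f ⟨A, hA, hf⟩
    refine ⟨‖c‖ * A, by positivity, ?_⟩
    simpa only [mul_assoc] using smul_mem_wordBall hf c

/-- The family of the values `w f(x) / M(|w|)`. -/
def gaugeMap {M : ℕ → ℝ} (hM : ∀ m, 0 < M m) :
    gaugeSubmodule d M →ₗ[ℂ] BoundedContinuousFunction (WordIndex d) ℂ where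
  toFun f := BoundedContinuousFunction.ofNormedAddCommGroupDiscrete
    (fun a : WordIndex d => word a.1 (f : Sch d) a.2 / (M a.1.length : ℂ)) f.2.choose fun a => by
      rw [norm_div, Complex.norm_real, Real.norm_eq_abs, abs_of_pos (hM _), div_le_iff₀ (hM _)]
      exact f.2.choose_spec.2 _ _
  map_add' f g := by
    ext a
    simp [add_div]
  map_smul' c f := by
    ext a
    simp [mul_div_assoc]

theorem gaugeMap_apply {M : ℕ → ℝ} (hM : ∀ m, 0 < M m) (f : gaugeSubmodule d M) (a : WordIndex d) :
    gaugeMap hM f a = word a.1 (f : Sch d) a.2 / (M a.1.length : ℂ) := rfl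

theorem norm_gaugeMap_le {M : ℕ → ℝ} (hM : ∀ m, 0 < M m) (f : gaugeSubmodule d M) {C : ℝ}
    (hC : 0 ≤ C) (hf : (f : Sch d) ∈ wordBall d fun m => C * M m) : ‖gaugeMap hM f‖ ≤ C := by
  refine (BoundedContinuousFunction.norm_le hC).2 fun a => ?_
  rw [gaugeMap_apply, norm_div, Complex.norm_real, Real.norm_eq_abs, abs_of_pos (hM _),
    div_le_iff₀ (hM _)]
  exact hf _ _

theorem mem_wordBall_norm_gaugeMap {M : ℕ → ℝ} (hM : ∀ m, 0 < M m) (f : gaugeSubmodule d M) :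
    (f : Sch d) ∈ wordBall d fun m => ‖gaugeMap hM f‖ * M m := fun w x => by
  have h : ‖word w (f : Sch d) x / (M w.length : ℂ)‖ ≤ ‖gaugeMap hM f‖ :=
    (gaugeMap hM f).norm_coe_le_norm ((w, x) : WordIndex d)
  rwa [norm_div, Complex.norm_real, Real.norm_eq_abs, abs_of_pos (hM _),
    div_le_iff₀ (hM _)] at h

/-- A bounded functional extends to the space of bounded families. -/
theorem exists_extension_gaugeMap {M : ℕ → ℝ} (hM : ∀ m, 0 < M m) {v : Sch d →ₗ[ℂ] ℂ} {C : ℝ}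
    (hC : ∀ f ∈ wordBall d M, ‖v f‖ ≤ C) :
    ∃ g : StrongDual ℂ (BoundedContinuousFunction (WordIndex d) ℂ),
      ∀ f : gaugeSubmodule d M, g (gaugeMap hM f) = v f := by
  have hinj : Function.Injective (gaugeMap (d := d) hM) := by
    refine (injective_iff_map_eq_zero _).2 fun f hf => Subtype.ext ?_
    ext x
    have h : word [] (f : Sch d) x / (M 0 : ℂ) = 0 :=
      congrArg (fun F : BoundedContinuousFunction (WordIndex d) ℂ =>
        F (([], x) : WordIndex d)) hf
    simpa [(hM 0).ne'] using h
  obtain ⟨e, he⟩ : ∃ e : gaugeSubmodule d M ≃ₗ[ℂ] LinearMap.range (gaugeMap (d := d) hM),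
      ∀ f, (e f : BoundedContinuousFunction (WordIndex d) ℂ) = gaugeMap hM f :=
    ⟨LinearEquiv.ofInjective _ hinj, fun f => LinearEquiv.ofInjective_apply _ f⟩
  let φ : LinearMap.range (gaugeMap (d := d) hM) →ₗ[ℂ] ℂ :=
    (v.comp (gaugeSubmodule d M).subtype).comp e.symm.toLinearMap
  have hφe : ∀ f, φ (e f) = v f := fun f => congrArg (fun f => v f.1) (e.symm_apply_apply f)
  have hφ : ∀ F, ‖φ F‖ ≤ C * ‖F‖ := fun F => by
    -- The norm of `gaugeMap hM f` is the best constant for f with respect to M, so v is bounded by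
    -- C on the image, and Hahn–Banach applies below.
    obtain ⟨f, rfl⟩ := e.surjective F
    have h := norm_map_le_of_mem_wordBall_mul hC (norm_nonneg _) (mem_wordBall_norm_gaugeMap hM f)
    rw [mul_comm, hφe, Submodule.coe_norm, he]
    exact h
  obtain ⟨g, hg, -⟩ := exists_extension_norm_eq _ (φ.mkContinuous C hφ)
  refine ⟨g, fun f => ?_⟩
  have h := hg (e f)
  rwa [he, LinearMap.mkContinuous_apply, hφe] at h

/-- Through `gaugeMap`, x ↦ Φ(x, ·) becomes an integrable curve in a Banach space of bounded
families, and v becomes the restriction of a continuous functional, which commutes with the Bochner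
integral. The integral is identified with k by evaluating at each word and point. -/
theorem map_eq_integral_slice {𝒲 : Set (ℕ → ℝ)} (h𝒲 : WeightClass 𝒲) {v : Sch d →ₗ[ℂ] ℂ}
    (hv : BoundedOn 𝒲 v) {Φ : Sch (d + d)} (hΦ : Φ ∈ h𝒲.carrier (d + d)) {k : Sch d}
    (hk : k ∈ h𝒲.carrier d) (hkΦ : ∀ y, k y = ∫ x, Φ (join x y)) : v k = ∫ x, v (slice x Φ) := by
  obtain ⟨M₀, hM₀, hΦ⟩ := hΦ
  obtain ⟨N, hN, hkN⟩ := hk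
  -- The final M has to dominate three weights: d M₀(m + 1) for the Lipschitz bound of the curve,
  -- the decay weight for its integrability, and N for membership of k.
  obtain ⟨M₁, hM₁, -, h1, h2⟩ := h𝒲.exists_common (h𝒲.const_mul (h𝒲.shift hM₀) d.cast_nonneg)
    (h𝒲.decay (d + d) (d + 1) hM₀)
  obtain ⟨M, hM, hpos, h3, h4⟩ := h𝒲.exists_common hM₁ hN
  obtain ⟨C, hC⟩ := hv M hM
  obtain ⟨g, hg⟩ := exists_extension_gaugeMap hpos hC
  have hdec : ∀ x, slice x Φ ∈ wordBall d fun m => (1 + ‖x‖) ^ (-((d + 1 : ℕ) : ℝ)) * M m := by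
    intro x w y
    rw [word_slice, slice_apply]
    have h := norm_join_le_left (word_mem_wordBall hΦ (w.map rightLetter)) (d + 1) x y
    rw [List.length_map] at h
    refine h.trans ?_
    rw [mul_comm]
    exact mul_le_mul_of_nonneg_left ((h2 _).trans (h3 _)) (by positivity)
  have hmem : ∀ x, slice x Φ ∈ gaugeSubmodule d M := fun x => ⟨_, by positivity, hdec x⟩
  have hkmem : k ∈ gaugeSubmodule d M :=
    ⟨1, zero_le_one, wordBall_mono (fun m => by simpa using h4 m) hkN⟩
  let J : Euc d → BoundedContinuousFunction (WordIndex d) ℂ := fun x => gaugeMap hpos ⟨_, hmem x⟩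
  -- Continuity supplies strong measurability; the target need not be separable.
  have hJc : Continuous J := by
    refine (LipschitzWith.of_dist_le_mul (K := 1) fun x' x => ?_).continuous
    rw [dist_eq_norm, dist_eq_norm, NNReal.coe_one, one_mul]
    simp only [J]
    rw [← map_sub]
    refine norm_gaugeMap_le hpos _ (norm_nonneg _) fun w y => ?_
    have h := norm_join_sub_le (word_mem_wordBall hΦ (w.map rightLetter)) x x' y
    rw [List.length_map] at h
    simp only [AddSubgroupClass.coe_sub, map_sub, word_slice, sub_apply, slice_apply]
    refine h.trans ?_
    rw [mul_comm]
    refine mul_le_mul_of_nonneg_left (le_trans (le_of_eq ?_) ((h1 _).trans (h3 _))) (norm_nonneg _)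
    rw [add_comm]
  have hJi : Integrable J := integrable_decay.mono' hJc.aestronglyMeasurable
    (Filter.Eventually.of_forall fun x => norm_gaugeMap_le hpos _ (by positivity) (hdec x))
  have hJ : ∫ x, J x = gaugeMap hpos ⟨k, hkmem⟩ := by
    ext a
    have := (BoundedContinuousFunction.evalCLM ℂ a).integral_comp_comm hJi
    simp only [BoundedContinuousFunction.evalCLM_apply] at this
    rw [← this, gaugeMap_apply, word_eq_integral a.1 hkΦ, ← integral_div]
    rfl
  have h := g.integral_comp_comm hJi
  rw [hJ, hg] at h
  rw [← h]
  exact integral_congr_ae (Filter.Eventually.of_forall fun x => hg ⟨_, hmem x⟩)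

end functionalFubini

/-! ### Integration and evaluation as functionals -/

section functionals

variable {n : ℕ}

/-- The functional `f ↦ ∫ f g`. -/
def pairingS (g : Sch n) : Sch n →ₗ[ℂ] ℂ := (schDist g).toLinearMap

theorem pairingS_apply (g f : Sch n) : pairingS g f = ∫ x, g x * f x := schDist_apply g f

theorem boundedOn_pairingS (𝒲 : Set (ℕ → ℝ)) (g : Sch n) : BoundedOn 𝒲 (pairingS g) := by
  intro M _
  refine ⟨∫ x, ‖g x‖ * M 0, fun f hf => ?_⟩
  rw [pairingS_apply]
  refine norm_integral_le_of_norm_le (g.integrable.norm.mul_const _)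
    (Filter.Eventually.of_forall fun x => ?_)
  rw [norm_mul]
  exact mul_le_mul_of_nonneg_left (norm_le_of_mem_wordBall hf x) (norm_nonneg _)

/-- The functional `f ↦ ∫ f`. -/
def integralS : Sch n →ₗ[ℂ] ℂ := (integralCLM ℂ (volume : Measure (Euc n))).toLinearMap

theorem integralS_apply (f : Sch n) : integralS f = ∫ x, f x := integralCLM_apply ℂ f

theorem norm_integralS_le {M : ℕ → ℝ} {f : Sch n} (hf : f ∈ wordBall n M) :
    ‖integralS f‖ ≤ ∫ x : Euc n, decayConst n (n + 1) M * (1 + ‖x‖) ^ (-((n + 1 : ℕ) : ℝ)) := by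
  rw [integralS_apply]
  exact norm_integral_le_of_norm_le (integrable_decay.const_mul _)
    (Filter.Eventually.of_forall (norm_le_decay (n + 1) hf))

theorem boundedOn_integralS (𝒲 : Set (ℕ → ℝ)) : BoundedOn 𝒲 (integralS (n := n)) :=
  fun _ _ => ⟨_, fun _ hf => norm_integralS_le hf⟩

/-- The functional `f ↦ f(0)`. -/
def evalZeroS : Sch n →ₗ[ℂ] ℂ where
  toFun f := f 0
  map_add' _ _ := rfl
  map_smul' _ _ := rfl

theorem evalZeroS_apply (f : Sch n) : evalZeroS f = f 0 := rfl

theorem boundedOn_evalZeroS (𝒲 : Set (ℕ → ℝ)) : BoundedOn 𝒲 (evalZeroS (n := n)) :=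
  fun M _ => ⟨M 0, fun _ hf => norm_le_of_mem_wordBall hf 0⟩

end functionals

end

section
/-! ### The Gaussian -/

section gaussian

variable {n : ℕ}

/-- The function `x^{us} e^{-|x|²/2}`. -/
def gaussianMonomial (us : List (Fin n)) (x : Euc n) : ℂ :=
  (us.map fun i => (x i : ℂ)).prod * Complex.exp (-(‖x‖ ^ 2 / 2 : ℝ))

theorem gaussianMonomial_cons (i : Fin n) (us : List (Fin n)) (x : Euc n) :
    gaussianMonomial (i :: us) x = (x i : ℂ) * gaussianMonomial us x := by
  simp [gaussianMonomial, mul_assoc]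

/-- The square root of (r²)^k / k! ≤ e^{r²}. This is the source of the exponent 1/2. -/
theorem pow_mul_exp_le_sqrt_factorial (r : ℝ) (k : ℕ) :
    r ^ k * Real.exp (-(r ^ 2 / 2)) ≤ √(k.factorial : ℝ) := by
  refine Real.le_sqrt_of_sq_le ?_
  have h := Real.pow_div_factorial_le_exp (r ^ 2) (sq_nonneg r) k
  rw [div_le_iff₀ (by positivity)] at h
  calc (r ^ k * Real.exp (-(r ^ 2 / 2))) ^ 2 = (r ^ 2) ^ k * Real.exp (-(r ^ 2)) := by
        rw [mul_pow, ← pow_mul, ← pow_mul, mul_comm k, ← Real.exp_nat_mul]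
        congr 2
        push_cast
        ring
    _ ≤ Real.exp (r ^ 2) * k.factorial * Real.exp (-(r ^ 2)) :=
        mul_le_mul_of_nonneg_right h (Real.exp_pos _).le
    _ = k.factorial := by
        rw [mul_right_comm, ← Real.exp_add]
        simp

theorem norm_gaussianMonomial_le (us : List (Fin n)) (x : Euc n) :
    ‖gaussianMonomial us x‖ ≤ √(us.length.factorial : ℝ) := by
  refine le_trans ?_ (pow_mul_exp_le_sqrt_factorial ‖x‖ us.length)
  rw [gaussianMonomial, norm_mul, Complex.norm_exp, Complex.neg_re, Complex.ofReal_re]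
  refine mul_le_mul_of_nonneg_right ?_ (Real.exp_pos _).le
  induction us with
  | nil => simp
  | cons i us ih =>
    rw [List.map_cons, List.prod_cons, norm_mul, List.length_cons, pow_succ', Complex.norm_real]
    exact mul_le_mul (norm_coord_le x i) ih (norm_nonneg _) (norm_nonneg _)

/-- L i lists the monomials obtained by deleting one occurrence of i from us; the exponential
contributes the term with the factor -xᵢ. -/
theorem hasFDerivAt_gaussianMonomial (us : List (Fin n)) :
    ∃ L : Fin n → List (List (Fin n)), (∀ i, (L i).length ≤ us.length ∧
      ∀ vs ∈ L i, vs.length + 1 = us.length) ∧ ∀ x,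
      HasFDerivAt (gaussianMonomial us) (gradOf fun i =>
        ((L i).map fun vs => gaussianMonomial vs x).sum - gaussianMonomial (i :: us) x) x := by
  induction us with
  | nil =>
    refine ⟨fun _ => [], by simp, fun x => ?_⟩
    have h0 : HasFDerivAt (fun x : Euc n => ((-(‖x‖ ^ 2 / 2) : ℝ) : ℂ))
        (gradOf fun i => -(x i : ℂ)) x := by
      have h1 := ((hasStrictFDerivAt_norm_sq x).hasFDerivAt.const_mul (1 / 2 : ℝ)).neg
      have h2 := Complex.ofRealCLM.hasFDerivAt.comp x h1
      have e : (fun x : Euc n => ((-(‖x‖ ^ 2 / 2) : ℝ) : ℂ)) =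
          Complex.ofRealCLM ∘ (-fun y : Euc n => (1 / 2 : ℝ) * ‖y‖ ^ 2) := by
        ext y
        simp
        ring
      rw [e]
      refine HasFDerivAt.gradOf_of_apply h2 fun v => ?_
      simp [PiLp.inner_apply]
    have h := h0.cexp
    have e : gaussianMonomial ([] : List (Fin n)) =
        fun x : Euc n => Complex.exp ((-(‖x‖ ^ 2 / 2) : ℝ) : ℂ) := by
      ext y
      simp [gaussianMonomial]
    rw [e]
    refine HasFDerivAt.gradOf_of_apply h fun v => ?_
    simp [gradOf_apply, gaussianMonomial, Finset.mul_sum]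
    refine Finset.sum_congr rfl fun i _ => ?_
    ring
  | cons j us ih =>
    obtain ⟨L, hL, hd⟩ := ih
    refine ⟨fun i => (if i = j then [us] else []) ++ (L i).map (j :: ·), fun i => ⟨?_, ?_⟩,
      fun x => ?_⟩
    · have := (hL i).1
      by_cases h : i = j
      · simpa [h, add_comm] using (hL j).1
      · simpa [h] using this.trans (Nat.le_succ _)
    · intro vs hvs
      rw [List.mem_append, List.mem_map] at hvs
      rcases hvs with hvs | ⟨ws, hws, rfl⟩
      · split_ifs at hvs <;> simp_all
      · simpa using (hL i).2 ws hws
    · have e : gaussianMonomial (j :: us) = fun x => (x j : ℂ) * gaussianMonomial us x :=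
        funext (gaussianMonomial_cons j us)
      have hj : HasFDerivAt (fun x : Euc n => (x j : ℂ)) (gradOf fun i => if i = j then 1 else 0) x := by
        refine HasFDerivAt.gradOf_of_apply (Complex.ofRealCLM.comp
          (EuclideanSpace.proj j : Euc n →L[ℝ] ℝ)).hasFDerivAt fun v => ?_
        simp
      rw [e]
      refine HasFDerivAt.gradOf_of_apply (HasFDerivAt.mul_gradOf hj (hd x)) fun v => ?_
      simp only [gradOf_apply]
      refine Finset.sum_congr rfl fun i _ => ?_
      congr 1
      simp only [List.map_append, List.sum_append, List.map_map, Function.comp_def,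
        gaussianMonomial_cons, List.sum_map_mul_left]
      split_ifs <;> simp <;> ring

theorem exists_gaussianMonomial (us : List (Fin n)) :
    ∃ g : Sch n, ∀ x, g x = gaussianMonomial us x := by
  refine exists_schwartz_of_span (𝒜 := Set.range gaussianMonomial) ?_ ?_ ?_ ⟨us, rfl⟩
  · rintro _ ⟨us, rfl⟩
    exact ⟨_, norm_gaussianMonomial_le us⟩
  · rintro _ ⟨us, rfl⟩ i
    exact Submodule.subset_span ⟨i :: us, funext (gaussianMonomial_cons i us)⟩
  · rintro _ ⟨us, rfl⟩
    obtain ⟨L, -, hL⟩ := hasFDerivAt_gaussianMonomial us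
    refine ⟨fun i x => ((L i).map fun vs => gaussianMonomial vs x).sum -
      gaussianMonomial (i :: us) x, fun i => ?_, hL⟩
    have e : (fun x => ((L i).map fun vs => gaussianMonomial vs x).sum -
        gaussianMonomial (i :: us) x) = ((L i).map gaussianMonomial).sum -
        gaussianMonomial (i :: us) := by
      ext x
      rw [Pi.sub_apply]
      congr 1
      generalize L i = l
      induction l with
      | nil => rfl
      | cons a l ih => simp [ih]
    beta_reduce
    rw [e]
    refine Submodule.sub_mem _ (list_sum_mem fun G hG => ?_) (Submodule.subset_span ⟨_, rfl⟩)
    obtain ⟨vs, -, rfl⟩ := List.mem_map.1 hG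
    exact Submodule.subset_span ⟨vs, rfl⟩

/-- The function `x^{us} e^{-|x|²/2}` as a Schwartz function. -/
def gaussianS (us : List (Fin n)) : Sch n := (exists_gaussianMonomial us).choose

theorem gaussianS_apply (us : List (Fin n)) (x : Euc n) : gaussianS us x = gaussianMonomial us x :=
  (exists_gaussianMonomial us).choose_spec x

theorem coordMul_gaussianS (i : Fin n) (us : List (Fin n)) :
    coordMul i (gaussianS us) = gaussianS (i :: us) := by
  ext x
  rw [coordMul_apply, gaussianS_apply, gaussianS_apply, gaussianMonomial_cons]

theorem exists_pderiv_gaussianS (i : Fin n) (us : List (Fin n)) :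
    ∃ L : List (List (Fin n)), L.length ≤ us.length ∧ (∀ vs ∈ L, vs.length + 1 = us.length) ∧
      pderiv i (gaussianS us) = (L.map gaussianS).sum - gaussianS (i :: us) := by
  obtain ⟨L, hL, hd⟩ := hasFDerivAt_gaussianMonomial us
  refine ⟨L i, (hL i).1, (hL i).2, ?_⟩
  ext x
  have h := hd x
  rw [← funext (gaussianS_apply us)] at h
  rw [pderiv_eq_of_hasFDerivAt h i, sub_apply, gaussianS_apply]
  congr 1
  generalize L i = l
  induction l with
  | nil => simp
  | cons a l ih => simp [ih, gaussianS_apply]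

/-- A derivative letter yields one longer monomial and at most |us| shorter ones. With |w| + |us| =
k + 1 for the remaining word w, the shorter ones contribute at most (k + 1) √(k!) ≤ √((k + 2)!), so
each letter costs a factor 2. -/
theorem norm_word_gaussianS_le (w : List (Letter n)) (us : List (Fin n)) (x : Euc n) :
    ‖word w (gaussianS us) x‖ ≤ 2 ^ w.length * √((w.length + us.length).factorial : ℝ) := by
  induction w generalizing us with
  | nil => simpa [gaussianS_apply] using norm_gaussianMonomial_le us x
  | cons l w ih =>
    have h0 : ∀ i, ‖word w (gaussianS (i :: us)) x‖ ≤
        2 ^ w.length * √((w.length + 1 + us.length).factorial : ℝ) := fun i => by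
      convert ih (i :: us) using 5
      simp only [List.length_cons]
      omega
    rw [word_cons, List.length_cons, pow_succ, mul_two, add_mul]
    rcases l with i | i
    · rw [letter_inl, coordMul_gaussianS]
      exact (h0 i).trans (le_add_of_nonneg_left (by positivity))
    · obtain ⟨L, hL, hL', e⟩ := exists_pderiv_gaussianS i us
      rw [letter_inr, e, map_sub, sub_apply]
      refine (norm_sub_le _ _).trans (add_le_add ?_ (h0 i))
      have h1 : ∀ vs ∈ L, ‖word w (gaussianS vs) x‖ ≤
          2 ^ w.length * √((w.length + us.length - 1).factorial : ℝ) := fun vs hvs => by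
        convert ih vs using 5
        have := hL' vs hvs
        omega
      have h2 : ‖word w (L.map gaussianS).sum x‖ ≤
          L.length * (2 ^ w.length * √((w.length + us.length - 1).factorial : ℝ)) := by
        clear hL hL' e
        induction L with
        | nil => simp
        | cons a L ihL =>
          rw [List.map_cons, List.sum_cons, map_add, add_apply, List.length_cons]
          push_cast
          rw [add_mul, one_mul, add_comm (_ * _)]
          exact (norm_add_le _ _).trans (add_le_add (h1 a List.mem_cons_self)
            (ihL fun vs hvs => h1 vs (List.mem_cons_of_mem _ hvs)))
      refine h2.trans ?_
      rw [mul_left_comm]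
      refine mul_le_mul_of_nonneg_left ?_ (by positivity)
      -- For empty us there are no shorter monomials, so the truncated subtraction in the factorial
      -- does no harm.
      rcases Nat.eq_zero_or_pos us.length with h3 | h3
      · have : L.length = 0 := by omega
        rw [this]
        simp
      · obtain ⟨k, hk⟩ : ∃ k, w.length + us.length = k + 1 := ⟨w.length + us.length - 1, by omega⟩
        have h4 : (L.length : ℝ) ≤ k + 1 := by
          have : L.length ≤ k + 1 := by omega
          exact_mod_cast this
        rw [hk, Nat.add_sub_cancel, show w.length + 1 + us.length = k + 2 by omega]
        refine Real.le_sqrt_of_sq_le ?_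
        rw [mul_pow, Real.sq_sqrt (by positivity), Nat.factorial_succ (k + 1), Nat.factorial_succ k]
        push_cast
        rw [← mul_assoc]
        refine mul_le_mul_of_nonneg_right ?_ (by positivity)
        nlinarith [L.length.cast_nonneg (α := ℝ), k.cast_nonneg (α := ℝ)]

theorem gaussianS_mem_wordBall :
    gaussianS ([] : List (Fin n)) ∈ wordBall n fun m => 2 ^ m * √(m.factorial : ℝ) :=
  fun w x => by simpa using norm_word_gaussianS_le w [] x

theorem gaussianS_nil_apply (x : Euc n) : gaussianS [] x = (Real.exp (-(1 / 2) * ‖x‖ ^ 2) : ℂ) := by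
  rw [gaussianS_apply, gaussianMonomial]
  simp
  ring_nf

theorem integral_gaussianS_ne_zero : ∫ x : Euc n, gaussianS [] x ≠ 0 := by
  simp only [gaussianS_nil_apply]
  have h := GaussianFourier.integral_rexp_neg_mul_sq_norm (V := Euc n) (b := 1 / 2) (by norm_num)
  rw [integral_complex_ofReal, h, Complex.ofReal_ne_zero]
  positivity

end gaussian

end

/-! ### Regularization by shears, and density of test functions -/

section
/-! ### Shears -/

section shear

variable {n : ℕ}

/-- The derivative of `Ψ` along the linear vector field `N`. -/
def alongField (N : Euc n →L[ℝ] Euc n) (Ψ : Sch n) : Sch n :=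
  ∑ i, ∑ j, ((N (EuclideanSpace.single j 1) i : ℝ) : ℂ) • coordMul j (pderiv i Ψ)

theorem alongField_apply (N : Euc n →L[ℝ] Euc n) (Ψ : Sch n) (z : Euc n) :
    alongField N Ψ z = gradOf (fun i => pderiv i Ψ z) (N z) := by
  have hz : z = ∑ j, z j • EuclideanSpace.single j (1 : ℝ) := by
    ext j
    simp [Finset.sum_apply, Pi.single_apply]
  rw [gradOf_apply, alongField]
  simp only [sum_apply, smul_apply, coordMul_apply, smul_eq_mul]
  refine Finset.sum_congr rfl fun i _ => ?_
  conv_rhs => rw [hz, map_sum]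
  simp only [map_smul, WithLp.ofLp_sum, WithLp.ofLp_smul, Finset.sum_apply, Pi.smul_apply, smul_eq_mul,
    Complex.ofReal_sum, Complex.ofReal_mul, Finset.sum_mul]
  rw [← hz]
  exact Finset.sum_congr rfl fun j _ => by ring

/-- The maps `1 + t η N`. -/
def shearFamily (N : Euc n →L[ℝ] Euc n) (hN : ∀ z, N (N z) = 0) (η : ℝ) : LinearFamily n where
  map t := ContinuousLinearMap.id ℝ _ + (t * η) • N
  inv t := ContinuousLinearMap.id ℝ _ - (t * η) • N
  continuous_map := by fun_prop
  continuous_inv := by fun_prop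
  inv_map t z := by simp [hN]

theorem shearFamily_boundedBy (N : Euc n →L[ℝ] Euc n) (hN : ∀ z, N (N z) = 0) {η : ℝ}
    (hη : η ∈ Set.Icc (0 : ℝ) 1) : (shearFamily N hN η).BoundedBy (1 + ‖N‖) := fun t ht => by
  have h : ‖(t * η) • N‖ ≤ ‖N‖ := by
    rw [norm_smul, Real.norm_eq_abs, abs_of_nonneg (mul_nonneg ht.1 hη.1)]
    exact mul_le_of_le_one_left (norm_nonneg _) (mul_le_one₀ ht.2 hη.1 hη.2)
  exact ⟨(norm_add_le _ _).trans (add_le_add ContinuousLinearMap.norm_id_le h),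
    (norm_sub_le _ _).trans (add_le_add ContinuousLinearMap.norm_id_le h)⟩

/-- The fundamental theorem of calculus along t ↦ z + tηNz. As N² = 0, the field N takes the value N
z at every point of this segment. -/
theorem add_mul_avg_shearFamily (N : Euc n →L[ℝ] Euc n) (hN : ∀ z, N (N z) = 0) (η : ℝ) (Ψ : Sch n)
    (z : Euc n) : Ψ z + η * (shearFamily N hN η).avg 1 (alongField N Ψ) z = Ψ (z + η • N z) := by
  have hd : ∀ t : ℝ, HasDerivAt (fun t : ℝ => Ψ (z + (t * η) • N z))
      (η * alongField N Ψ (z + (t * η) • N z)) t := fun t => by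
    have h1 : HasDerivAt (fun t : ℝ => z + (t * η) • N z) (η • N z) t := by
      simpa using (((hasDerivAt_id t).mul_const η).smul_const (N z)).const_add z
    have h2 := (hasFDerivAt_gradOf Ψ (z + (t * η) • N z)).comp_hasDerivAt t h1
    rw [alongField_apply, map_add, map_smul, hN, smul_zero, add_zero]
    refine h2.congr_deriv ?_
    rw [map_smul, Complex.real_smul]
  have h := intervalIntegral.integral_eq_sub_of_hasDerivAt (a := 0) (b := 1) (fun t _ => hd t)
    (Continuous.intervalIntegrable (by have := (alongField N Ψ).continuous; fun_prop) _ _)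
  rw [intervalIntegral.integral_const_mul, intervalIntegral.integral_of_le zero_le_one] at h
  rw [LinearFamily.avg_one_apply]
  simp only [one_mul, zero_mul, zero_smul, add_zero] at h
  rw [eq_sub_iff_add_eq'] at h
  exact h

theorem alongField_mem_wordBall (N : Euc n →L[ℝ] Euc n) {M : ℕ → ℝ} {Ψ : Sch n}
    (hΨ : Ψ ∈ wordBall n M) : alongField N Ψ ∈ wordBall n fun m => n * (n * (‖N‖ * M (m + 2))) := by
  refine wordBall_mono (fun m => le_of_eq ?_) (sum_mem_wordBall (M := fun _ m => n * (‖N‖ * M (m + 2)))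
    Finset.univ fun i _ => wordBall_mono (fun m => le_of_eq ?_)
    (sum_mem_wordBall (M := fun _ m => ‖N‖ * M (m + 2)) Finset.univ fun j _ w x => ?_))
  · simp
  · simp
  · have h := letter_mem_wordBall (letter_mem_wordBall hΨ (Sum.inr i)) (Sum.inl j) w x
    rw [map_smul, smul_apply, norm_smul, Complex.norm_real]
    refine mul_le_mul ((norm_coord_le _ i).trans ((N.le_opNorm _).trans (by simp))) h
      (norm_nonneg _) (norm_nonneg _)

/-- A shear by ηN differs from the identity by η times an error in a ball that does not depend on η.
Multiplication by g(η·) and convolution with dilates of g are both obtained from shears of tensor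
products. -/
theorem WeightClass.exists_shear_bound {𝒲 : Set (ℕ → ℝ)} (h𝒲 : WeightClass 𝒲)
    (N : Euc n →L[ℝ] Euc n) (hN : ∀ z, N (N z) = 0) {M : ℕ → ℝ} (hM : M ∈ 𝒲) :
    ∃ P ∈ 𝒲, ∀ η ∈ Set.Icc (0 : ℝ) 1, ∀ Ψ ∈ wordBall n M, ∃ Δ ∈ wordBall n P,
      ∀ z, Ψ z + η * Δ z = Ψ (z + η • N z) := by
  obtain ⟨P, hP, h⟩ := h𝒲.exists_avg_bound (n := n) (1 + ‖N‖)
    (M := fun m => n * (n * (‖N‖ * M (m + 2))))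
    (h𝒲.const_mul (h𝒲.const_mul (h𝒲.const_mul (h𝒲.shift_add hM 2) (norm_nonneg _))
      n.cast_nonneg) n.cast_nonneg)
  exact ⟨P, hP, fun η hη Ψ hΨ => ⟨_, h _ (shearFamily_boundedBy N hN hη) _
    (alongField_mem_wordBall N hΨ), add_mul_avg_shearFamily N hN η Ψ⟩⟩

/-- The composition with a linear map that has a left inverse. -/
theorem WeightClass.exists_comp {𝒲 : Set (ℕ → ℝ)} (h𝒲 : WeightClass 𝒲) (A A' : Euc n →L[ℝ] Euc n)
    (hA : ∀ z, A' (A z) = z) {Ψ : Sch n} (hΨ : Ψ ∈ h𝒲.carrier n) :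
    ∃ Φ ∈ h𝒲.carrier n, ∀ z, Φ z = Ψ (A z) := by
  -- The average of a family that is constant in t is the substitution itself.
  let F : LinearFamily n := ⟨fun _ => A, fun _ => A', continuous_const, continuous_const, fun _ => hA⟩
  obtain ⟨M, hM, hΨ⟩ := hΨ
  obtain ⟨L, hL⟩ := F.exists_boundedBy
  obtain ⟨P, hP, h⟩ := h𝒲.exists_avg_bound (n := n) L hM
  refine ⟨F.avg 1 Ψ, ⟨P, hP, h F hL Ψ hΨ⟩, fun z => ?_⟩
  rw [F.avg_one_apply]
  simp [F]

end shear

/-! ### Approximation of functionals by test functions -/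

section density

variable {d : ℕ} {𝒲 : Set (ℕ → ℝ)} {v : Sch d →ₗ[ℂ] ℂ}

theorem WeightClass.exists_slicePairing_bound (h𝒲 : WeightClass 𝒲) (hv : BoundedOn 𝒲 v) {M : ℕ → ℝ}
    (hM : M ∈ 𝒲) : ∃ P ∈ 𝒲, ∀ Ψ ∈ wordBall (d + d) M, slicePairing v Ψ ∈ wordBall d P := by
  obtain ⟨M', hM', hpos, hsplit⟩ := h𝒲.split hM
  obtain ⟨C, hC⟩ := hv M' hM'
  have hC0 : 0 ≤ C := (norm_nonneg _).trans (hC 0 (zero_mem_wordBall fun m => (hpos m).le))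
  exact ⟨_, h𝒲.const_mul hM' hC0, fun Ψ hΨ =>
    slicePairing_mem_wordBall h𝒲 hv hM hpos hsplit hC hΨ⟩

@[simp] theorem inlL_apply (x : Euc d) : inlL x = join x 0 := by
  rw [← inlL_add_inrL, map_zero, add_zero]

@[simp] theorem inrL_apply (x : Euc d) : inrL x = join 0 x := by
  rw [← inlL_add_inrL, map_zero, zero_add]

theorem neg_join (x y : Euc d) : -join x y = join (-x) (-y) := by
  simp only [← inlL_add_inrL, map_neg, neg_add]

theorem join_add_join (x y x' y' : Euc d) : join x y + join x' y' = join (x + x') (y + y') := by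
  simp only [← inlL_add_inrL, map_add]
  abel

theorem smul_join (c : ℝ) (x y : Euc d) : c • join x y = join (c • x) (c • y) := by
  simp only [← inlL_add_inrL, map_smul, smul_add]

theorem join_zero_zero : join (0 : Euc d) 0 = 0 := by
  rw [← inlL_apply, map_zero]

/-- Multiplication by `g(η ·)`, for the Gaussian `g`. -/
theorem WeightClass.exists_gaussian_mul (h𝒲 : WeightClass 𝒲) {M : ℕ → ℝ} (hM : M ∈ 𝒲) :
    ∃ P ∈ 𝒲, ∀ η ∈ Set.Icc (0 : ℝ) 1, ∀ ψ ∈ wordBall d M, ∃ δ ∈ wordBall d P,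
      ∀ x, ψ x + η * δ x = ψ x * gaussianS [] (η • x) := by
  obtain ⟨M₁, hM₁, h1⟩ := h𝒲.exists_tensor_bound hM h𝒲.gaussian
  -- The shear (x, y) ↦ (x, y + ηx) of ψ ⊗ g, evaluated at y = 0, is ψ(x) g(ηx); also g(0) = 1.
  obtain ⟨M₂, hM₂, h2⟩ := h𝒲.exists_shear_bound ((inrL (d := d)).comp positionL)
    (fun z => by simp [join_zero_zero]) hM₁
  obtain ⟨P, hP, h3⟩ := h𝒲.exists_slicePairing_bound (boundedOn_evalZeroS 𝒲) hM₂
  refine ⟨P, hP, fun η hη ψ hψ => ?_⟩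
  obtain ⟨Δ, hΔ, h⟩ := h2 η hη _ (h1 d ψ _ hψ gaussianS_mem_wordBall)
  refine ⟨_, h3 Δ hΔ, fun x => ?_⟩
  have := h (join x 0)
  rw [slicePairing_apply h𝒲 (boundedOn_evalZeroS 𝒲) ⟨M₂, hM₂, hΔ⟩, evalZeroS_apply]
  simpa [tensor_apply, join_add_join, smul_join, gaussianS_nil_apply] using this

/-- Convolution with the dilations of the Gaussian. -/
theorem WeightClass.exists_gaussian_conv (h𝒲 : WeightClass 𝒲) {M : ℕ → ℝ} (hM : M ∈ 𝒲) :
    ∃ P ∈ 𝒲, ∀ η ∈ Set.Icc (0 : ℝ) 1, ∀ χ ∈ wordBall d M, ∃ δ ∈ wordBall d P, ∀ x,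
      χ x + η * δ x =
        (∫ y : Euc d, gaussianS [] y)⁻¹ * ∫ y, χ (x - η • y) * gaussianS [] y := by
  set c : ℂ := (∫ y : Euc d, gaussianS [] y)⁻¹ with hc
  obtain ⟨M₁, hM₁, h1⟩ := h𝒲.exists_tensor_bound hM h𝒲.gaussian
  -- The shear (x, y) ↦ (x - ηy, y) of χ ⊗ g, integrated over y, is the convolution; the constant c
  -- normalizes ∫ g.
  obtain ⟨M₂, hM₂, h2⟩ := h𝒲.exists_shear_bound ((inlL (d := d)).comp (-frequencyL))
    (fun z => by simp [neg_join, join_zero_zero]) hM₁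
  obtain ⟨P, hP, h3⟩ := h𝒲.exists_slicePairing_bound (boundedOn_integralS 𝒲) hM₂
  refine ⟨_, h𝒲.const_mul hP (norm_nonneg c), fun η hη χ hχ => ?_⟩
  obtain ⟨Δ, hΔ, h⟩ := h2 η hη _ (h1 d χ _ hχ gaussianS_mem_wordBall)
  refine ⟨_, smul_mem_wordBall (h3 Δ hΔ) c, fun x => ?_⟩
  rw [smul_apply, slicePairing_apply h𝒲 (boundedOn_integralS 𝒲) ⟨M₂, hM₂, hΔ⟩, integralS_apply]
  have e : ∀ y, χ (x - η • y) * gaussianS [] y = χ x * gaussianS [] y + η * slice x Δ y := fun y => by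
    have := h (join x y)
    rw [slice_apply]
    simpa [tensor_apply, neg_join, join_add_join, smul_join, sub_eq_add_neg] using this.symm
  simp only [e]
  rw [integral_add ((gaussianS []).integrable.const_mul _) ((slice x Δ).integrable.const_mul _),
    integral_const_mul, integral_const_mul, smul_eq_mul, mul_add, mul_left_comm c (χ x), hc,
    inv_mul_cancel₀ integral_gaussianS_ne_zero]
  ring

theorem integral_comp_sub_smul (F : Euc d → ℂ) (x : Euc d) {η : ℝ} (hη : 0 < η) :
    ∫ y, F (x - η • y) = ((η ^ d)⁻¹ : ℝ) * ∫ q, F q := by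
  have h := Measure.integral_comp_smul volume (fun y => F (x - y)) η
  rw [h, integral_sub_left_eq_self F volume x, finrank_euclideanSpace_fin, Complex.real_smul,
    abs_of_pos (by positivity)]

/-- Approximation of a functional by test functions, uniformly on bounded sets. -/
theorem exists_approx (h𝒲 : WeightClass 𝒲) {𝒜 : Set (ℕ → ℝ)} (h𝒜 : WeightClass 𝒜) (hsub : 𝒜 ⊆ 𝒲)
    (hv : BoundedOn 𝒲 v) {M : ℕ → ℝ} (hM : M ∈ 𝒲) {ε : ℝ} (hε : 0 < ε) :
    ∃ f ∈ h𝒜.carrier d, ∀ ψ ∈ wordBall d M, ‖v ψ - ∫ x, f x * ψ x‖ ≤ ε := by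
  obtain ⟨P₁, hP₁, h1⟩ := h𝒲.exists_gaussian_mul (d := d) hM
  obtain ⟨P₂, hP₂, h2⟩ := h𝒲.exists_gaussian_conv (d := d) (h𝒲.add hM hP₁)
  obtain ⟨C, hC⟩ := hv _ (h𝒲.add hP₁ hP₂)
  -- C bounds v on the sum of the two errors, so the total error ηC is at most ε.
  obtain ⟨η, hη, hη1, hηC⟩ : ∃ η : ℝ, 0 < η ∧ η ≤ 1 ∧ η * C ≤ ε := by
    refine ⟨min 1 (ε / (|C| + 1)), by positivity, min_le_left _ _, ?_⟩
    calc min 1 (ε / (|C| + 1)) * C ≤ min 1 (ε / (|C| + 1)) * (|C| + 1) :=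
          mul_le_mul_of_nonneg_left ((le_abs_self C).trans (by simp)) (by positivity)
      _ ≤ ε / (|C| + 1) * (|C| + 1) := mul_le_mul_of_nonneg_right (min_le_right _ _) (by positivity)
      _ = ε := div_mul_cancel₀ _ (by positivity)
  set c : ℂ := (∫ y : Euc d, gaussianS [] y)⁻¹ with hc
  have hg : ∀ {𝒰 : Set (ℕ → ℝ)} (h : WeightClass 𝒰), gaussianS [] ∈ h.carrier d := fun h =>
    ⟨_, h.gaussian, gaussianS_mem_wordBall⟩
  have htensor : ∀ {𝒰 : Set (ℕ → ℝ)} (h : WeightClass 𝒰) {f g : Sch d}, f ∈ h.carrier d →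
      g ∈ h.carrier d → tensor f g ∈ h.carrier (d + d) := by
    rintro 𝒰 h f g ⟨M, hM, hf⟩ ⟨N, hN, hg⟩
    obtain ⟨P, hP, h⟩ := h.exists_tensor_bound hM hN
    exact ⟨P, hP, h d f g hf hg⟩
  -- R₀(x, y) = g(ηx) g((y - x)/η). The approximant is f(x) = v(c η^{-d} R₀(x, ·)), a test function
  -- of the small class because R₀ is one.
  obtain ⟨R₀, hR₀, hR₀e⟩ := h𝒜.exists_comp
    ((inlL (d := d)).comp (η • positionL) + (inrL).comp (η⁻¹ • (frequencyL - positionL)))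
    ((inlL (d := d)).comp (η⁻¹ • positionL) + (inrL).comp (η⁻¹ • positionL + η • frequencyL))
    (fun z => by
      simp only [add_apply, ContinuousLinearMap.comp_apply, inlL_add_inrL]
      conv_rhs => rw [← join_position_frequency z]
      simp [hη.ne'])
    (htensor h𝒜 (hg h𝒜) (hg h𝒜))
  have hR : (c * ((η ^ d)⁻¹ : ℝ)) • R₀ ∈ h𝒜.carrier (d + d) := Submodule.smul_mem _ _ hR₀
  have hv𝒜 : BoundedOn 𝒜 v := fun M hM => hv M (hsub hM)
  refine ⟨slicePairing v ((c * ((η ^ d)⁻¹ : ℝ)) • R₀), ?_, fun ψ hψ => ?_⟩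
  · obtain ⟨N, hN, hR⟩ := hR
    obtain ⟨P, hP, h⟩ := h𝒜.exists_slicePairing_bound hv𝒜 hN
    exact ⟨P, hP, h _ hR⟩
  · obtain ⟨δ₁, hδ₁, e1⟩ := h1 η ⟨hη.le, hη1⟩ ψ hψ
    have hχ : ψ + (η : ℂ) • δ₁ ∈ wordBall d fun m => M m + P₁ m := by
      refine fun w x => (add_mem_wordBall hψ (smul_mem_wordBall hδ₁ (η : ℂ)) w x).trans ?_
      refine add_le_add le_rfl (mul_le_of_le_one_left (nonneg_of_mem_wordBall hδ₁ w) ?_)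
      simpa [abs_of_pos hη] using hη1
    obtain ⟨δ₂, hδ₂, e2⟩ := h2 η ⟨hη.le, hη1⟩ _ hχ
    -- Φ₀(x, y) = χ(x) g((y - x)/η) with χ = ψ g(η·). Its normalized integral over x is the
    -- regularization ψ + η(δ₁ + δ₂), while its slices are ψ(x) R₀(x, ·).
    obtain ⟨Φ₀, hΦ₀, hΦ₀e⟩ := h𝒲.exists_comp
      ((inlL (d := d)).comp positionL + (inrL).comp (η⁻¹ • (frequencyL - positionL)))
      ((inlL (d := d)).comp positionL + (inrL).comp (positionL + η • frequencyL))
      (fun z => by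
        simp only [add_apply, ContinuousLinearMap.comp_apply, inlL_add_inrL]
        conv_rhs => rw [← join_position_frequency z]
        simp [hη.ne'])
      (htensor h𝒲 ⟨_, h𝒲.add hM hP₁, hχ⟩ (hg h𝒲))
    have key := map_eq_integral_slice h𝒲 hv (Φ := (c * ((η ^ d)⁻¹ : ℝ)) • Φ₀)
      (k := ψ + (η : ℂ) • (δ₁ + δ₂)) (Submodule.smul_mem _ _ hΦ₀)
      (Submodule.add_mem _ ⟨M, hM, hψ⟩ (Submodule.smul_mem _ _
        ⟨_, h𝒲.add hP₁ hP₂, add_mem_wordBall hδ₁ hδ₂⟩)) fun y => by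
        have e3 := integral_comp_sub_smul (fun q => (ψ + (η : ℂ) • δ₁) q *
          gaussianS [] (η⁻¹ • (y - q))) y hη
        have e4 := e2 y
        simp only [sub_sub_cancel, inv_smul_smul₀ hη.ne'] at e3
        rw [e3] at e4
        simp only [smul_apply, smul_eq_mul, hΦ₀e, tensor_apply]
        rw [integral_const_mul]
        simp only [add_apply, ContinuousLinearMap.comp_apply, inlL_add_inrL] at e4 ⊢
        simp only [smul_apply, smul_eq_mul, positionL_apply, position_join, frequency_join, sub_apply,
          frequencyL_apply] at e4 ⊢
        rw [mul_assoc, ← e4]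
        simp
        ring
    have e5 : ∀ x, v (slice x ((c * ((η ^ d)⁻¹ : ℝ)) • Φ₀)) =
        slicePairing v ((c * ((η ^ d)⁻¹ : ℝ)) • R₀) x * ψ x := fun x => by
      rw [slicePairing_apply h𝒜 hv𝒜 hR, mul_comm (v _), ← smul_eq_mul (ψ x), ← map_smul]
      congr 1
      ext y
      have := e1 x
      simp only [slice_apply, smul_apply, smul_eq_mul, hΦ₀e, hR₀e, tensor_apply, add_apply,
        ContinuousLinearMap.comp_apply, inlL_apply, inrL_apply, join_add_join, position_join,
        frequency_join, zero_add, add_zero, positionL_apply, this]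
      ring
    simp only [e5] at key
    rw [← key, map_add, map_smul, sub_add_cancel_left, norm_neg, norm_smul, Complex.norm_real,
      Real.norm_eq_abs, abs_of_pos hη]
    exact (mul_le_mul_of_nonneg_left (hC _ (add_mem_wordBall hδ₁ hδ₂)) hη.le).trans hηC

end density

end

section
/-! ### The Born-Jordan distribution and its adjoint operation -/

section adjoint

variable {d : ℕ}

/-- The maps `(x, y) ↦ (x + t y, x - (1 - t) y)`. -/
def wignerFamily (d : ℕ) : LinearFamily (d + d) where
  map t := (inlL (d := d)).comp (positionL + t • frequencyL) +
    inrL.comp (positionL - (1 - t) • frequencyL)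
  inv t := (inlL (d := d)).comp ((1 - t) • positionL + t • frequencyL) +
    inrL.comp (positionL - frequencyL)
  continuous_map := by fun_prop
  continuous_inv := by fun_prop
  inv_map t z := by
    conv_rhs => rw [← join_position_frequency z]
    simp only [add_apply, ContinuousLinearMap.comp_apply, inlL_add_inrL, sub_apply, smul_apply,
      positionL_apply, frequencyL_apply, position_join, frequency_join]
    congr 1 <;> module

theorem wignerFamily_map_join (t : ℝ) (x y : Euc d) :
    (wignerFamily d).map t (join x y) = join (x + t • y) (x - (1 - t) • y) := by
  simp only [wignerFamily, add_apply, ContinuousLinearMap.comp_apply, inlL_add_inrL, sub_apply,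
    smul_apply, positionL_apply, frequencyL_apply, position_join, frequency_join]

/-- The inverses of the maps `(x, y) ↦ (x + t y, x - (1 - t) y)`. -/
def wignerFamilyInv (d : ℕ) : LinearFamily (d + d) where
  map := (wignerFamily d).inv
  inv := (wignerFamily d).map
  continuous_map := (wignerFamily d).continuous_inv
  continuous_inv := (wignerFamily d).continuous_map
  inv_map t z := by
    conv_rhs => rw [← join_position_frequency z]
    simp only [wignerFamily, add_apply, ContinuousLinearMap.comp_apply, inlL_add_inrL, sub_apply,
      smul_apply, positionL_apply, frequencyL_apply, position_join, frequency_join]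
    congr 1 <;> module

theorem measurableEmbedding_wignerFamily_map (t : ℝ) :
    MeasurableEmbedding ((wignerFamily d).map t) :=
  Continuous.measurableEmbedding ((wignerFamily d).map t).continuous
    (Function.LeftInverse.injective ((wignerFamily d).inv_map t))

/-- A_t is (x, y) ↦ (x + ty, y) followed by (p, y) ↦ (p, p - y), two skew products over the identity
with measure-preserving fibre maps. -/
theorem measurePreserving_wignerFamily_map (t : ℝ) :
    MeasurePreserving ((wignerFamily d).map t) volume volume := by
  have h1 : MeasurePreserving (fun p : Euc d × Euc d => (p.1, p.2 + t • p.1))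
      (volume.prod volume) (volume.prod volume) :=
    (MeasurePreserving.id volume).skew_product (g := fun y x => x + t • y) (by fun_prop)
      (Filter.Eventually.of_forall fun y => map_add_right_eq_self volume (t • y))
  have h2 : MeasurePreserving (fun p : Euc d × Euc d => (p.1, p.1 - p.2))
      (volume.prod volume) (volume.prod volume) :=
    (MeasurePreserving.id volume).skew_product (g := fun p y => p - y) (by fun_prop)
      (Filter.Eventually.of_forall fun p => (Measure.measurePreserving_sub_left volume p).map_eq)
  have h3 : MeasurePreserving (Prod.swap : Euc d × Euc d → Euc d × Euc d)
      (volume.prod volume) (volume.prod volume) := Measure.measurePreserving_swap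
  have h := (measurePreserving_join (d := d)).comp (h2.comp (h3.comp (h1.comp h3)))
  have e : (wignerFamily d).map t ∘ (fun p : Euc d × Euc d => join p.1 p.2) =
      (fun p : Euc d × Euc d => join p.1 p.2) ∘ (fun p : Euc d × Euc d => (p.1, p.1 - p.2)) ∘
        Prod.swap ∘ (fun p : Euc d × Euc d => (p.1, p.2 + t • p.1)) ∘ Prod.swap := by
    funext p
    simp only [Function.comp_apply, wignerFamily_map_join, Prod.swap, sub_smul, one_smul]
    congr 1
    abel
  rw [← e] at h
  refine ⟨((wignerFamily d).map t).continuous.measurable, ?_⟩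
  conv_lhs => rw [← (measurePreserving_join (d := d)).map_eq]
  rw [Measure.map_map ((wignerFamily d).map t).continuous.measurable continuous_join.measurable]
  exact h.map_eq

/-- Fubini in t, then the volume-preserving substitution by A_t for each t. -/
theorem integral_avg_mul (Ψ θ : Sch (d + d)) :
    ∫ z, (wignerFamily d).avg 1 Ψ z * θ z = ∫ z, Ψ z * (wignerFamilyInv d).avg 1 θ z := by
  obtain ⟨C, hC⟩ : ∃ C, ∀ z, ‖Ψ z‖ ≤ C := ⟨_, norm_le_seminorm ℂ Ψ⟩
  obtain ⟨C', hC'⟩ : ∃ C, ∀ z, ‖θ z‖ ≤ C := ⟨_, norm_le_seminorm ℂ θ⟩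
  have hone : Integrable (fun _ : ℝ => (1 : ℂ)) (volume.restrict (Set.Ioc (0 : ℝ) 1)) :=
    integrable_const _
  have hA := (wignerFamily d).continuous_map
  have hA' := (wignerFamilyInv d).continuous_map
  have h1 : Integrable (Function.uncurry fun (z : Euc (d + d)) (t : ℝ) =>
      Ψ ((wignerFamily d).map t z) * θ z) (volume.prod (volume.restrict (Set.Ioc (0 : ℝ) 1))) := by
    have h := (θ.integrable (μ := volume)).mul_prod hone
    have := Integrable.bdd_mul (f := fun p : Euc (d + d) × ℝ => Ψ ((wignerFamily d).map p.2 p.1)) h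
      (Continuous.aestronglyMeasurable (by have := Ψ.continuous; fun_prop))
      (Filter.Eventually.of_forall fun p => hC _)
    simpa [Function.uncurry_def] using this
  have h2 : Integrable (Function.uncurry fun (z : Euc (d + d)) (t : ℝ) =>
      Ψ z * θ ((wignerFamilyInv d).map t z))
      (volume.prod (volume.restrict (Set.Ioc (0 : ℝ) 1))) := by
    have h := (Ψ.integrable (μ := volume)).mul_prod hone
    have := Integrable.mul_bdd (g := fun p : Euc (d + d) × ℝ => θ ((wignerFamilyInv d).map p.2 p.1)) h
      (Continuous.aestronglyMeasurable (by have := θ.continuous; fun_prop))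
      (Filter.Eventually.of_forall fun p => hC' _)
    simpa [Function.uncurry_def] using this
  simp only [LinearFamily.avg_one_apply, ← integral_mul_const, ← integral_const_mul]
  rw [integral_integral_swap h1, integral_integral_swap h2]
  refine integral_congr_ae (Filter.Eventually.of_forall fun t => ?_)
  have h := (measurePreserving_wignerFamily_map (d := d) t).integral_comp
    (measurableEmbedding_wignerFamily_map t)
    (fun z => Ψ z * θ ((wignerFamilyInv d).map t z))
  refine Eq.trans ?_ h
  refine integral_congr_ae (Filter.Eventually.of_forall fun z => ?_)
  exact congrArg (fun w => Ψ ((wignerFamily d).map t z) * θ w) ((wignerFamily d).inv_map t z).symm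

theorem integrable_mul (f g : Sch d) : Integrable fun x => f x * g x := by
  have := f.integrable (μ := volume) |>.mul_bdd (g := g) g.continuous.aestronglyMeasurable
    (Filter.Eventually.of_forall (norm_le_seminorm ℂ g))
  exact this

/-- Fubini for each fixed x; the kernel e^{-i⟨y,ξ⟩} is symmetric. -/
theorem integral_partialFourier_mul (Ψ ψ : Sch (d + d)) :
    ∫ z, partialFourier Ψ z * ψ z = ∫ z, Ψ z * partialFourier ψ z := by
  rw [integral_join (integrable_mul _ _), integral_join (integrable_mul _ _)]
  refine integral_congr_ae (Filter.Eventually.of_forall fun x => ?_)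
  simp only [partialFourier_apply, partialFourierFun, partialFourierIntegrand, position_join,
    frequency_join]
  have h : Integrable (Function.uncurry fun ξ y : Euc d =>
      ψ (join x ξ) * Ψ (join x y) * expChar y ξ) (volume.prod volume) := by
    refine ((slice x ψ).integrable.mul_prod (slice x Ψ).integrable).mul_bdd
      (g := fun p : Euc d × Euc d => expChar p.2 p.1)
      (Continuous.aestronglyMeasurable (by unfold expChar; fun_prop))
      (Filter.Eventually.of_forall fun p => (norm_expChar _ _).le)
  have h' := integral_integral_swap h
  have e1 : ∀ ξ, fourierConst d * (∫ y, Ψ (join x y) * expChar y ξ) * ψ (join x ξ) =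
      fourierConst d * ∫ y, ψ (join x ξ) * Ψ (join x y) * expChar y ξ := fun ξ => by
    simp only [mul_assoc, integral_const_mul]
    ring
  have e2 : ∀ y, Ψ (join x y) * (fourierConst d * ∫ ξ, ψ (join x ξ) * expChar ξ y) =
      fourierConst d * ∫ ξ, ψ (join x ξ) * Ψ (join x y) * expChar y ξ := fun y => by
    simp only [mul_comm (ψ _) (Ψ _), mul_assoc, integral_const_mul, expChar_comm y]
    ring
  simp only [e1, e2, integral_const_mul, h']

theorem integral_tensor_mul (f g : Sch d) (Θ : Sch (d + d)) :
    ∫ z, tensor f g z * Θ z = ∫ x, f x * ∫ y, g y * Θ (join x y) := by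
  rw [integral_join (integrable_mul _ _)]
  simp only [tensor_apply, position_join, frequency_join, mul_assoc, integral_const_mul]

/-- The Born-Jordan distribution of two Schwartz functions as a Schwartz function. -/
def bornJordanS (f φ : Sch d) : Sch (d + d) :=
  partialFourier ((wignerFamily d).avg 1 (tensor f (conjS φ)))

/-- The operator dual to the Born-Jordan distribution. -/
def bornJordanDual (ψ : Sch (d + d)) : Sch (d + d) := (wignerFamilyInv d).avg 1 (partialFourier ψ)

/-- The transform and the average are moved onto ψ. In the result f and φ occur only as functionals
in separate variables, so they can be replaced by distributions. -/
theorem integral_bornJordanS_mul (f φ : Sch d) (ψ : Sch (d + d)) :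
    ∫ z, bornJordanS f φ z * ψ z =
      ∫ x, f x * ∫ y, conj (φ y) * bornJordanDual ψ (join x y) := by
  rw [bornJordanS, integral_partialFourier_mul, integral_avg_mul, integral_tensor_mul]
  rfl

end adjoint

end

/-! ### Pointwise formula, linearity, and the form on pairs of functionals -/

section
/-! ### The integral formula for the Born-Jordan distribution -/

section pointwise

variable {d : ℕ}

theorem wignerIntegrand_eq (f φ : Sch d) (t : ℝ) (x ξ y : Euc d) : wignerIntegrand t f φ x ξ y =
    tensor f (conjS φ) ((wignerFamily d).map t (join x y)) * expChar y ξ := by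
  rw [wignerFamily_map_join, tensor_apply, position_join, frequency_join]
  rfl

/-- y is the difference of the two components of A_t(x, y). The bound is free of t and x, hence so
is the integrable majorant that it yields. -/
theorem norm_le_two_mul_norm_wignerFamily (t : ℝ) (x y : Euc d) :
    ‖(1 / 2 : ℝ) • y‖ ≤ ‖(wignerFamily d).map t (join x y)‖ := by
  rw [wignerFamily_map_join, norm_smul]
  have h : y = (x + t • y) - (x - (1 - t) • y) := by module
  have h1 := norm_sub_le (x + t • y) (x - (1 - t) • y)
  rw [← h] at h1
  have h2 := norm_le_norm_join_left (x + t • y) (x - (1 - t) • y)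
  have h3 := norm_le_norm_join_right (x + t • y) (x - (1 - t) • y)
  norm_num
  linarith

theorem exists_wignerIntegrand_bound (f φ : Sch d) : ∃ G : Euc d → ℝ, Integrable G ∧
    ∀ t x ξ y, ‖wignerIntegrand t f φ x ξ y‖ ≤ G y := by
  obtain ⟨M, hM⟩ := exists_mem_wordBall (tensor f (conjS φ))
  refine ⟨fun y => decayConst (d + d) (d + 1) M *
    (1 + ‖(1 / 2 : ℝ) • y‖) ^ (-((d + 1 : ℕ) : ℝ)), ?_, fun t x ξ y => ?_⟩
  · exact Integrable.const_mul ((integrable_comp_smul_iff volume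
      (fun y : Euc d => (1 + ‖y‖) ^ (-((d + 1 : ℕ) : ℝ))) (by norm_num)).2 integrable_decay) _
  · rw [wignerIntegrand_eq, norm_mul, norm_expChar, mul_one]
    exact (norm_le_decay (d + 1) hM _).trans (mul_le_mul_of_nonneg_left
      (rpow_decay_mono (norm_nonneg _) (norm_le_two_mul_norm_wignerFamily t x y) (d + 1))
      (decayConst_nonneg hM (d + 1)))

theorem continuous_wignerIntegrand (f φ : Sch d) (x ξ : Euc d) :
    Continuous fun p : ℝ × Euc d => wignerIntegrand p.1 f φ x ξ p.2 := by
  have := f.continuous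
  have := φ.continuous
  unfold wignerIntegrand
  fun_prop

theorem integrable_wignerIntegrand (f φ : Sch d) (x ξ : Euc d) (t : ℝ) :
    Integrable (wignerIntegrand t f φ x ξ) := by
  obtain ⟨G, hG, h⟩ := exists_wignerIntegrand_bound f φ
  exact hG.mono' ((continuous_wignerIntegrand f φ x ξ).comp
    (Continuous.prodMk_right t)).aestronglyMeasurable (Filter.Eventually.of_forall (h t x ξ))

theorem integrable_uncurry_wignerIntegrand (f φ : Sch d) (x ξ : Euc d) :
    Integrable (Function.uncurry fun (t : ℝ) y => wignerIntegrand t f φ x ξ y)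
      ((volume.restrict (Set.Ioc (0 : ℝ) 1)).prod volume) := by
  obtain ⟨G, hG, h⟩ := exists_wignerIntegrand_bound f φ
  have hone : Integrable (fun _ : ℝ => (1 : ℝ)) (volume.restrict (Set.Ioc (0 : ℝ) 1)) :=
    integrable_const _
  refine (hone.mul_prod hG).mono' (continuous_wignerIntegrand f φ x ξ).aestronglyMeasurable
    (Filter.Eventually.of_forall fun p => ?_)
  rw [one_mul]
  exact h p.1 x ξ p.2

theorem intervalIntegrable_wigner (f φ : Sch d) (x ξ : Euc d) :
    IntervalIntegrable (fun t => wigner t f φ x ξ) volume 0 1 := by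
  rw [intervalIntegrable_iff_integrableOn_Ioc_of_le zero_le_one]
  exact (integrable_uncurry_wignerIntegrand f φ x ξ).integral_prod_left.const_mul _

/-- `bornJordanS` integrates over t inside the y-integral, `wignerBJ` outside; Fubini identifies
them. -/
theorem bornJordanS_apply (f φ : Sch d) (z : Euc (d + d)) :
    bornJordanS f φ z = wignerBJ f φ (position z) (frequency z) := by
  rw [bornJordanS, partialFourier_apply, partialFourierFun, wignerBJ,
    intervalIntegral.integral_of_le zero_le_one]
  simp only [wigner, integral_const_mul]
  rw [integral_integral_swap (integrable_uncurry_wignerIntegrand f φ _ _), fourierConst]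
  congr 1
  refine integral_congr_ae (Filter.Eventually.of_forall fun y => ?_)
  simp only [partialFourierIntegrand, LinearFamily.avg_one_apply, wignerIntegrand_eq,
    integral_mul_const]

end pointwise

/-! ### Linearity -/

section linearity

variable {d n : ℕ}

theorem LinearFamily.avg_add (A : LinearFamily n) (Ψ Ψ' : Sch n) :
    A.avg 1 (Ψ + Ψ') = A.avg 1 Ψ + A.avg 1 Ψ' := by
  ext z
  have h := A.integrable_avg_integrand 1 Ψ z
  have h' := A.integrable_avg_integrand 1 Ψ' z
  simp only [ContinuousMap.one_apply, Complex.ofReal_one, one_mul] at h h'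
  simp only [A.avg_one_apply, add_apply]
  exact integral_add h h'

theorem LinearFamily.avg_smul (A : LinearFamily n) (c : ℂ) (Ψ : Sch n) :
    A.avg 1 (c • Ψ) = c • A.avg 1 Ψ := by
  ext z
  simp only [A.avg_one_apply, smul_apply, integral_smul]

theorem partialFourier_add (Ψ Ψ' : Sch (d + d)) :
    partialFourier (Ψ + Ψ') = partialFourier Ψ + partialFourier Ψ' := by
  ext z
  simp only [partialFourier_apply, partialFourierFun, add_apply]
  rw [← mul_add, ← integral_add (integrable_partialFourierIntegrand Ψ z)
    (integrable_partialFourierIntegrand Ψ' z)]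
  simp only [partialFourierIntegrand, add_apply, add_mul]

theorem partialFourier_smul (c : ℂ) (Ψ : Sch (d + d)) :
    partialFourier (c • Ψ) = c • partialFourier Ψ := by
  ext z
  simp only [partialFourier_apply, partialFourierFun, partialFourierIntegrand, smul_apply, smul_eq_mul,
    mul_assoc, integral_const_mul]
  ring

theorem bornJordanDual_add (ψ ψ' : Sch (d + d)) :
    bornJordanDual (ψ + ψ') = bornJordanDual ψ + bornJordanDual ψ' := by
  simp only [bornJordanDual, partialFourier_add, LinearFamily.avg_add]

theorem bornJordanDual_smul (c : ℂ) (ψ : Sch (d + d)) :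
    bornJordanDual (c • ψ) = c • bornJordanDual ψ := by
  simp only [bornJordanDual, partialFourier_smul, LinearFamily.avg_smul]

theorem tensor_add_left (f f' g : Sch d) : tensor (f + f') g = tensor f g + tensor f' g := by
  ext z
  simp only [tensor_apply, add_apply, add_mul]

theorem tensor_add_right (f g g' : Sch d) : tensor f (g + g') = tensor f g + tensor f g' := by
  ext z
  simp only [tensor_apply, add_apply, mul_add]

theorem tensor_smul_left (c : ℂ) (f g : Sch d) : tensor (c • f) g = c • tensor f g := by
  ext z
  simp only [tensor_apply, smul_apply, smul_eq_mul, mul_assoc]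

theorem tensor_smul_right (c : ℂ) (f g : Sch d) : tensor f (c • g) = c • tensor f g := by
  ext z
  simp only [tensor_apply, smul_apply, smul_eq_mul, mul_left_comm]

/-- The Born-Jordan distribution as a sesquilinear map. -/
def bornJordanL (d : ℕ) : Sch d →ₗ[ℂ] Sch d →ₛₗ[starRingEnd ℂ] Sch (d + d) :=
  LinearMap.mk₂'ₛₗ (RingHom.id ℂ) (starRingEnd ℂ) bornJordanS
    (fun f f' φ => by
      simp only [bornJordanS, tensor_add_left, LinearFamily.avg_add, partialFourier_add])
    (fun c f φ => by
      simp only [bornJordanS, tensor_smul_left, LinearFamily.avg_smul, partialFourier_smul]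
      rfl)
    (fun f φ φ' => by
      simp only [bornJordanS, conjS_add, tensor_add_right, LinearFamily.avg_add, partialFourier_add])
    (fun c f φ => by
      simp only [bornJordanS, conjS_smul, tensor_smul_right, LinearFamily.avg_smul,
        partialFourier_smul])

theorem WeightClass.exists_bornJordan_bound {𝒲 : Set (ℕ → ℝ)} (h𝒲 : WeightClass 𝒲) {M N : ℕ → ℝ}
    (hM : M ∈ 𝒲) (hN : N ∈ 𝒲) : ∃ P ∈ 𝒲, ∀ f ∈ wordBall d M, ∀ φ ∈ wordBall d N,
      bornJordanL d f φ ∈ wordBall (d + d) P := by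
  obtain ⟨L, hL⟩ := (wignerFamily d).exists_boundedBy
  obtain ⟨P₁, hP₁, h1⟩ := h𝒲.exists_tensor_bound hM hN
  obtain ⟨P₂, hP₂, h2⟩ := h𝒲.exists_avg_bound (n := d + d) L hP₁
  obtain ⟨P₃, hP₃, h3⟩ := h𝒲.exists_partialFourier_bound (d := d) hP₂
  exact ⟨P₃, hP₃, fun f hf φ hφ => h3 _ (h2 _ hL _ (h1 _ _ _ hf (conjS_mem_wordBall hφ)))⟩

theorem WeightClass.exists_dual_bound {𝒲 : Set (ℕ → ℝ)} (h𝒲 : WeightClass 𝒲) {M : ℕ → ℝ}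
    (hM : M ∈ 𝒲) : ∃ P ∈ 𝒲, ∀ ψ ∈ wordBall (d + d) M,
      conjS (bornJordanDual ψ) ∈ wordBall (d + d) P := by
  obtain ⟨L, hL⟩ := (wignerFamilyInv d).exists_boundedBy
  obtain ⟨P₁, hP₁, h1⟩ := h𝒲.exists_partialFourier_bound (d := d) hM
  obtain ⟨P₂, hP₂, h2⟩ := h𝒲.exists_avg_bound (n := d + d) L hP₁
  exact ⟨P₂, hP₂, fun ψ hψ => conjS_mem_wordBall (h2 _ hL _ (h1 _ hψ))⟩

end linearity

/-! ### The Born-Jordan distribution of two functionals -/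

section dualForm

variable {d : ℕ} {𝒲 : Set (ℕ → ℝ)} {u u' v v' : Sch d →ₗ[ℂ] ℂ}

theorem slicePairing_add (h𝒲 : WeightClass 𝒲) (hv : BoundedOn 𝒲 v) {Ψ Ψ' : Sch (d + d)}
    (hΨ : Ψ ∈ h𝒲.carrier (d + d)) (hΨ' : Ψ' ∈ h𝒲.carrier (d + d)) :
    slicePairing v (Ψ + Ψ') = slicePairing v Ψ + slicePairing v Ψ' := by
  ext x
  simp only [add_apply, slicePairing_apply h𝒲 hv hΨ, slicePairing_apply h𝒲 hv hΨ',
    slicePairing_apply h𝒲 hv (add_mem hΨ hΨ'), map_add]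

theorem slicePairing_smul (h𝒲 : WeightClass 𝒲) (hv : BoundedOn 𝒲 v) (c : ℂ) {Ψ : Sch (d + d)}
    (hΨ : Ψ ∈ h𝒲.carrier (d + d)) : slicePairing v (c • Ψ) = c • slicePairing v Ψ := by
  ext x
  simp only [smul_apply, slicePairing_apply h𝒲 hv hΨ,
    slicePairing_apply h𝒲 hv (Submodule.smul_mem _ c hΨ), map_smul]

/-- The Born-Jordan distribution of the functionals `u` and `v`, applied to `ψ`. -/
def dualForm (u v : Sch d →ₗ[ℂ] ℂ) (ψ : Sch (d + d)) : ℂ :=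
  -- ∫ conj φ · Θ is the conjugate of ∫ φ · conj Θ, so v acts on the conjugate and its value is
  -- conjugated back.
  u (conjS (slicePairing v (conjS (bornJordanDual ψ))))

theorem WeightClass.dual_mem_carrier (h𝒲 : WeightClass 𝒲) {ψ : Sch (d + d)}
    (hψ : ψ ∈ h𝒲.carrier (d + d)) : conjS (bornJordanDual ψ) ∈ h𝒲.carrier (d + d) := by
  obtain ⟨M, hM, hψ⟩ := hψ
  obtain ⟨P, hP, h⟩ := h𝒲.exists_dual_bound (d := d) hM
  exact ⟨P, hP, h ψ hψ⟩

theorem dualForm_add (h𝒲 : WeightClass 𝒲) (hv : BoundedOn 𝒲 v) {ψ ψ' : Sch (d + d)}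
    (hψ : ψ ∈ h𝒲.carrier (d + d)) (hψ' : ψ' ∈ h𝒲.carrier (d + d)) :
    dualForm u v (ψ + ψ') = dualForm u v ψ + dualForm u v ψ' := by
  rw [dualForm, bornJordanDual_add, conjS_add,
    slicePairing_add h𝒲 hv (h𝒲.dual_mem_carrier hψ) (h𝒲.dual_mem_carrier hψ'), conjS_add, map_add]
  rfl

theorem dualForm_smul (h𝒲 : WeightClass 𝒲) (hv : BoundedOn 𝒲 v) (c : ℂ) {ψ : Sch (d + d)}
    (hψ : ψ ∈ h𝒲.carrier (d + d)) : dualForm u v (c • ψ) = c * dualForm u v ψ := by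
  rw [dualForm, bornJordanDual_smul, conjS_smul,
    slicePairing_smul h𝒲 hv _ (h𝒲.dual_mem_carrier hψ), conjS_smul, map_smul, Complex.conj_conj]
  rfl

theorem slicePairing_mem_carrier (h𝒲 : WeightClass 𝒲) (hv : BoundedOn 𝒲 v) {Ψ : Sch (d + d)}
    (hΨ : Ψ ∈ h𝒲.carrier (d + d)) : slicePairing v Ψ ∈ h𝒲.carrier d := by
  obtain ⟨M, hM, hΨ⟩ := hΨ
  obtain ⟨P, hP, h⟩ := h𝒲.exists_slicePairing_bound hv hM
  exact ⟨P, hP, h Ψ hΨ⟩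

/-- Only the values on the carrier enter. This removes the dependence on the chosen extensions of
functionals to all Schwartz functions, which need not be additive in the functional. -/
theorem dualForm_congr (h𝒲 : WeightClass 𝒲) (hv : BoundedOn 𝒲 v) (hv' : BoundedOn 𝒲 v')
    (hu : ∀ f ∈ h𝒲.carrier d, u f = u' f) (hvv : ∀ f ∈ h𝒲.carrier d, v f = v' f)
    {ψ : Sch (d + d)} (hψ : ψ ∈ h𝒲.carrier (d + d)) : dualForm u v ψ = dualForm u' v' ψ := by
  have hmem := h𝒲.dual_mem_carrier hψ
  have e : slicePairing v (conjS (bornJordanDual ψ)) = slicePairing v' (conjS (bornJordanDual ψ)) := by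
    ext x
    rw [slicePairing_apply h𝒲 hv hmem, slicePairing_apply h𝒲 hv' hmem]
    obtain ⟨M, hM, h⟩ := hmem
    exact hvv _ ⟨M, hM, slice_mem_wordBall h x⟩
  rw [dualForm, dualForm, ← e]
  refine hu _ ?_
  obtain ⟨M, hM, h⟩ := slicePairing_mem_carrier h𝒲 hv hmem
  exact ⟨M, hM, conjS_mem_wordBall h⟩

theorem dualForm_add_right (h𝒲 : WeightClass 𝒲) (hv : BoundedOn 𝒲 v) (hv' : BoundedOn 𝒲 v')
    (hvv : BoundedOn 𝒲 (v + v')) {ψ : Sch (d + d)} (hψ : ψ ∈ h𝒲.carrier (d + d)) :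
    dualForm u (v + v') ψ = dualForm u v ψ + dualForm u v' ψ := by
  have hmem := h𝒲.dual_mem_carrier hψ
  have e : slicePairing (v + v') (conjS (bornJordanDual ψ)) =
      slicePairing v (conjS (bornJordanDual ψ)) + slicePairing v' (conjS (bornJordanDual ψ)) := by
    ext x
    rw [add_apply, slicePairing_apply h𝒲 hv hmem, slicePairing_apply h𝒲 hv' hmem,
      slicePairing_apply h𝒲 hvv hmem, LinearMap.add_apply]
  rw [dualForm, e, conjS_add, map_add]
  rfl

/-- v maps the dual of ψ into b times the word ball of P, and u is at most a there. Since P does not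
depend on u and v, the product bound gives joint continuity. -/
theorem exists_dualForm_bound (h𝒲 : WeightClass 𝒲) {M : ℕ → ℝ} (hM : M ∈ 𝒲) :
    ∃ P ∈ 𝒲, ∀ u v : Sch d →ₗ[ℂ] ℂ, BoundedOn 𝒲 v → ∀ a b : ℝ,
      (∀ f ∈ wordBall d P, ‖u f‖ ≤ a) → (∀ f ∈ wordBall d P, ‖v f‖ ≤ b) →
      ∀ ψ ∈ wordBall (d + d) M, ‖dualForm u v ψ‖ ≤ a * b := by
  obtain ⟨Q, hQ, h⟩ := h𝒲.exists_dual_bound (d := d) hM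
  obtain ⟨P, hP, hpos, hsplit⟩ := h𝒲.split hQ
  refine ⟨P, hP, fun u v hv a b ha hb ψ hψ => ?_⟩
  have hb0 : 0 ≤ b := (norm_nonneg _).trans (hb 0 (zero_mem_wordBall fun m => (hpos m).le))
  rw [mul_comm]
  exact norm_map_le_of_mem_wordBall_mul ha hb0
    (conjS_mem_wordBall (slicePairing_mem_wordBall h𝒲 hv hQ hpos hsplit hb (h ψ hψ)))

theorem dualForm_pairingS (h𝒲 : WeightClass 𝒲) (f φ : Sch d) {ψ : Sch (d + d)}
    (hψ : ψ ∈ h𝒲.carrier (d + d)) :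
    dualForm (pairingS f) (pairingS φ) ψ = ∫ z, bornJordanS f φ z * ψ z := by
  rw [integral_bornJordanS_mul, dualForm, pairingS_apply]
  refine integral_congr_ae (Filter.Eventually.of_forall fun x => ?_)
  simp only [conjS_apply, slicePairing_apply h𝒲 (boundedOn_pairingS 𝒲 φ) (h𝒲.dual_mem_carrier hψ),
    pairingS_apply, ← integral_conj, map_mul, slice_apply, Complex.conj_conj]

end dualForm

end

section
/-! ### Spaces of test functions -/

/-- The space `E` of test functions has the bounded sets and the bounded functionals that belong to
the class `𝒲` of weights. -/
structure IsTestSpace {𝒲 : Set (ℕ → ℝ)} (h𝒲 : WeightClass 𝒲) {n : ℕ} {E : Type*} [AddCommGroup E]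
    [Module ℂ E] [TopologicalSpace E] (ι : E →ₗ[ℂ] Sch n) : Prop where
  injective : Function.Injective ι
  range_eq : LinearMap.range ι = h𝒲.carrier n
  isVonNBounded_iff : ∀ S : Set E,
    Bornology.IsVonNBounded ℂ S ↔ ∃ M ∈ 𝒲, ∀ f ∈ S, ι f ∈ wordBall n M
  continuous_of_bounded : ∀ ℓ : E →ₗ[ℂ] ℂ,
    (∀ M ∈ 𝒲, ∃ C, ∀ f, ι f ∈ wordBall n M → ‖ℓ f‖ ≤ C) → Continuous ℓ

namespace IsTestSpace

variable {𝒲 : Set (ℕ → ℝ)} {h𝒲 : WeightClass 𝒲} {n : ℕ} {E : Type*} [AddCommGroup E]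
  [Module ℂ E] [TopologicalSpace E] {ι : E →ₗ[ℂ] Sch n}

theorem mem_carrier (hE : IsTestSpace h𝒲 ι) (f : E) : ι f ∈ h𝒲.carrier n := by
  rw [← hE.range_eq]
  exact ⟨f, rfl⟩

theorem exists_eq (hE : IsTestSpace h𝒲 ι) {g : Sch n} (hg : g ∈ h𝒲.carrier n) : ∃ f, ι f = g := by
  rwa [← hE.range_eq] at hg

/-- A purely algebraic extension, without continuity; it puts all functionals on the single space
`Sch n`. -/
theorem exists_extension (hE : IsTestSpace h𝒲 ι) (u : StrongDual ℂ E) :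
    ∃ U : Sch n →ₗ[ℂ] ℂ, ∀ f, U (ι f) = u f := by
  obtain ⟨g, hg⟩ := ι.exists_leftInverse_of_injective (LinearMap.ker_eq_bot.2 hE.injective)
  exact ⟨u.toLinearMap.comp g, fun f => congrArg u (LinearMap.congr_fun hg f)⟩

/-- An extension of a functional to all Schwartz functions. -/
def extend (hE : IsTestSpace h𝒲 ι) (u : StrongDual ℂ E) : Sch n →ₗ[ℂ] ℂ :=
  (hE.exists_extension u).choose

theorem extend_apply (hE : IsTestSpace h𝒲 ι) (u : StrongDual ℂ E) (f : E) :
    hE.extend u (ι f) = u f := (hE.exists_extension u).choose_spec f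

theorem boundedOn_extend (hE : IsTestSpace h𝒲 ι) (u : StrongDual ℂ E) :
    BoundedOn 𝒲 (hE.extend u) := fun M hM => by
  have hb : Bornology.IsVonNBounded ℂ {f : E | ι f ∈ wordBall n M} :=
    (hE.isVonNBounded_iff _).2 ⟨M, hM, fun f hf => hf⟩
  obtain ⟨C, hC⟩ := (NormedSpace.isVonNBounded_iff ℂ).1 (hb.image u) |>.exists_norm_le
  refine ⟨C, fun g hg => ?_⟩
  obtain ⟨f, rfl⟩ := hE.exists_eq ⟨M, hM, hg⟩
  rw [extend_apply]
  exact hC _ ⟨f, hg, rfl⟩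

/-- The neighbourhoods of zero in the strong dual. -/
theorem hasBasis_nhds_zero (hE : IsTestSpace h𝒲 ι) :
    (nhds (0 : StrongDual ℂ E)).HasBasis (fun p : (ℕ → ℝ) × ℝ => p.1 ∈ 𝒲 ∧ 0 < p.2)
      fun p => {u | ∀ f, ι f ∈ wordBall n p.1 → ‖u f‖ ≤ p.2} := by
  have h := ContinuousLinearMap.hasBasis_nhds_zero_of_basis (𝕜₁ := ℂ) (E := E) (σ := RingHom.id ℂ)
    (Metric.nhds_basis_closedBall (x := (0 : ℂ)))
  refine h.to_hasBasis ?_ ?_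
  · rintro ⟨S, ε⟩ ⟨hS, hε⟩
    obtain ⟨M, hM, hMS⟩ := (hE.isVonNBounded_iff S).1 hS
    exact ⟨(M, ε), ⟨hM, hε⟩, fun u hu f hf => mem_closedBall_zero_iff.2 (hu f (hMS f hf))⟩
  · rintro ⟨M, ε⟩ ⟨hM, hε⟩
    exact ⟨({f | ι f ∈ wordBall n M}, ε), ⟨(hE.isVonNBounded_iff _).2 ⟨M, hM, fun f hf => hf⟩, hε⟩,
      fun u hu f hf => mem_closedBall_zero_iff.1 (hu f hf)⟩

theorem mem_nhds_iff (hE : IsTestSpace h𝒲 ι) {u₀ : StrongDual ℂ E} {s : Set (StrongDual ℂ E)} :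
    s ∈ nhds u₀ ↔ ∃ M ∈ 𝒲, ∃ ε > 0, ∀ u : StrongDual ℂ E,
      (∀ f, ι f ∈ wordBall n M → ‖u f - u₀ f‖ ≤ ε) → u ∈ s := by
  rw [← map_add_left_nhds_zero u₀, Filter.mem_map, hE.hasBasis_nhds_zero.mem_iff]
  constructor
  · rintro ⟨⟨M, ε⟩, ⟨hM, hε⟩, h⟩
    refine ⟨M, hM, ε, hε, fun u hu => ?_⟩
    have : u - u₀ ∈ (fun x => u₀ + x) ⁻¹' s := h hu
    simpa using this
  · rintro ⟨M, hM, ε, hε, h⟩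
    refine ⟨(M, ε), ⟨hM, hε⟩, fun u hu => h _ fun f hf => ?_⟩
    simpa using hu f hf

/-- The test functions of a class that is contained in `𝒲` are dense in the strong dual. -/
theorem dense_range (hE : IsTestSpace h𝒲 ι) {𝒜 : Set (ℕ → ℝ)} (h𝒜 : WeightClass 𝒜) (hsub : 𝒜 ⊆ 𝒲)
    {A : Type*} {a : A → Sch n} (ha : ∀ f ∈ h𝒜.carrier n, ∃ x, a x = f) {δ : A → StrongDual ℂ E}
    (hδ : ∀ x f, δ x f = ∫ y, a x y * ι f y) : DenseRange δ := by
  refine fun u => mem_closure_iff_nhds.2 fun s hs => ?_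
  obtain ⟨M, hM, ε, hε, h⟩ := hE.mem_nhds_iff.1 hs
  obtain ⟨f, hf, hfu⟩ := exists_approx h𝒲 h𝒜 hsub (hE.boundedOn_extend u) hM hε
  obtain ⟨x, rfl⟩ := ha f hf
  refine ⟨δ x, h _ fun g hg => ?_, ⟨x, rfl⟩⟩
  rw [norm_sub_rev, hδ, ← hE.extend_apply u]
  exact hfu _ hg

end IsTestSpace

section extension

variable {d : ℕ} {𝒲 : Set (ℕ → ℝ)} {h𝒲 : WeightClass 𝒲} {E F : Type*} [AddCommGroup E] [Module ℂ E]
  [TopologicalSpace E] {ι : E →ₗ[ℂ] Sch d} [AddCommGroup F] [Module ℂ F] [TopologicalSpace F]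
  {κ : F →ₗ[ℂ] Sch (d + d)}

/-- The Born-Jordan distribution of two functionals as a linear functional. -/
def bornJordanLin (hE : IsTestSpace h𝒲 ι) (hF : IsTestSpace h𝒲 κ)
    (p : StrongDual ℂ E × StrongDual ℂ E) : F →ₗ[ℂ] ℂ where
  toFun ψ := dualForm (hE.extend p.1) (hE.extend p.2) (κ ψ)
  map_add' ψ ψ' := by
    rw [map_add, dualForm_add h𝒲 (hE.boundedOn_extend _) (hF.mem_carrier _) (hF.mem_carrier _)]
  map_smul' c ψ := by
    rw [map_smul, dualForm_smul h𝒲 (hE.boundedOn_extend _) _ (hF.mem_carrier _)]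
    rfl

/-- The Born-Jordan distribution of two functionals. -/
def bornJordanDist (hE : IsTestSpace h𝒲 ι) (hF : IsTestSpace h𝒲 κ)
    (p : StrongDual ℂ E × StrongDual ℂ E) : StrongDual ℂ F where
  toLinearMap := bornJordanLin hE hF p
  cont := hF.continuous_of_bounded _ fun M hM => by
    obtain ⟨P, hP, h⟩ := exists_dualForm_bound (d := d) h𝒲 hM
    obtain ⟨a, ha⟩ := hE.boundedOn_extend p.1 P hP
    obtain ⟨b, hb⟩ := hE.boundedOn_extend p.2 P hP
    exact ⟨a * b, fun ψ hψ => h _ _ (hE.boundedOn_extend _) a b ha hb _ hψ⟩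

theorem bornJordanDist_apply (hE : IsTestSpace h𝒲 ι) (hF : IsTestSpace h𝒲 κ)
    (p : StrongDual ℂ E × StrongDual ℂ E) (ψ : F) :
    bornJordanDist hE hF p ψ = dualForm (hE.extend p.1) (hE.extend p.2) (κ ψ) := rfl

/-- Biadditivity with u = (u - u₀) + u₀ and v = (v - v₀) + v₀. -/
theorem bornJordanDist_sub (hE : IsTestSpace h𝒲 ι) (hF : IsTestSpace h𝒲 κ)
    (u u₀ v v₀ : StrongDual ℂ E) (ψ : F) :
    bornJordanDist hE hF (u, v) ψ - bornJordanDist hE hF (u₀, v₀) ψ =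
      dualForm (hE.extend (u - u₀)) (hE.extend (v - v₀)) (κ ψ) +
      dualForm (hE.extend (u - u₀)) (hE.extend v₀) (κ ψ) +
      dualForm (hE.extend u₀) (hE.extend (v - v₀)) (κ ψ) := by
  have hb := hE.boundedOn_extend
  have hadd : ∀ w w' : StrongDual ℂ E, BoundedOn 𝒲 (hE.extend w + hE.extend w') := fun w w' M hM => by
    obtain ⟨a, ha⟩ := hb w M hM
    obtain ⟨b, hb⟩ := hb w' M hM
    exact ⟨a + b, fun f hf => norm_add_le_of_le (ha f hf) (hb f hf)⟩
  have hsum : ∀ w w₀ : StrongDual ℂ E, ∀ f ∈ h𝒲.carrier d,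
      hE.extend w f = (hE.extend (w - w₀) + hE.extend w₀) f := fun w w₀ f hf => by
    obtain ⟨f, rfl⟩ := hE.exists_eq hf
    simp [hE.extend_apply]
  rw [bornJordanDist_apply, bornJordanDist_apply, dualForm_congr h𝒲 (hb v) (hadd (v - v₀) v₀)
    (hsum u u₀) (hsum v v₀) (hF.mem_carrier ψ),
    dualForm_add_right h𝒲 (hb _) (hb _) (hadd _ _) (hF.mem_carrier ψ)]
  simp only [dualForm, LinearMap.add_apply]
  ring

theorem continuous_bornJordanDist (hE : IsTestSpace h𝒲 ι) (hF : IsTestSpace h𝒲 κ) :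
    Continuous (bornJordanDist hE hF) := by
  refine continuous_iff_continuousAt.2 fun ⟨u₀, v₀⟩ s hs => ?_
  obtain ⟨M, hM, ε, hε, h⟩ := hF.mem_nhds_iff.1 hs
  obtain ⟨P, hP, hbound⟩ := exists_dualForm_bound (d := d) h𝒲 hM
  obtain ⟨a, ha⟩ := hE.boundedOn_extend u₀ P hP
  obtain ⟨b, hb⟩ := hE.boundedOn_extend v₀ P hP
  have ha' : ∀ f ∈ wordBall d P, ‖hE.extend u₀ f‖ ≤ |a| := fun f hf => (ha f hf).trans (le_abs_self a)
  have hb' : ∀ f ∈ wordBall d P, ‖hE.extend v₀ f‖ ≤ |b| := fun f hf => (hb f hf).trans (le_abs_self b)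
  -- The three terms of the difference are at most η², η|b| and |a|η, and η² ≤ η.
  obtain ⟨η, hη, hη1, hηε⟩ : ∃ η : ℝ, 0 < η ∧ η ≤ 1 ∧ η * (1 + |a| + |b|) ≤ ε := by
    refine ⟨min 1 (ε / (1 + |a| + |b|)), by positivity, min_le_left _ _, ?_⟩
    calc _ ≤ ε / (1 + |a| + |b|) * (1 + |a| + |b|) :=
          mul_le_mul_of_nonneg_right (min_le_right _ _) (by positivity)
      _ = ε := div_mul_cancel₀ _ (by positivity)
  have hnhds : ∀ w₀ : StrongDual ℂ E, {w : StrongDual ℂ E |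
      ∀ f ∈ wordBall d P, ‖hE.extend (w - w₀) f‖ ≤ η} ∈ nhds w₀ := fun w₀ =>
    hE.mem_nhds_iff.2 ⟨P, hP, η, hη, fun w hw f hf => by
      obtain ⟨f, rfl⟩ := hE.exists_eq ⟨P, hP, hf⟩
      rw [hE.extend_apply]
      exact hw f hf⟩
  refine Filter.mem_map.2 (Filter.mem_of_superset (prod_mem_nhds (hnhds u₀) (hnhds v₀)) ?_)
  rintro ⟨u, v⟩ ⟨hu, hv⟩
  refine h _ fun ψ hψ => ?_
  rw [bornJordanDist_sub]
  refine (norm_add₃_le).trans ?_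
  have h1 := hbound _ _ (hE.boundedOn_extend (v - v₀)) η η hu hv _ hψ
  have h2 := hbound _ _ (hE.boundedOn_extend v₀) η |b| hu hb' _ hψ
  have h3 := hbound _ _ (hE.boundedOn_extend (v - v₀)) |a| η ha' hv _ hψ
  nlinarith

theorem bornJordanDist_eq (hE : IsTestSpace h𝒲 ι) (hF : IsTestSpace h𝒲 κ) {u v : StrongDual ℂ E}
    {f φ : Sch d} (hu : ∀ g, u g = ∫ x, f x * ι g x) (hv : ∀ g, v g = ∫ x, φ x * ι g x) (ψ : F) :
    bornJordanDist hE hF (u, v) ψ = ∫ z, bornJordanL d f φ z * κ ψ z := by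
  have h : ∀ {w : StrongDual ℂ E} {f : Sch d}, (∀ g, w g = ∫ x, f x * ι g x) →
      ∀ g ∈ h𝒲.carrier d, hE.extend w g = pairingS f g := fun hw g hg => by
    obtain ⟨g, rfl⟩ := hE.exists_eq hg
    rw [hE.extend_apply, hw, pairingS_apply]
  rw [bornJordanDist_apply, dualForm_congr h𝒲 (hE.boundedOn_extend v) (boundedOn_pairingS 𝒲 φ) (h hu)
    (h hv) (hF.mem_carrier ψ), dualForm_pairingS h𝒲 f φ (hF.mem_carrier ψ)]
  rfl

/-- The Born-Jordan distribution of test functions extends uniquely to functionals. -/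
theorem existsUnique_extension [ContinuousSMul ℂ F] (hE : IsTestSpace h𝒲 ι) (hF : IsTestSpace h𝒲 κ)
    {𝒜 : Set (ℕ → ℝ)} (h𝒜 : WeightClass 𝒜) (hsub : 𝒜 ⊆ 𝒲) {A : Type*} {a : A → Sch d}
    (ha : ∀ f ∈ h𝒜.carrier d, ∃ x, a x = f) {δ : A → StrongDual ℂ E}
    (hδ : ∀ x f, δ x f = ∫ y, a x y * ι f y) {T : A → A → StrongDual ℂ F}
    (hT : ∀ x x' ψ, T x x' ψ = ∫ z, bornJordanL d (a x) (a x') z * κ ψ z) :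
    ∃! B : StrongDual ℂ E × StrongDual ℂ E → StrongDual ℂ F,
      Continuous B ∧ ∀ x x', B (δ x, δ x') = T x x' := by
  have hB : ∀ x x', bornJordanDist hE hF (δ x, δ x') = T x x' := fun x x' => by
    ext ψ
    rw [hT, bornJordanDist_eq hE hF (hδ x) (hδ x')]
  refine ⟨bornJordanDist hE hF, ⟨continuous_bornJordanDist hE hF, hB⟩, fun B hB' => ?_⟩
  -- Uniqueness: both maps are continuous and agree on the product of two dense sets.
  have hd := hE.dense_range h𝒜 hsub ha hδ
  refine (hd.prodMap hd).equalizer hB'.1 (continuous_bornJordanDist hE hF) ?_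
  funext p
  exact (hB'.2 p.1 p.2).trans (hB p.1 p.2).symm

end extension

end

section
/-! ### The classes of weights of the Schwartz and the Gelfand-Shilov spaces -/

section weights

variable {s : ℝ}

/-- The weights that are bounded by `C h^m m!^s` for some `C` and `h`. -/
def rouWeights (s : ℝ) : Set (ℕ → ℝ) :=
  {M | ∃ C > 0, ∃ h > 0, ∀ m, M m ≤ C * (h ^ m * (m.factorial : ℝ) ^ s)}

/-- The weights that are bounded by `C h^m m!^s` for every `h` and some `C`. -/
def beuWeights (s : ℝ) : Set (ℕ → ℝ) :=
  {M | ∀ h > 0, ∃ C > 0, ∀ m, M m ≤ C * (h ^ m * (m.factorial : ℝ) ^ s)}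

theorem factorial_rpow_pos (m : ℕ) (s : ℝ) : 0 < (m.factorial : ℝ) ^ s :=
  Real.rpow_pos_of_pos (by exact_mod_cast m.factorial_pos) s

theorem factorial_rpow_mul_le (hs : 0 ≤ s) (j k : ℕ) :
    (j.factorial : ℝ) ^ s * (k.factorial : ℝ) ^ s ≤ ((j + k).factorial : ℝ) ^ s := by
  rw [← Real.mul_rpow (by positivity) (by positivity)]
  refine Real.rpow_le_rpow (by positivity) ?_ hs
  exact_mod_cast Nat.le_of_dvd (Nat.factorial_pos _) (Nat.factorial_mul_factorial_dvd_factorial_add j k)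

theorem factorial_add_rpow_le (hs : 0 ≤ s) (j k : ℕ) :
    ((j + k).factorial : ℝ) ^ s ≤
      ((2 : ℝ) ^ s) ^ (j + k) * ((j.factorial : ℝ) ^ s * (k.factorial : ℝ) ^ s) := by
  rw [← Real.rpow_natCast, ← Real.rpow_mul (by norm_num), mul_comm s, Real.rpow_mul (by norm_num),
    Real.rpow_natCast, ← Real.mul_rpow (by positivity) (by positivity),
    ← Real.mul_rpow (by positivity) (by positivity)]
  refine Real.rpow_le_rpow (by positivity) ?_ hs
  have h : (j + k).factorial ≤ 2 ^ (j + k) * (j.factorial * k.factorial) := by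
    rw [← Nat.add_choose_mul_factorial_mul_factorial, mul_assoc]
    exact Nat.mul_le_mul_right _ (Nat.choose_le_two_pow _ _)
  exact_mod_cast h

theorem factorial_succ_rpow_le (hs : 0 ≤ s) (m : ℕ) :
    ((m + 1).factorial : ℝ) ^ s ≤ (2 : ℝ) ^ s * (((2 : ℝ) ^ s) ^ m * (m.factorial : ℝ) ^ s) := by
  have h := factorial_add_rpow_le hs m 1
  simpa [pow_succ, mul_assoc, mul_comm, mul_left_comm] using h

theorem natCast_succ_le_two_pow (m : ℕ) : ((m : ℝ) + 1) ≤ 2 ^ m := by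
  exact_mod_cast Nat.succ_le_of_lt m.lt_two_pow_self

theorem mul_le_sum_range {M N : ℕ → ℝ} (hM : ∀ m, 0 < M m) (hN : ∀ m, 0 < N m) (j k : ℕ) :
    M j * N k ≤ ∑ i ∈ Finset.range (j + k + 1), M i * N (j + k - i) := by
  have h := Finset.single_le_sum (f := fun i => M i * N (j + k - i))
    (fun i _ => (mul_pos (hM i) (hN _)).le) (Finset.mem_range.2 (by omega : j < j + k + 1))
  simpa using h

theorem weightClass_univ : WeightClass Set.univ where
  add _ _ := trivial
  scale _ _ _ _ _ := trivial
  shift _ := trivial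
  split {M} _ := by
    have hnn : ∀ m, 0 ≤ ∑ i ∈ Finset.range (2 * m + 1), |M i| := fun m =>
      Finset.sum_nonneg fun i _ => abs_nonneg _
    have key : ∀ j m, j ≤ 2 * m → M j ≤ 1 + ∑ i ∈ Finset.range (2 * m + 1), |M i| := fun j m h => by
      have := Finset.single_le_sum (f := fun i => |M i|) (fun i _ => abs_nonneg _)
        (Finset.mem_range.2 (by omega : j < 2 * m + 1))
      have := le_abs_self (M j)
      linarith
    -- The larger of j and k is at least (j + k)/2, so its factor alone dominates M(j + k); the
    -- other factor is at least 1.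
    refine ⟨fun m => 1 + ∑ i ∈ Finset.range (2 * m + 1), |M i|, trivial, fun m => ?_, fun j k => ?_⟩
    · have := hnn m
      linarith
    · rcases le_total j k with h | h
      · exact (key _ k (by omega)).trans (le_mul_of_one_le_left (by have := hnn k; linarith)
          (by have := hnn j; linarith))
      · exact (key _ j (by omega)).trans (le_mul_of_one_le_right (by have := hnn j; linarith)
          (by have := hnn k; linarith))
  mul {M N} _ _ hM hN :=
    ⟨fun m => ∑ i ∈ Finset.range (m + 1), M i * N (m - i), trivial, mul_le_sum_range hM hN⟩
  gaussian := trivial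

theorem weightClass_rouWeights (hs : 1 / 2 ≤ s) : WeightClass (rouWeights s) where
  add := by
    rintro M N ⟨C, hC, h, hh, hM⟩ ⟨D, hD, k, hk, hN⟩
    refine ⟨C + D, by positivity, max h k, lt_max_of_lt_left hh, fun m => ?_⟩
    rw [add_mul]
    refine add_le_add ((hM m).trans ?_) ((hN m).trans ?_)
    · gcongr
      exact le_max_left _ _
    · gcongr
      exact le_max_right _ _
  scale := by
    rintro M A c ⟨C, hC, h, hh, hM⟩ hA hc
    refine ⟨(A + 1) * C, by positivity, (c + 1) * h, by positivity, fun m => ?_⟩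
    calc A * (c ^ m * M m) ≤ A * (c ^ m * (C * (h ^ m * (m.factorial : ℝ) ^ s))) := by
          gcongr
          exact hM m
      _ ≤ (A + 1) * ((c + 1) ^ m * (C * (h ^ m * (m.factorial : ℝ) ^ s))) := by
          gcongr <;> linarith
      _ = _ := by
          rw [mul_pow]
          ring
  shift := by
    rintro M ⟨C, hC, h, hh, hM⟩
    refine ⟨C * h * 2 ^ s, by positivity, h * 2 ^ s, by positivity, fun m => (hM _).trans ?_⟩
    calc C * (h ^ (m + 1) * ((m + 1).factorial : ℝ) ^ s)
        ≤ C * (h ^ (m + 1) * ((2 : ℝ) ^ s * (((2 : ℝ) ^ s) ^ m * (m.factorial : ℝ) ^ s))) := by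
          gcongr
          exact factorial_succ_rpow_le (by linarith) m
      _ = _ := by
          rw [mul_pow]
          ring
  split := by
    rintro M ⟨C, hC, h, hh, hM⟩
    refine ⟨fun m => (C + 1) * ((h * 2 ^ s) ^ m * (m.factorial : ℝ) ^ s),
      ⟨C + 1, by positivity, h * 2 ^ s, by positivity, fun m => le_rfl⟩,
      fun m => by positivity, fun j k => (hM _).trans ?_⟩
    calc C * (h ^ (j + k) * ((j + k).factorial : ℝ) ^ s)
        ≤ (C + 1) ^ 2 * (h ^ (j + k) * (((2 : ℝ) ^ s) ^ (j + k) *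
          ((j.factorial : ℝ) ^ s * (k.factorial : ℝ) ^ s))) := by
          gcongr
          · nlinarith
          · exact factorial_add_rpow_le (by linarith) j k
      _ = _ := by
          simp only [mul_pow, pow_add]
          ring
  mul := by
    rintro M N ⟨C, hC, h, hh, hM⟩ ⟨D, hD, k, hk, hN⟩ hMpos hNpos
    have hmax : 0 < max h k := lt_max_of_lt_left hh
    refine ⟨fun m => C * D * (max h k ^ m * (m.factorial : ℝ) ^ s),
      ⟨C * D, by positivity, max h k, hmax, fun m => le_rfl⟩, fun i j => ?_⟩
    calc M i * N j ≤ (C * (h ^ i * (i.factorial : ℝ) ^ s)) * (D * (k ^ j * (j.factorial : ℝ) ^ s)) :=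
          mul_le_mul (hM i) (hN j) (hNpos j).le (by positivity)
      _ ≤ (C * (max h k ^ i * (i.factorial : ℝ) ^ s)) *
          (D * (max h k ^ j * (j.factorial : ℝ) ^ s)) := by
          gcongr
          · exact le_max_left _ _
          · exact le_max_right _ _
      _ = C * D * (max h k ^ (i + j) * ((i.factorial : ℝ) ^ s * (j.factorial : ℝ) ^ s)) := by
          rw [pow_add]
          ring
      _ ≤ C * D * (max h k ^ (i + j) * ((i + j).factorial : ℝ) ^ s) := by
          gcongr
          exact factorial_rpow_mul_le (by linarith) i j
  gaussian := by
    refine ⟨1, one_pos, 2, two_pos, fun m => ?_⟩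
    beta_reduce
    rw [one_mul, Real.sqrt_eq_rpow]
    gcongr
    exact_mod_cast m.factorial_pos

/-- A decreasing envelope of a family that decays faster than exponentially. -/
theorem exists_antitone_envelope {b : ℕ → ℝ} (hb : ∀ h > 0, ∃ C > 0, ∀ m, b m ≤ C * h ^ m) :
    ∃ N : ℕ → ℝ, (∀ m, 0 < N m) ∧ Antitone N ∧ (∀ m, b m ≤ N m) ∧
      ∀ h > 0, ∃ C > 0, ∀ m, N m ≤ C * h ^ m := by
  -- 1/m! makes the family positive and still decays faster than every exponential; N is then the
  -- supremum of the tail.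
  let a : ℕ → ℝ := fun m => max (b m) (1 / m.factorial)
  have ha : ∀ h > 0, ∃ C > 0, ∀ m, a m ≤ C * h ^ m := by
    intro h hh
    obtain ⟨C, hC, hbC⟩ := hb h hh
    refine ⟨max C (Real.exp h⁻¹), lt_max_of_lt_left hC, fun m => max_le ((hbC m).trans ?_) ?_⟩
    · gcongr
      exact le_max_left _ _
    · have h1 := Real.pow_div_factorial_le_exp h⁻¹ (by positivity) m
      calc (1 : ℝ) / m.factorial = h⁻¹ ^ m / m.factorial * h ^ m := by
            rw [inv_pow]
            field_simp
        _ ≤ max C (Real.exp h⁻¹) * h ^ m := by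
            gcongr
            exact h1.trans (le_max_right _ _)
  have hbound : ∀ h > 0, h ≤ 1 → ∃ C > 0, ∀ m i, a (m + i) ≤ C * h ^ m := by
    intro h hh h1
    obtain ⟨C, hC, haC⟩ := ha h hh
    refine ⟨C, hC, fun m i => (haC _).trans ?_⟩
    gcongr C * ?_
    exact pow_le_pow_of_le_one hh.le h1 (Nat.le_add_right _ _)
  have hbdd : ∀ m, BddAbove (Set.range fun i => a (m + i)) := fun m => by
    obtain ⟨C, -, h⟩ := hbound 1 one_pos le_rfl
    exact ⟨C * 1 ^ m, by rintro _ ⟨i, rfl⟩; exact h m i⟩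
  have hle : ∀ m i, a (m + i) ≤ ⨆ i, a (m + i) := fun m i => le_ciSup (hbdd m) i
  refine ⟨fun m => ⨆ i, a (m + i), fun m => ?_, fun m m' h => ciSup_le fun i => ?_, fun m => ?_,
    fun h hh => ?_⟩
  · exact (by positivity : (0 : ℝ) < 1 / m.factorial).trans_le ((le_max_right _ _).trans (hle m 0))
  · obtain ⟨k, rfl⟩ := Nat.exists_eq_add_of_le h
    rw [add_assoc]
    exact hle m (k + i)
  · exact (le_max_left _ _).trans (hle m 0)
  · obtain ⟨C, hC, h'⟩ := hbound (min h 1) (by positivity) (min_le_right _ _)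
    refine ⟨C, hC, fun m => (ciSup_le fun i => h' m i).trans ?_⟩
    gcongr
    exact min_le_left _ _

theorem weightClass_beuWeights (hs : 1 / 2 < s) : WeightClass (beuWeights s) where
  add := by
    intro M N hM hN h hh
    obtain ⟨C, hC, hM⟩ := hM h hh
    obtain ⟨D, hD, hN⟩ := hN h hh
    refine ⟨C + D, by positivity, fun m => ?_⟩
    rw [add_mul]
    exact add_le_add (hM m) (hN m)
  scale := by
    intro M A c hM hA hc h hh
    obtain ⟨C, hC, hM⟩ := hM (h / (c + 1)) (by positivity)
    refine ⟨(A + 1) * C, by positivity, fun m => ?_⟩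
    calc A * (c ^ m * M m) ≤ A * (c ^ m * (C * ((h / (c + 1)) ^ m * (m.factorial : ℝ) ^ s))) := by
          gcongr
          exact hM m
      _ ≤ (A + 1) * ((c + 1) ^ m * (C * ((h / (c + 1)) ^ m * (m.factorial : ℝ) ^ s))) := by
          gcongr <;> linarith
      _ = _ := by
          rw [div_pow]
          field_simp
  shift := by
    intro M hM h hh
    obtain ⟨C, hC, hM⟩ := hM (h / 2 ^ s) (by positivity)
    refine ⟨C * h, by positivity, fun m => (hM _).trans ?_⟩
    calc C * ((h / 2 ^ s) ^ (m + 1) * ((m + 1).factorial : ℝ) ^ s)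
        ≤ C * ((h / 2 ^ s) ^ (m + 1) *
          ((2 : ℝ) ^ s * (((2 : ℝ) ^ s) ^ m * (m.factorial : ℝ) ^ s))) := by
          gcongr
          exact factorial_succ_rpow_le (by linarith) m
      _ = _ := by
          rw [div_pow, pow_succ h, pow_succ ((2 : ℝ) ^ s)]
          field_simp
  split := by
    intro M hM
    -- One M' has to serve all h at once, so a geometric choice is not available. For decreasing N,
    -- N(j + k) ≤ √N(j) √N(k), and √N still decays faster than every exponential.
    obtain ⟨N, hpos, hanti, hMN, hN⟩ := exists_antitone_envelope
      (b := fun m => M m / (m.factorial : ℝ) ^ s) fun h hh => by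
        obtain ⟨C, hC, hM⟩ := hM h hh
        refine ⟨C, hC, fun m => ?_⟩
        rw [div_le_iff₀ (factorial_rpow_pos m s), mul_assoc]
        exact hM m
    refine ⟨fun m => √(N m) * (((2 : ℝ) ^ s) ^ m * (m.factorial : ℝ) ^ s), fun h hh => ?_,
      fun m => ?_, fun j k => ?_⟩
    · obtain ⟨C, hC, hN⟩ := hN ((h / 2 ^ s) ^ 2) (by positivity)
      refine ⟨√C, by positivity, fun m => ?_⟩
      calc √(N m) * (((2 : ℝ) ^ s) ^ m * (m.factorial : ℝ) ^ s)
          ≤ √(C * ((h / 2 ^ s) ^ 2) ^ m) * (((2 : ℝ) ^ s) ^ m * (m.factorial : ℝ) ^ s) := by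
            gcongr
            exact hN m
        _ = _ := by
            rw [Real.sqrt_mul hC.le, ← pow_mul, mul_comm 2, pow_mul, Real.sqrt_sq (by positivity),
              div_pow]
            field_simp
    · have := factorial_rpow_pos m s
      have := hpos m
      positivity
    · have h1 : M (j + k) ≤ N (j + k) * ((j + k).factorial : ℝ) ^ s := by
        rw [← div_le_iff₀ (factorial_rpow_pos _ s)]
        exact hMN _
      calc M (j + k) ≤ N (j + k) * ((j + k).factorial : ℝ) ^ s := h1
        _ = √(N (j + k)) * √(N (j + k)) * ((j + k).factorial : ℝ) ^ s := by
            rw [Real.mul_self_sqrt (hpos _).le]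
        _ ≤ √(N j) * √(N k) * (((2 : ℝ) ^ s) ^ (j + k) *
            ((j.factorial : ℝ) ^ s * (k.factorial : ℝ) ^ s)) := by
            gcongr
            · exact hanti (Nat.le_add_right _ _)
            · exact hanti (Nat.le_add_left _ _)
            · exact factorial_add_rpow_le (by linarith) j k
        _ = _ := by
            rw [pow_add]
            ring
  mul := by
    intro M N hM hN hMpos hNpos
    -- The m + 1 ≤ 2^m terms are paid for by using the bounds for h/2.
    refine ⟨fun m => ∑ i ∈ Finset.range (m + 1), M i * N (m - i), fun h hh => ?_,
      mul_le_sum_range hMpos hNpos⟩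
    obtain ⟨C, hC, hM⟩ := hM (h / 2) (by positivity)
    obtain ⟨D, hD, hN⟩ := hN (h / 2) (by positivity)
    refine ⟨C * D, by positivity, fun m => ?_⟩
    calc ∑ i ∈ Finset.range (m + 1), M i * N (m - i)
        ≤ ∑ i ∈ Finset.range (m + 1), C * D * ((h / 2) ^ m * (m.factorial : ℝ) ^ s) := by
          refine Finset.sum_le_sum fun i hi => ?_
          obtain ⟨k, rfl⟩ := Nat.exists_eq_add_of_le (Nat.lt_succ_iff.1 (Finset.mem_range.1 hi))
          rw [Nat.add_sub_cancel_left]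
          calc M i * N k ≤ (C * ((h / 2) ^ i * (i.factorial : ℝ) ^ s)) *
                (D * ((h / 2) ^ k * (k.factorial : ℝ) ^ s)) :=
                mul_le_mul (hM i) (hN k) (hNpos k).le (by positivity)
            _ = C * D * ((h / 2) ^ (i + k) * ((i.factorial : ℝ) ^ s * (k.factorial : ℝ) ^ s)) := by
                rw [pow_add]
                ring
            _ ≤ _ := by
                gcongr
                exact factorial_rpow_mul_le (by linarith) i k
      _ = C * D * ((m + 1) * ((h / 2) ^ m * (m.factorial : ℝ) ^ s)) := by
          rw [Finset.sum_const, Finset.card_range, nsmul_eq_mul]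
          push_cast
          ring
      _ ≤ C * D * (2 ^ m * ((h / 2) ^ m * (m.factorial : ℝ) ^ s)) := by
          gcongr
          exact natCast_succ_le_two_pow m
      _ = _ := by
          rw [div_pow]
          field_simp
  gaussian := by
    intro h hh
    have hσ : 0 < s - 1 / 2 := by linarith
    -- Chosen so that r^{s - 1/2} = 2/h; then r^m ≤ e^r m! absorbs (2/h)^m into m!^{s - 1/2}. This
    -- is where s > 1/2 is needed.
    set r : ℝ := (2 / h) ^ (1 / (s - 1 / 2)) with hr
    have hr0 : 0 < r := by positivity
    refine ⟨Real.exp r ^ (s - 1 / 2), by positivity, fun m => ?_⟩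
    have h1 : (2 / h) ^ m ≤ Real.exp r ^ (s - 1 / 2) * (m.factorial : ℝ) ^ (s - 1 / 2) := by
      have h2 := Real.pow_div_factorial_le_exp r hr0.le m
      rw [div_le_iff₀ (by positivity)] at h2
      have h3 : r ^ (s - 1 / 2) = 2 / h := by
        rw [hr, ← Real.rpow_mul (by positivity), one_div_mul_cancel hσ.ne', Real.rpow_one]
      rw [← Real.mul_rpow (by positivity) (by positivity), ← h3, ← Real.rpow_natCast,
        ← Real.rpow_mul hr0.le, mul_comm (s - 1 / 2), Real.rpow_mul hr0.le, Real.rpow_natCast]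
      exact Real.rpow_le_rpow (by positivity) h2 hσ.le
    have h4 : (m.factorial : ℝ) ^ s = (m.factorial : ℝ) ^ (s - 1 / 2) * √(m.factorial : ℝ) := by
      rw [Real.sqrt_eq_rpow, ← Real.rpow_add (by positivity)]
      congr 1
      ring
    calc 2 ^ m * √(m.factorial : ℝ) = (2 / h) ^ m * (h ^ m * √(m.factorial : ℝ)) := by
          rw [div_pow]
          field_simp
      _ ≤ Real.exp r ^ (s - 1 / 2) * (m.factorial : ℝ) ^ (s - 1 / 2) *
          (h ^ m * √(m.factorial : ℝ)) := by gcongr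
      _ = _ := by
          rw [h4]
          ring

end weights

end

section
/-! ### The norms of `𝒮_{s,h}` and words -/

section normalOrder

variable {n : ℕ}

theorem word_map_inl (us : List (Fin n)) (f : Sch n) (x : Euc n) :
    word (us.map Sum.inl) f x = (us.map fun i => (x i : ℂ)).prod * f x := by
  induction us generalizing f with
  | nil => simp
  | cons i us ih =>
    simp [ih]
    ring

theorem word_map_inr_perm {vs vs' : List (Fin n)} (h : vs.Perm vs') (f : Sch n) :
    word (vs.map Sum.inr) f = word (vs'.map Sum.inr) f := by
  induction h generalizing f with
  | nil => rfl
  | cons i _ ih => exact ih _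
  | swap i j l =>
    simp only [List.map_cons, word_cons, letter_inr]
    rw [pderiv_comm]
  | trans _ _ ih ih' => exact (ih f).trans (ih' f)

theorem word_replicate_inr (i : Fin n) (k : ℕ) (f : Sch n) :
    word ((List.replicate k i).map Sum.inr) f = (pderiv i ^ k) f := by
  induction k generalizing f with
  | zero => rfl
  | succ k ih =>
    rw [List.replicate_succ, List.map_cons, word_cons, ih, pow_succ]
    rfl

/-- The list in which the index `i` occurs `α i` times. -/
def indexList (α : Fin n → ℕ) : List (Fin n) :=
  (List.finRange n).flatMap fun i => List.replicate (α i) i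

theorem count_indexList (α : Fin n → ℕ) (i : Fin n) : (indexList α).count i = α i := by
  rw [indexList, List.count_flatMap, ← Fin.sum_univ_def]
  simp [List.count_replicate]

theorem word_indexList (α : Fin n → ℕ) (f : Sch n) :
    word ((indexList α).map Sum.inr) f = multiDeriv α f := by
  rw [indexList, multiDeriv]
  induction List.finRange n with
  | nil => rfl
  | cons i l ih =>
    -- The head of a word acts first, the head of a product of operators last; derivatives commute,
    -- so the order is irrelevant.
    rw [List.flatMap_cons, word_map_inr_perm List.perm_append_comm, List.map_append, word_append, ih,
      word_replicate_inr]
    rfl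

theorem perm_indexList (vs : List (Fin n)) : vs.Perm (indexList fun i => vs.count i) :=
  List.perm_iff_count.2 fun i => (count_indexList (fun i => vs.count i) i).symm

theorem prod_map_eq {R : Type*} [CommMonoid R] (us : List (Fin n)) (g : Fin n → R) :
    (us.map g).prod = ∏ i, g i ^ us.count i := by
  rw [Finset.prod_list_map_count]
  refine Finset.prod_subset (Finset.subset_univ _) fun i _ hi => ?_
  rw [List.count_eq_zero_of_not_mem (by simpa using hi), pow_zero]

theorem length_eq_sum_count (us : List (Fin n)) : us.length = ∑ i, us.count i := by
  have h := prod_map_eq us fun _ => Multiplicative.ofAdd 1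
  have := congrArg Multiplicative.toAdd h
  simpa [List.map_const'] using this

theorem norm_word_normal (us vs : List (Fin n)) (f : Sch n) (x : Euc n) :
    ‖word (vs.map Sum.inr ++ us.map Sum.inl) f x‖ =
      |∏ i, x i ^ us.count i| * ‖multiDeriv (fun i => vs.count i) f x‖ := by
  rw [word_append, word_map_inl, word_map_inr_perm (perm_indexList vs), word_indexList, norm_mul,
    prod_map_eq]
  congr 1
  rw [← Real.norm_eq_abs, ← Complex.norm_real]
  push_cast
  rfl

theorem factorial_sum_le (t : Finset (Fin n)) (α : Fin n → ℕ) :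
    (∑ i ∈ t, α i).factorial ≤ (2 ^ t.card) ^ (∑ i ∈ t, α i) * ∏ i ∈ t, (α i).factorial := by
  induction t using Finset.induction_on with
  | empty => simp
  | insert a t ha ih =>
    rw [Finset.sum_insert ha, Finset.prod_insert ha, Finset.card_insert_of_notMem ha]
    calc (α a + ∑ i ∈ t, α i).factorial
        ≤ 2 ^ (α a + ∑ i ∈ t, α i) * ((α a).factorial * (∑ i ∈ t, α i).factorial) := by
          rw [← Nat.add_choose_mul_factorial_mul_factorial, mul_assoc]
          exact Nat.mul_le_mul_right _ (Nat.choose_le_two_pow _ _)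
      _ ≤ 2 ^ (α a + ∑ i ∈ t, α i) * ((α a).factorial *
          ((2 ^ t.card) ^ (α a + ∑ i ∈ t, α i) * ∏ i ∈ t, (α i).factorial)) := by
          gcongr
          refine ih.trans (Nat.mul_le_mul_right _ (Nat.pow_le_pow_right (by positivity) ?_))
          omega
      _ = _ := by
          rw [pow_succ, mul_pow]
          ring

theorem factorial_sum_add_sum_le (α β : Fin n → ℕ) :
    ((∑ i, α i) + ∑ i, β i).factorial ≤ (2 ^ (n + 1)) ^ ((∑ i, α i) + ∑ i, β i) *
      ((∏ i, (α i).factorial) * ∏ i, (β i).factorial) := by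
  have h1 := factorial_sum_le Finset.univ α
  have h2 := factorial_sum_le Finset.univ β
  rw [Finset.card_univ, Fintype.card_fin] at h1 h2
  calc ((∑ i, α i) + ∑ i, β i).factorial
      ≤ 2 ^ ((∑ i, α i) + ∑ i, β i) * ((∑ i, α i).factorial * (∑ i, β i).factorial) := by
        rw [← Nat.add_choose_mul_factorial_mul_factorial, mul_assoc]
        exact Nat.mul_le_mul_right _ (Nat.choose_le_two_pow _ _)
    _ ≤ 2 ^ ((∑ i, α i) + ∑ i, β i) * (((2 ^ n) ^ (∑ i, α i) * ∏ i, (α i).factorial) *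
        ((2 ^ n) ^ (∑ i, β i) * ∏ i, (β i).factorial)) := by
        gcongr
    _ = _ := by
        rw [pow_succ, mul_pow, pow_add (2 ^ n)]
        ring

/-- x^β ∂^α is a word of length |α| + |β|, and (|α| + |β|)! ≤ 2^{(n+1)(|α|+|β|)} α! β!, which
enlarges h by the factor (2^{n+1})^s. -/
theorem ratios_le_of_mem_wordBall {s : ℝ} (hs : 0 ≤ s) {C h : ℝ} (hC : 0 ≤ C) (hh : 0 < h) {f : Sch n}
    (hf : f ∈ wordBall n fun m => C * (h ^ m * (m.factorial : ℝ) ^ s)) (a : Idx n) :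
    ratios s (((2 : ℝ) ^ (n + 1)) ^ s * h) f a ≤ C := by
  obtain ⟨α, β, x⟩ := a
  rw [ratios, ratio, div_le_iff₀ (denom_pos (by positivity) _ _)]
  have e := norm_word_normal (indexList β) (indexList α) f x
  simp only [count_indexList] at e
  rw [← e]
  refine (hf _ x).trans ?_
  have hl : ((indexList α).map Sum.inr ++ (indexList β).map Sum.inl : List (Letter n)).length =
      (∑ i, α i) + ∑ i, β i := by
    simp only [List.length_append, List.length_map, length_eq_sum_count, count_indexList]
  rw [hl, mul_pow, mul_right_comm]
  refine mul_le_mul_of_nonneg_left ?_ hC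
  rw [mul_comm]
  refine mul_le_mul_of_nonneg_right ?_ (by positivity)
  rw [← Real.rpow_natCast, ← Real.rpow_mul (by positivity), mul_comm s, Real.rpow_mul (by positivity),
    Real.rpow_natCast, ← Real.mul_rpow (by positivity) (by positivity)]
  refine Real.rpow_le_rpow (by positivity) ?_ hs
  exact_mod_cast factorial_sum_add_sum_le α β

/-- Bounds for the operators `x^{us} ∂^{vs}`. -/
def NormallyBounded (M : ℕ → ℝ) (f : Sch n) : Prop :=
  ∀ (us vs : List (Fin n)) x, ‖word (vs.map Sum.inr ++ us.map Sum.inl) f x‖ ≤ M (vs.length + us.length)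

theorem normallyBounded_of_ratios {s : ℝ} (hs : 0 ≤ s) {C h : ℝ} (hC : 0 ≤ C) (hh : 0 < h) {f : Sch n}
    (hf : ∀ a, ratios s h f a ≤ C) :
    NormallyBounded (fun m => C * (h ^ m * (m.factorial : ℝ) ^ s)) f := fun us vs x => by
  have h1 := hf (fun i => vs.count i, fun i => us.count i, x)
  rw [ratios, ratio, div_le_iff₀ (denom_pos hh _ _)] at h1
  rw [norm_word_normal]
  refine h1.trans ?_
  rw [length_eq_sum_count us, length_eq_sum_count vs]
  refine mul_le_mul_of_nonneg_left (mul_le_mul_of_nonneg_left ?_ (by positivity)) hC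
  refine Real.rpow_le_rpow (by positivity) ?_ hs
  have h2 := Nat.le_of_dvd (Nat.factorial_pos _)
    (Nat.prod_factorial_dvd_factorial_sum Finset.univ fun i => vs.count i)
  have h3 := Nat.le_of_dvd (Nat.factorial_pos _)
    (Nat.prod_factorial_dvd_factorial_sum Finset.univ fun i => us.count i)
  exact_mod_cast (Nat.mul_le_mul h2 h3).trans
    (Nat.le_of_dvd (Nat.factorial_pos _) (Nat.factorial_mul_factorial_dvd_factorial_add _ _))

/-- Moving xᵢ past the derivatives leaves a commutator, with that derivative deleted, for each
occurrence of ∂ᵢ. -/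
theorem word_map_inr_coordMul (vs : List (Fin n)) (i : Fin n) (f : Sch n) :
    ∃ L : List (List (Fin n)), L.length ≤ vs.length ∧ (∀ ws ∈ L, ws.length + 1 = vs.length) ∧
      word (vs.map Sum.inr) (coordMul i f) =
        coordMul i (word (vs.map Sum.inr) f) + (L.map fun ws => word (ws.map Sum.inr) f).sum := by
  induction vs generalizing f with
  | nil => exact ⟨[], by simp⟩
  | cons j vs ih =>
    obtain ⟨L, hL, hL', e⟩ := ih (pderiv j f)
    refine ⟨L.map (j :: ·) ++ (if j = i then [vs] else []), ?_, ?_, ?_⟩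
    · by_cases h : j = i <;> simp [h] <;> omega
    · intro ws hws
      rcases List.mem_append.1 hws with hws | hws
      · obtain ⟨ws, hws', rfl⟩ := List.mem_map.1 hws
        simpa using hL' ws hws'
      · by_cases h : j = i <;> simp_all
    · rw [List.map_cons, word_cons, letter_inr, pderiv_coordMul, map_add, e, List.map_append,
        List.sum_append, List.map_map, word_cons, letter_inr, add_assoc]
      congr 2
      by_cases h : j = i <;> simp [h]

theorem NormallyBounded.apply_letter {M : ℕ → ℝ} {f : Sch n} (hf : NormallyBounded M f) (hM : ∀ m, 0 ≤ M m)
    (l : Letter n) : NormallyBounded (fun m => M (m + 1) + m * M (m - 1)) (letter l f) :=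
  fun us vs x => by
  have hnn : 0 ≤ ((vs.length + us.length : ℕ) : ℝ) * M (vs.length + us.length - 1) :=
    mul_nonneg (Nat.cast_nonneg _) (hM _)
  rcases l with i | i
  · obtain ⟨L, hL, hL', e⟩ := word_map_inr_coordMul vs i f
    rw [letter_inl, word_append, e, map_add, add_apply]
    refine (norm_add_le _ _).trans (add_le_add ?_ ?_)
    · have := hf (i :: us) vs x
      rw [word_append] at this
      exact this
    · have h1 : ‖word (us.map Sum.inl) (L.map fun ws => word (ws.map Sum.inr) f).sum x‖ ≤
          L.length * M (vs.length + us.length - 1) := by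
        have h2 : ∀ ws ∈ L, ‖word (us.map Sum.inl) (word (ws.map Sum.inr) f) x‖ ≤
            M (vs.length + us.length - 1) := fun ws hws => by
          have h3 := hf us ws x
          rw [word_append] at h3
          rwa [← hL' ws hws, add_right_comm, Nat.add_sub_cancel]
        clear hL hL' e
        induction L with
        | nil => simp
        | cons a L ih =>
          rw [List.map_cons, List.sum_cons, map_add, add_apply, List.length_cons]
          push_cast
          rw [add_mul, one_mul, add_comm (_ * _)]
          exact (norm_add_le _ _).trans (add_le_add (h2 a List.mem_cons_self)
            (ih fun ws hws => h2 ws (List.mem_cons_of_mem _ hws)))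
      refine h1.trans (mul_le_mul_of_nonneg_right ?_ (hM _))
      exact_mod_cast hL.trans (Nat.le_add_right _ _)
  · have := hf us (i :: vs) x
    rw [List.length_cons, Nat.add_right_comm] at this
    exact this.trans (le_add_of_nonneg_right hnn)

/-- The two factorials differ by two factors, each at least m + K. Their s-th power is at least (m +
K)^{2s}, which absorbs the number m of commutators. -/
theorem natCast_mul_factorial_rpow_le {s ε : ℝ} (hs : 0 ≤ s) (hε : 0 ≤ ε) {K : ℕ}
    (hK : ∀ m : ℕ, (m : ℝ) ≤ ε * ((m : ℝ) + K) ^ (2 * s)) (m j : ℕ) :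
    m * ((m - 1 + j + K).factorial : ℝ) ^ s ≤ ε * ((m + 1 + j + K).factorial : ℝ) ^ s := by
  rcases m with - | m
  · simp only [Nat.cast_zero, zero_mul]
    positivity
  · rw [Nat.add_sub_cancel]
    have h1 : (m + 1 + 1 + j + K).factorial =
        (m + 2 + j + K) * (m + 1 + j + K) * (m + j + K).factorial := by
      rw [show m + 1 + 1 + j + K = (m + j + K) + 1 + 1 by ring, Nat.factorial_succ, Nat.factorial_succ]
      ring
    rw [h1, Nat.cast_mul, Real.mul_rpow (by positivity) (by positivity), ← mul_assoc]
    refine mul_le_mul_of_nonneg_right ((hK (m + 1)).trans (mul_le_mul_of_nonneg_left ?_ hε))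
      (by positivity)
    rw [Real.rpow_mul (by positivity), Real.rpow_two]
    refine Real.rpow_le_rpow (by positivity) ?_ hs
    push_cast
    have : (0 : ℝ) ≤ j := j.cast_nonneg
    nlinarith [K.cast_nonneg (α := ℝ), m.cast_nonneg (α := ℝ)]

/-- A letter raises the factorial by one and costs h for the leading term and ε/h for the
commutators; j counts the letters already applied. -/
theorem NormallyBounded.norm_word_le {s ε : ℝ} (hs : 0 ≤ s) (hε : 0 ≤ ε) {K : ℕ}
    (hK : ∀ m : ℕ, (m : ℝ) ≤ ε * ((m : ℝ) + K) ^ (2 * s)) {C h : ℝ} (hC : 0 ≤ C) (hh : 0 < h)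
    (w : List (Letter n)) {j : ℕ} {f : Sch n}
    (hf : NormallyBounded (fun m => C * (h ^ m * ((m + j + K).factorial : ℝ) ^ s)) f) (x : Euc n) :
    ‖word w f x‖ ≤ C * ((h + ε / h) ^ w.length * ((j + w.length + K).factorial : ℝ) ^ s) := by
  induction w generalizing j C f with
  | nil => simpa using hf [] [] x
  | cons l w ih =>
    have h1 : NormallyBounded
        (fun m => C * (h + ε / h) * (h ^ m * ((m + (j + 1) + K).factorial : ℝ) ^ s)) (letter l f) :=
      fun us vs x => by
        refine (hf.apply_letter (fun m => by positivity) l us vs x).trans ?_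
        set m := vs.length + us.length
        have h2 := natCast_mul_factorial_rpow_le hs hε hK m j
        have h3 : (m : ℝ) * (C * (h ^ (m - 1) * ((m - 1 + j + K).factorial : ℝ) ^ s)) ≤
            C * (ε / h) * (h ^ m * ((m + 1 + j + K).factorial : ℝ) ^ s) := by
          rcases Nat.eq_zero_or_pos m with h0 | h0
          · rw [h0, Nat.cast_zero, zero_mul]
            positivity
          · have h4 : h ^ m = h ^ (m - 1) * h := by
              rw [← pow_succ, Nat.sub_add_cancel h0]
            calc (m : ℝ) * (C * (h ^ (m - 1) * ((m - 1 + j + K).factorial : ℝ) ^ s))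
                = C * h ^ (m - 1) * (m * ((m - 1 + j + K).factorial : ℝ) ^ s) := by ring
              _ ≤ C * h ^ (m - 1) * (ε * ((m + 1 + j + K).factorial : ℝ) ^ s) := by gcongr
              _ = _ := by
                rw [h4]
                field_simp
        refine (add_le_add le_rfl h3).trans (le_of_eq ?_)
        beta_reduce
        rw [show m + (j + 1) + K = m + 1 + j + K by ring]
        ring
    rw [word_cons, List.length_cons]
    refine (ih (by positivity) h1).trans (le_of_eq ?_)
    rw [show j + 1 + w.length + K = j + (w.length + 1) + K by ring]
    ring

theorem mem_wordBall_of_ratios {s ε : ℝ} (hs : 0 ≤ s) (hε : 0 ≤ ε) {K : ℕ}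
    (hK : ∀ m : ℕ, (m : ℝ) ≤ ε * ((m : ℝ) + K) ^ (2 * s)) {C h : ℝ} (hC : 0 ≤ C) (hh : 0 < h)
    {f : Sch n} (hf : ∀ a, ratios s h f a ≤ C) :
    f ∈ wordBall n fun m => C * ((h + ε / h) ^ m * ((m + K).factorial : ℝ) ^ s) := fun w x => by
  have h1 : NormallyBounded (fun m => C * (h ^ m * ((m + 0 + K).factorial : ℝ) ^ s)) f :=
    fun us vs x => by
      refine (normallyBounded_of_ratios hs hC hh hf us vs x).trans ?_
      refine mul_le_mul_of_nonneg_left (mul_le_mul_of_nonneg_left ?_ (by positivity)) hC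
      refine Real.rpow_le_rpow (by positivity) ?_ hs
      exact_mod_cast Nat.factorial_le (by omega)
  simpa using h1.norm_word_le hs hε hK hC hh w x

end normalOrder

end

/-! ### The concrete spaces as instances of the abstract setting -/

section
section concrete

variable {n : ℕ} {s : ℝ}

/-- In a first countable space, a functional that is bounded on bounded sets is continuous. -/
theorem continuous_of_bounded_of_firstCountable {E : Type*} [AddCommGroup E] [Module ℂ E]
    [TopologicalSpace E] [IsTopologicalAddGroup E] [ContinuousSMul ℂ E] [FirstCountableTopology E]
    {𝒲 : Set (ℕ → ℝ)} {ι : E →ₗ[ℂ] Sch n}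
    (hb : ∀ S : Set E, Bornology.IsVonNBounded ℂ S → ∃ M ∈ 𝒲, ∀ f ∈ S, ι f ∈ wordBall n M)
    (ℓ : E →ₗ[ℂ] ℂ) (hℓ : ∀ M ∈ 𝒲, ∃ C, ∀ f, ι f ∈ wordBall n M → ‖ℓ f‖ ≤ C) : Continuous ℓ := by
  refine ℓ.continuous_of_locally_bounded fun S hS => ?_
  obtain ⟨M, hM, h⟩ := hb S hS
  obtain ⟨C, hC⟩ := hℓ M hM
  refine (NormedSpace.isVonNBounded_iff ℂ).2 (isBounded_iff_forall_norm_le.2 ⟨C, ?_⟩)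
  rintro _ ⟨f, hf, rfl⟩
  exact hC f (h f hf)

/-! ### The Schwartz space -/

theorem isTestSpace_sch : IsTestSpace weightClass_univ (LinearMap.id : Sch n →ₗ[ℂ] Sch n) := by
  have hb : ∀ S : Set (Sch n), Bornology.IsVonNBounded ℂ S →
      ∃ M ∈ Set.univ, ∀ f ∈ S, LinearMap.id (R := ℂ) f ∈ wordBall n M := fun S hS => by
    obtain ⟨M, hM⟩ := exists_wordBall_of_isVonNBounded hS
    exact ⟨M, trivial, fun f hf => hM hf⟩
  refine ⟨Function.injective_id, ?_, fun S => ⟨hb S, ?_⟩, continuous_of_bounded_of_firstCountable hb⟩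
  · rw [LinearMap.range_id]
    refine (eq_top_iff.2 fun f _ => ?_).symm
    obtain ⟨M, hM⟩ := exists_mem_wordBall f
    exact ⟨M, trivial, hM⟩
  · rintro ⟨M, -, hM⟩
    refine ((schwartz_withSeminorms ℂ _ _).isVonNBounded_iff_seminorm_bounded).2 fun i => ?_
    obtain ⟨C, hC⟩ := exists_seminorm_bound_of_wordBall (n := n) M i.1 i.2
    exact ⟨|C| + 1, by positivity, fun f hf =>
      ((hC f (hM f hf)).trans (le_abs_self C)).trans_lt (lt_add_one _)⟩

/-! ### The spaces `𝒮_{s,h}` -/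

theorem Step.exists_of_ratios {h : Set.Ioi (0 : ℝ)} {f : Sch n} {C : ℝ}
    (hf : ∀ a, ratios s h f a ≤ C) : ∃ g : Step n s h, Step.toSch g = f ∧ ‖g‖ ≤ C := by
  refine ⟨⟨f, C, ?_⟩, rfl, ?_⟩
  · rintro _ ⟨a, rfl⟩
    exact hf a
  · exact ciSup_le hf

theorem ratios_le_norm {h : Set.Ioi (0 : ℝ)} (g : Step n s h) (a : Idx n) :
    ratios s h (Step.toSch g) a ≤ ‖g‖ := Step.le_gsNorm g a

theorem exists_ratios_bound (hs : 1 / 2 ≤ s) {h : ℝ} (hh : 0 < h) {C : ℝ} (hC : 0 ≤ C) {f : Sch n}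
    (hf : ∀ a, ratios s h f a ≤ C) :
    f ∈ wordBall n fun m => C * ((h + 1 / h) ^ m * (m.factorial : ℝ) ^ s) := by
  refine mem_wordBall_of_ratios (K := 0) (by linarith) zero_le_one (fun m => ?_) hC hh hf
  rw [Nat.cast_zero, add_zero, one_mul]
  rcases Nat.eq_zero_or_pos m with rfl | hm
  · rw [Nat.cast_zero]
    exact Real.rpow_nonneg le_rfl _
  · exact Real.self_le_rpow_of_one_le (by exact_mod_cast hm) (by linarith)

/-- Since 2s > 1, a large K allows ε = k² with k small, and the cost per letter is k + ε/k = 2k. A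
further factor 2^s per letter comes from splitting (m + K)!, whence k = h/(2 · 2^s). -/
theorem exists_ratios_bound_of_lt (hs : 1 / 2 < s) {h : ℝ} (hh : 0 < h) :
    ∃ h' > 0, ∃ D > 0, ∀ (n : ℕ) (f : Sch n) (C : ℝ), 0 ≤ C → (∀ a, ratios s h' f a ≤ C) →
      f ∈ wordBall n fun m => C * D * (h ^ m * (m.factorial : ℝ) ^ s) := by
  have hs0 : 0 ≤ s := by linarith
  set k : ℝ := h / (2 * 2 ^ s) with hk
  have hk0 : 0 < k := by positivity
  obtain ⟨K, hK1, hK⟩ : ∃ K : ℕ, 1 ≤ K ∧ 1 / k ^ 2 ≤ (K : ℝ) ^ (2 * s - 1) := by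
    have h1 := (tendsto_rpow_atTop (by linarith : 0 < 2 * s - 1)).comp tendsto_natCast_atTop_atTop
    obtain ⟨K, hK⟩ := ((h1.eventually_ge_atTop (1 / k ^ 2)).and
      (Filter.eventually_ge_atTop 1)).exists
    exact ⟨K, hK.2, hK.1⟩
  refine ⟨k, hk0, ((2 : ℝ) ^ s) ^ K * (K.factorial : ℝ) ^ s, by positivity, fun n f C hC hf => ?_⟩
  have hKm : ∀ m : ℕ, (m : ℝ) ≤ k ^ 2 * ((m : ℝ) + K) ^ (2 * s) := fun m => by
    have hKpos : (0 : ℝ) < K := by exact_mod_cast hK1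
    have e : ((m : ℝ) + K) ^ (2 * s) = ((m : ℝ) + K) ^ (2 * s - 1) * (m + K) := by
      rw [← Real.rpow_add_one (by positivity)]
      congr 1
      ring
    rw [e]
    have h2 : (K : ℝ) ^ (2 * s - 1) ≤ ((m : ℝ) + K) ^ (2 * s - 1) :=
      Real.rpow_le_rpow hKpos.le (by linarith [m.cast_nonneg (α := ℝ)]) (by linarith)
    calc (m : ℝ) = k ^ 2 * (1 / k ^ 2 * m) := by field_simp
      _ ≤ k ^ 2 * (((m : ℝ) + K) ^ (2 * s - 1) * (m + K)) := by
          gcongr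
          · exact hK.trans h2
          · linarith
  refine wordBall_mono (fun m => ?_) (mem_wordBall_of_ratios hs0 (sq_nonneg k) hKm hC hk0 hf)
  calc C * ((k + k ^ 2 / k) ^ m * ((m + K).factorial : ℝ) ^ s)
      ≤ C * ((k + k ^ 2 / k) ^ m * (((2 : ℝ) ^ s) ^ (m + K) *
        ((m.factorial : ℝ) ^ s * (K.factorial : ℝ) ^ s))) := by
        gcongr
        exact factorial_add_rpow_le hs0 m K
    _ = C * (((2 : ℝ) ^ s) ^ K * (K.factorial : ℝ) ^ s) *
        ((2 * k * 2 ^ s) ^ m * (m.factorial : ℝ) ^ s) := by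
        rw [show k + k ^ 2 / k = 2 * k by field_simp; ring, pow_add, mul_pow (2 * k)]
        ring
    _ = _ := by
        rw [show 2 * k * 2 ^ s = h by rw [hk]; field_simp]

/-! ### The spaces `𝒮_s` -/

/-- The universal property of the inductive limit, for seminorms. -/
theorem Rou.continuous_seminorm (p : Seminorm ℂ (Rou n s))
    (hp : ∀ h, ∃ C, ∀ f : Step n s h, p (Rou.ofStep h f) ≤ C * ‖f‖) : Continuous p := by
  let q : SeminormFamily ℂ (Rou n s) Unit := fun _ => p
  let t : TopologicalSpace (Rou n s) := q.moduleFilterBasis.topology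
  have hq : @WithSeminorms ℂ (Rou n s) Unit _ _ _ q t := .mk (topology := t) rfl
  -- The topology of p alone is one of the competitors in the definition of the inductive limit
  -- topology.
  have ht : Rou.instTopologicalSpace ≤ t := by
    refine sInf_le (show _ ∧ _ from
      ⟨fun h => ?_, hq.topologicalAddGroup, hq.continuousSMul, hq.toLocallyConvexSpace⟩)
    refine hq.continuous_normedSpace_dom (𝕝 := ℂ) (τ₁₂ := RingHom.id ℂ) (Step n s h) (Rou.ofStep h)
      fun _ => ?_
    obtain ⟨C, hC⟩ := hp h
    exact ⟨C.toNNReal, fun f => (hC f).trans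
      (mul_le_mul_of_nonneg_right (Real.le_coe_toNNReal C) (norm_nonneg f))⟩
  exact continuous_le_dom ht (hq.continuous_seminorm ())

open scoped ComplexOrder in
instance : PolynormableSpace ℂ (Rou n s) := by
  have : LocallyConvexSpace ℂ (Rou n s) := by
    rw [locallyConvexSpace_iff_exists_convex_subset_zero]
    intro U hU
    obtain ⟨S, hS, hc, hSU⟩ :=
      (locallyConvexSpace_iff_exists_convex_subset_zero ℝ (Rou n s)).1 inferInstance U hU
    exact ⟨S, hS, convex_of_nonneg_surjective_algebraMap _
      (fun c hc => RCLike.nonneg_iff_exists_ofReal.1 hc) hc, hSU⟩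
  have : ContinuousSMul ℝ (Rou n s) := IsScalarTower.continuousSMul ℂ
  exact LocallyConvexSpace.toPolynormableSpace

theorem ratios_eq_mul {r h : ℝ} (hr : 0 < r) (hh : 0 < h) (f : Sch n) (a : Idx n) :
    ratios s r f a = (h / r) ^ ((∑ i, a.1 i) + ∑ i, a.2.1 i) * ratios s h f a := by
  have h1 := (denom_pos (s := s) hr a.1 a.2.1).ne'
  have h2 := (denom_pos (s := s) hh a.1 a.2.1).ne'
  rw [ratios, ratios, ratio, ratio, div_pow, div_eq_iff h1]
  have h3 : r ^ ((∑ i, a.1 i) + ∑ i, a.2.1 i) ≠ 0 := by positivity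
  have h4 : h ^ ((∑ i, a.1 i) + ∑ i, a.2.1 i) ≠ 0 := by positivity
  have h5 := right_ne_zero_of_mul h1
  field_simp

/-- For k ≥ h the factor (h/(k + 1))^{|α|+|β|} is at most 1; only finitely many k remain. -/
theorem exists_ratios_le_mul_norm (a : ℕ → Idx n) (h : Set.Ioi (0 : ℝ)) :
    ∃ C, ∀ (k : ℕ) (f : Step n s h), ratios s ((k : ℝ) + 1) (Step.toSch f) (a k) ≤ C * ‖f‖ := by
  have hh : (0 : ℝ) < h := h.2
  obtain ⟨K, hK⟩ := exists_nat_ge (h : ℝ)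
  set c : ℕ → ℝ := fun k => (h / ((k : ℝ) + 1)) ^ ((∑ i, (a k).1 i) + ∑ i, (a k).2.1 i) with hc
  have hc0 : ∀ k, 0 ≤ c k := fun k => by positivity
  refine ⟨1 + ∑ k ∈ Finset.range K, c k, fun k f => ?_⟩
  have hsum := Finset.sum_nonneg fun k (_ : k ∈ Finset.range K) => hc0 k
  rw [ratios_eq_mul (by positivity) hh]
  refine mul_le_mul ?_ (ratios_le_norm f _) (ratios_nonneg hh _ _) (by positivity)
  rcases lt_or_ge k K with hk | hk
  · have := Finset.single_le_sum (fun k _ => hc0 k) (Finset.mem_range.2 hk)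
    exact this.trans (le_add_of_nonneg_left zero_le_one)
  · refine (pow_le_one₀ (by positivity) ?_).trans (le_add_of_nonneg_right hsum)
    rw [div_le_one (by positivity)]
    have : (K : ℝ) ≤ k := by exact_mod_cast hk
    linarith

theorem Rou.bddAbove_ratios (a : ℕ → Idx n) (f : Rou n s) :
    BddAbove (Set.range fun k : ℕ => ratios s ((k : ℝ) + 1) (Rou.toSch f) (a k)) := by
  obtain ⟨f, h, hf⟩ := f
  obtain ⟨C, hC⟩ := exists_ratios_le_mul_norm (s := s) a h
  let g : Step n s h := ⟨f, hf⟩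
  refine ⟨C * ‖g‖, ?_⟩
  rintro _ ⟨k, rfl⟩
  exact hC k g

/-- The seminorm `f ↦ sup_k |x_k^{β_k} ∂^{α_k} f(x_k)| / ((k+1)^{|α_k|+|β_k|} (α_k! β_k!)^s)` of
`𝒮_s`, where `(α_k, β_k, x_k)` is any sequence of indices. -/
def Rou.supSeminorm (a : ℕ → Idx n) : Seminorm ℂ (Rou n s) :=
  Seminorm.of (fun f => ⨆ k : ℕ, ratios s ((k : ℝ) + 1) (Rou.toSch f) (a k))
    (fun f g => ciSup_le fun k => by
      rw [map_add]
      exact (ratios_add_le (by positivity) _ _ _).trans (add_le_add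
        (le_ciSup (Rou.bddAbove_ratios a f) k) (le_ciSup (Rou.bddAbove_ratios a g) k)))
    (fun c f => by
      simp only [map_smul, ratios_smul]
      rw [Real.mul_iSup_of_nonneg (norm_nonneg c)])

/-- Regularity of the inductive limit. If S were bounded in no step, there would be f_k in S and
indices a_k at which the ratio for h = k + 1 exceeds k + 1. The seminorm `Rou.supSeminorm a` is
continuous but unbounded on these f_k. -/
theorem Rou.isVonNBounded_iff (S : Set (Rou n s)) : Bornology.IsVonNBounded ℂ S ↔
    ∃ h > 0, ∃ C > 0, ∀ f ∈ S, ∀ a, ratios s h (Rou.toSch f) a ≤ C := by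
  constructor
  · intro hS
    by_contra! hcon
    choose! f hf a ha using fun k : ℕ => hcon ((k : ℝ) + 1) (by positivity) ((k : ℝ) + 1) (by positivity)
    have hp : Continuous (Rou.supSeminorm (s := s) a) := by
      refine Rou.continuous_seminorm _ fun h => ?_
      obtain ⟨C, hC⟩ := exists_ratios_le_mul_norm (s := s) a h
      exact ⟨C, fun g => ciSup_le fun k => hC k g⟩
    obtain ⟨C, hC, hb⟩ := ((PolynormableSpace.withSeminorms ℂ
      (Rou n s)).isVonNBounded_iff_seminorm_bounded).1 hS ⟨_, hp⟩
    obtain ⟨k, hk⟩ := exists_nat_ge C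
    have h1 := (ha k).trans_le (le_ciSup (Rou.bddAbove_ratios a (f k)) k)
    change _ < Rou.supSeminorm a (f k) at h1
    have h2 : Rou.supSeminorm a (f k) < C := hb _ (hf k)
    linarith
  · rintro ⟨h, hh, C, hC, hS⟩
    have hb : Bornology.IsVonNBounded ℂ {g : Step n s ⟨h, hh⟩ | ‖g‖ ≤ C} :=
      (NormedSpace.isVonNBounded_iff ℂ).2 (isBounded_iff_forall_norm_le.2 ⟨C, fun _ => id⟩)
    refine (hb.image (⟨Rou.ofStep ⟨h, hh⟩, Rou.continuous_ofStep ⟨h, hh⟩⟩ :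
      Step n s ⟨h, hh⟩ →L[ℂ] Rou n s)).subset fun f hf => ?_
    obtain ⟨g, hg, hgC⟩ := Step.exists_of_ratios (h := ⟨h, hh⟩) (hS f hf)
    exact ⟨g, hgC, Subtype.ext hg⟩

theorem isTestSpace_rou (hs : 1 / 2 ≤ s) :
    IsTestSpace (weightClass_rouWeights hs) (Rou.toSch : Rou n s →ₗ[ℂ] Sch n) := by
  have h1 : ∀ h > 0, ∀ C > 0, ∀ f : Sch n, (∀ a, ratios s h f a ≤ C) →
      f ∈ wordBall n fun m => C * ((h + 1 / h) ^ m * (m.factorial : ℝ) ^ s) :=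
    fun h hh C hC f hf => exists_ratios_bound hs hh hC.le hf
  have h1mem : ∀ h > 0, ∀ C > 0,
      (fun m : ℕ => C * ((h + 1 / h) ^ m * (m.factorial : ℝ) ^ s)) ∈ rouWeights s :=
    fun h hh C hC => ⟨C, hC, h + 1 / h, by positivity, fun m => le_rfl⟩
  have h2 : ∀ M ∈ rouWeights s, ∃ h > 0, ∃ C > 0, ∀ f ∈ wordBall n M, ∀ a, ratios s h f a ≤ C := by
    rintro M ⟨C, hC, h, hh, hM⟩
    exact ⟨_, by positivity, C, hC, fun f hf =>
      ratios_le_of_mem_wordBall (by linarith) hC.le hh (wordBall_mono hM hf)⟩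
  refine ⟨Subtype.val_injective, ?_, fun S => ?_, fun ℓ hℓ => ?_⟩
  · ext f
    constructor
    · rintro ⟨⟨f, h, C, hC⟩, rfl⟩
      refine ⟨_, h1mem h h.2 (max C 1) (by positivity), h1 h h.2 (max C 1) (by positivity) f fun a => ?_⟩
      exact (hC ⟨a, rfl⟩).trans (le_max_left _ _)
    · rintro ⟨M, hM, hf⟩
      obtain ⟨h, hh, C, hC, h3⟩ := h2 M hM
      refine ⟨⟨f, ⟨h, hh⟩, C, ?_⟩, rfl⟩
      rintro _ ⟨a, rfl⟩
      exact h3 f hf a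
  · rw [Rou.isVonNBounded_iff]
    constructor
    · rintro ⟨h, hh, C, hC, hS⟩
      exact ⟨_, h1mem h hh C hC, fun f hf => h1 h hh C hC _ (hS f hf)⟩
    · rintro ⟨M, hM, hS⟩
      obtain ⟨h, hh, C, hC, h3⟩ := h2 M hM
      exact ⟨h, hh, C, hC, fun f hf => h3 _ (hS f hf)⟩
  · refine Rou.continuous_of_step ℓ fun h => ?_
    refine (ℓ.comp (Rou.ofStep h)).continuous_of_locally_bounded fun S hS => ?_
    obtain ⟨C, hC⟩ := ((NormedSpace.isVonNBounded_iff ℂ).1 hS).exists_norm_le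
    obtain ⟨D, hD⟩ := hℓ _ (h1mem h h.2 (max C 1) (by positivity))
    refine (NormedSpace.isVonNBounded_iff ℂ).2 (isBounded_iff_forall_norm_le.2 ⟨D, ?_⟩)
    rintro _ ⟨g, hg, rfl⟩
    exact hD _ (h1 h h.2 _ (by positivity) _ fun a =>
      (ratios_le_norm g a).trans ((hC g hg).trans (le_max_left _ _)))

/-! ### The spaces `Σ_s` -/

/-- The norm of `𝒮_{s,h}` as a seminorm on `Σ_s`. -/
def Beu.stepSeminorm (h : Set.Ioi (0 : ℝ)) : Seminorm ℂ (Beu n s) :=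
  (normSeminorm ℂ (Step n s h)).comp (Beu.toStep h)

theorem Beu.withSeminorms : WithSeminorms (Beu.stepSeminorm : Set.Ioi (0 : ℝ) → Seminorm ℂ (Beu n s)) := by
  have h := withSeminorms_iInf (𝕜 := ℂ) (κ := fun _ : Set.Ioi (0 : ℝ) => Fin 1)
    (p := fun h _ => Beu.stepSeminorm (n := n) (s := s) h)
    (t := fun h => TopologicalSpace.induced (Beu.toStep h) inferInstance)
    fun h => LinearMap.withSeminorms_induced (norm_withSeminorms ℂ (Step n s h))
      (Beu.toStep (n := n) (s := s) h)
  exact h.congr_equiv (Equiv.sigmaUnique _ _).symm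

theorem Beu.stepSeminorm_anti {h k : Set.Ioi (0 : ℝ)} (hk : h ≤ k) :
    (Beu.stepSeminorm k : Seminorm ℂ (Beu n s)) ≤ Beu.stepSeminorm h := fun f =>
  ciSup_le fun a => (ratios_anti h.2 hk _ a).trans (ratios_le_norm (Beu.toStep h f) a)

instance : FirstCountableTopology (Beu n s) := by
  let k : ℕ → Set.Ioi (0 : ℝ) := fun i => ⟨1 / ((i : ℝ) + 1), Set.mem_Ioi.2 (by positivity)⟩
  refine WithSeminorms.firstCountableTopology (𝕜 := ℂ) (p := fun i => Beu.stepSeminorm (k i))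
    (Beu.withSeminorms.congr (fun i => ⟨{k i}, 1, ?_⟩) fun h => ?_)
  · rw [one_smul, Finset.sup_singleton]
    exact le_rfl
  · obtain ⟨i, hi⟩ := exists_nat_one_div_lt (Set.mem_Ioi.1 h.2)
    refine ⟨{i}, 1, ?_⟩
    rw [one_smul, Finset.sup_singleton]
    exact Beu.stepSeminorm_anti (h := k i) hi.le

theorem Beu.isVonNBounded_iff (S : Set (Beu n s)) : Bornology.IsVonNBounded ℂ S ↔
    ∀ h > 0, ∃ C > 0, ∀ f ∈ S, ∀ a, ratios s h (Beu.toSch f) a ≤ C := by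
  rw [Beu.withSeminorms.isVonNBounded_iff_seminorm_bounded]
  constructor
  · intro hS h hh
    obtain ⟨C, hC, hS⟩ := hS ⟨h, hh⟩
    exact ⟨C, hC, fun f hf a => (ratios_le_norm (Beu.toStep ⟨h, hh⟩ f) a).trans (hS f hf).le⟩
  · intro hS h
    obtain ⟨C, hC, hS⟩ := hS h h.2
    exact ⟨C + 1, by positivity, fun f hf =>
      (ciSup_le fun a => hS f hf a : ‖Beu.toStep h f‖ ≤ C).trans_lt (lt_add_one C)⟩

theorem isTestSpace_beu (hs : 1 / 2 < s) :
    IsTestSpace (weightClass_beuWeights hs) (Beu.toSch : Beu n s →ₗ[ℂ] Sch n) := by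
  have h1 : ∀ S : Set (Sch n), (∀ h > 0, ∃ C > 0, ∀ f ∈ S, ∀ a, ratios s h f a ≤ C) →
      ∃ M ∈ beuWeights s, S ⊆ wordBall n M := fun S hS => by
    have key : ∀ h > 0, ∃ C > 0, ∀ f ∈ S,
        f ∈ wordBall n fun m => C * (h ^ m * (m.factorial : ℝ) ^ s) := fun h hh => by
      obtain ⟨h', hh', D, hD, hbound⟩ := exists_ratios_bound_of_lt hs hh
      obtain ⟨C, hC, hS⟩ := hS h' hh'
      exact ⟨C * D, by positivity, fun f hf => hbound n f C hC.le (hS f hf)⟩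
    -- The optimal weight of S does not depend on h, so it inherits the bounds for every h.
    refine ⟨fun m => sSup {r | ∃ f ∈ S, ∃ w : List (Letter n), w.length = m ∧ ∃ x, r = ‖word w f x‖},
      fun h hh => ?_, fun f hf w x => ?_⟩
    · obtain ⟨C, hC, h⟩ := key h hh
      refine ⟨C, hC, fun m => Real.sSup_le ?_ (by positivity)⟩
      rintro _ ⟨f, hf, w, rfl, x, rfl⟩
      exact h f hf w x
    · obtain ⟨C, -, h⟩ := key 1 one_pos
      refine le_csSup ⟨C * (1 ^ w.length * (w.length.factorial : ℝ) ^ s), ?_⟩ ⟨f, hf, w, rfl, x, rfl⟩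
      rintro _ ⟨g, hg, v, hv, y, rfl⟩
      rw [← hv]
      exact h g hg v y
  have h2 : ∀ M ∈ beuWeights s, ∀ h > 0, ∃ C > 0, ∀ f ∈ wordBall n M, ∀ a, ratios s h f a ≤ C := by
    intro M hM h hh
    obtain ⟨C, hC, hM⟩ := hM (h / ((2 : ℝ) ^ (n + 1)) ^ s) (by positivity)
    refine ⟨C, hC, fun f hf a => ?_⟩
    have := ratios_le_of_mem_wordBall (by linarith) hC.le (by positivity) (wordBall_mono hM hf) a
    rwa [mul_div_cancel₀ _ (by positivity)] at this
  have hiff : ∀ S : Set (Beu n s), Bornology.IsVonNBounded ℂ S ↔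
      ∃ M ∈ beuWeights s, ∀ f ∈ S, Beu.toSch f ∈ wordBall n M := fun S => by
    rw [Beu.isVonNBounded_iff]
    constructor
    · intro hS
      obtain ⟨M, hM, h⟩ := h1 (Beu.toSch '' S) fun h hh => by
        obtain ⟨C, hC, h⟩ := hS h hh
        exact ⟨C, hC, by rintro _ ⟨f, hf, rfl⟩; exact h f hf⟩
      exact ⟨M, hM, fun f hf => h ⟨f, hf, rfl⟩⟩
    · rintro ⟨M, hM, hS⟩ h hh
      obtain ⟨C, hC, h3⟩ := h2 M hM h hh
      exact ⟨C, hC, fun f hf => h3 _ (hS f hf)⟩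
  refine ⟨Subtype.val_injective, ?_, hiff,
    continuous_of_bounded_of_firstCountable fun S hS => (hiff S).1 hS⟩
  ext f
  constructor
  · rintro ⟨f, rfl⟩
    obtain ⟨M, hM, h⟩ := (hiff {f}).1 (Bornology.isVonNBounded_singleton f)
    exact ⟨M, hM, h f rfl⟩
  · rintro ⟨M, hM, hf⟩
    refine ⟨⟨f, (Submodule.mem_iInf _).2 fun h => ?_⟩, rfl⟩
    obtain ⟨C, hC, h3⟩ := h2 M hM h h.2
    exact ⟨C, by rintro _ ⟨a, rfl⟩; exact h3 f hf a⟩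

end concrete

end

section
/-! ### Continuity of the Born-Jordan distribution on test functions -/

section continuity

variable {n : ℕ} {s : ℝ}

open Filter Topology Pointwise in
/-- In a first countable space, a sesquilinear map that is bounded on bounded sets is continuous. -/
theorem continuous₂_of_bounded {E F : Type*} [AddCommGroup E] [Module ℂ E] [TopologicalSpace E]
    [IsTopologicalAddGroup E] [ContinuousSMul ℂ E] [FirstCountableTopology E] [AddCommGroup F]
    [Module ℂ F] [TopologicalSpace F] [IsTopologicalAddGroup F]
    (T : E →ₗ[ℂ] E →ₛₗ[starRingEnd ℂ] F)
    (hT : ∀ S S' : Set E, Bornology.IsVonNBounded ℂ S → Bornology.IsVonNBounded ℂ S' →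
      Bornology.IsVonNBounded ℂ (Set.image2 (fun f φ => T f φ) S S')) :
    Continuous fun p : E × E => T p.1 p.2 := by
  refine continuous_of_continuousAt_zero₂
    (AddMonoidHom.mk' (fun f => (T f).toAddMonoidHom) fun f g => by ext φ; simp) ?_ ?_ ?_
  · set c : ℂ := 2⁻¹ with hc
    have c_ne : c ≠ 0 := by norm_num [hc]
    have hc1 : ‖c‖ < 1 := by norm_num [hc]
    rcases (nhds_basis_balanced ℂ E).exists_antitone_subbasis with ⟨b, bE1, bE⟩
    simp only [_root_.id] at bE
    -- Points of c^n b_n remain bounded after division by c^n. If T failed to be continuous at 0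
    -- along such points, T of the rescaled points would be bounded, and multiplying by |c|^{2n} → 0
    -- gives a contradiction.
    have bE' : (𝓝 (0 : E)).HasBasis (fun _ ↦ True) (fun n : ℕ ↦ (c ^ n) • b n) := by
      refine bE.1.to_hasBasis' ?_ ?_
      · intro n _
        exact ⟨n, trivial, (bE1 n).2 _ (by grw [norm_pow, hc1, one_pow])⟩
      · intro n _
        simpa using smul_mem_nhds_smul₀ (pow_ne_zero n c_ne) (bE1 n).1
    have hmap : Tendsto (fun p : E × E => T p.1 p.2) (𝓝 0 ×ˢ 𝓝 0) (𝓝 0) := by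
      rw [(bE'.prod bE').tendsto_left_iff]
      by_contra! h
      obtain ⟨V, hV, h⟩ := h
      have h' : ∀ n : ℕ, ∃ p : E × E, (p.1 ∈ c ^ n • b n ∧ p.2 ∈ c ^ n • b n) ∧ T p.1 p.2 ∉ V :=
        fun n => by simpa [Set.MapsTo, and_assoc] using h (n, n) ⟨trivial, trivial⟩
      choose u hu hu' using h'
      have hb : ∀ v : ℕ → E, (∀ n, v n ∈ c ^ n • b n) →
          Bornology.IsVonNBounded ℂ (Set.range fun n : ℕ => (c ^ n)⁻¹ • v n) := fun v hv => by
        refine Tendsto.isVonNBounded_range ℂ (x := 0) (bE.tendsto fun n => ?_)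
        simpa only [Set.mem_smul_set_iff_inv_smul_mem₀ (pow_ne_zero n c_ne)] using hv n
      have h2 := hT _ _ (hb (fun n => (u n).1) fun n => (hu n).1)
        (hb (fun n => (u n).2) fun n => (hu n).2)
      have h3 : Tendsto (fun n : ℕ => c ^ n * (starRingEnd ℂ) c ^ n) atTop (𝓝 0) := by
        have hc1' : ‖(starRingEnd ℂ) c‖ < 1 := by rwa [RCLike.norm_conj]
        simpa using (tendsto_pow_atTop_nhds_zero_of_norm_lt_one hc1).mul
          (tendsto_pow_atTop_nhds_zero_of_norm_lt_one hc1')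
      have h4 := h2.smul_tendsto_zero (x := fun n => T ((c ^ n)⁻¹ • (u n).1) ((c ^ n)⁻¹ • (u n).2))
        (.of_forall fun n => ⟨_, ⟨n, rfl⟩, _, ⟨n, rfl⟩, rfl⟩) h3
      have h5 : Tendsto (fun n => T (u n).1 (u n).2) atTop (𝓝 0) := h4.congr fun n => by
        have : (starRingEnd ℂ) c ≠ 0 := by simpa using c_ne
        simp only [Pi.smul_apply', map_smul, LinearMap.smul_apply, LinearMap.map_smulₛₗ, map_inv₀,
          map_pow, smul_smul]
        rw [show c ^ n * (starRingEnd ℂ) c ^ n * (((starRingEnd ℂ) c ^ n)⁻¹ * (c ^ n)⁻¹) = 1 by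
          field_simp, one_smul]
      obtain ⟨n, hn⟩ := (h5.eventually_mem hV).exists
      exact hu' n hn
    rw [← nhds_prod_eq] at hmap
    simpa [ContinuousAt] using hmap
  · intro f
    refine (LinearMap.continuous_of_locally_bounded (T f) fun S hS => ?_).continuousAt
    refine (hT {f} S (Bornology.isVonNBounded_singleton f) hS).subset ?_
    rintro _ ⟨φ, hφ, rfl⟩
    exact ⟨f, rfl, φ, hφ, rfl⟩
  · intro φ
    refine (LinearMap.continuous_of_locally_bounded (T.flip φ) fun S hS => ?_).continuousAt
    refine (hT S {φ} hS (Bornology.isVonNBounded_singleton φ)).subset ?_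
    rintro _ ⟨f, hf, rfl⟩
    exact ⟨f, hf, φ, rfl, rfl⟩

/-- The space `𝒮_{s,k+1}` as a step of `𝒮_s`. -/
abbrev natStep (k : ℕ) : Set.Ioi (0 : ℝ) := ⟨(k : ℝ) + 1, Set.mem_Ioi.2 (by positivity)⟩

theorem Rou.exists_natStep (h : Set.Ioi (0 : ℝ)) : ∃ k, ∀ f : Step n s h,
    ∃ g : Step n s (natStep k), Rou.ofStep (natStep k) g = Rou.ofStep h f ∧ ‖g‖ ≤ ‖f‖ := by
  obtain ⟨k, hk⟩ := exists_nat_ge (h : ℝ)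
  refine ⟨k, fun f => ?_⟩
  have hk' : (h : ℝ) ≤ natStep k := hk.trans (le_add_of_nonneg_right zero_le_one)
  obtain ⟨g, hg, hgf⟩ := Step.exists_of_ratios (h := natStep k)
    fun a => (ratios_anti h.2 hk' (Step.toSch f) a).trans (ratios_le_norm f a)
  exact ⟨g, Subtype.ext hg, hgf⟩

theorem Rou.exists_eq_natStep (f : Rou n s) : ∃ k, ∃ g, f = Rou.ofStep (natStep k) g := by
  obtain ⟨f, h, hf⟩ := f
  obtain ⟨k, hk⟩ := Rou.exists_natStep (n := n) (s := s) h
  obtain ⟨g, hg, -⟩ := hk ⟨f, hf⟩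
  exact ⟨k, g, hg.symm⟩

/-- There is a largest seminorm with prescribed bounds on the steps of `𝒮_s`, and it is
continuous. -/
theorem Rou.exists_seminorm (C : ℕ → ℝ) : ∃ p : Seminorm ℂ (Rou n s), Continuous p ∧
    ∀ q : Seminorm ℂ (Rou n s), (∀ k f, q (Rou.ofStep (natStep k) f) ≤ C k * ‖f‖) → q ≤ p := by
  let Q := {q : Seminorm ℂ (Rou n s) // ∀ k f, q (Rou.ofStep (natStep k) f) ≤ C k * ‖f‖}
  have hQ : BddAbove (Set.range fun q : Q => q.1) := by
    rw [Seminorm.bddAbove_range_iff]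
    intro f
    obtain ⟨k, g, rfl⟩ := Rou.exists_eq_natStep f
    exact ⟨C k * ‖g‖, by rintro _ ⟨q, rfl⟩; exact q.2 k g⟩
  -- The supremum of all admissible seminorms is finite, as each f lies in some step, and it obeys
  -- the same bounds up to replacing C k by max (C k) 0.
  refine ⟨⨆ q : Q, q.1, Rou.continuous_seminorm _ fun h => ?_, fun q hq => le_ciSup hQ ⟨q, hq⟩⟩
  obtain ⟨k, hk⟩ := Rou.exists_natStep (n := n) (s := s) h
  refine ⟨max (C k) 0, fun f => ?_⟩
  obtain ⟨g, hg, hgf⟩ := hk f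
  rw [Seminorm.iSup_apply hQ, ← hg]
  refine Real.iSup_le (fun q => (q.2 k g).trans ?_) (by positivity)
  exact mul_le_mul (le_max_left _ _) hgf (norm_nonneg _) (le_max_right _ _)

theorem Rou.exists_norm_bound {F : Type*} [AddCommGroup F] [Module ℂ F] [TopologicalSpace F]
    [IsTopologicalAddGroup F] [PolynormableSpace ℂ F]
    (T : Rou n s →ₗ[ℂ] Rou n s →ₛₗ[starRingEnd ℂ] F)
    (hT : ∀ S S' : Set (Rou n s), Bornology.IsVonNBounded ℂ S → Bornology.IsVonNBounded ℂ S' →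
      Bornology.IsVonNBounded ℂ (Set.image2 (fun f φ => T f φ) S S'))
    (r : Seminorm ℂ F) (hr : Continuous r) (h k : Set.Ioi (0 : ℝ)) :
    ∃ C, 0 ≤ C ∧ ∀ f φ, r (T (Rou.ofStep h f) (Rou.ofStep k φ)) ≤ C * (‖f‖ * ‖φ‖) := by
  have hb : ∀ h, Bornology.IsVonNBounded ℂ (Rou.ofStep h '' {g : Step n s h | ‖g‖ ≤ 1}) := fun h =>
    Bornology.IsVonNBounded.image ((NormedSpace.isVonNBounded_iff ℂ).2
      (isBounded_iff_forall_norm_le.2 ⟨1, fun _ => id⟩))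
      (⟨Rou.ofStep h, Rou.continuous_ofStep h⟩ : Step n s h →L[ℂ] Rou n s)
  obtain ⟨C, hC, hCb⟩ := ((PolynormableSpace.withSeminorms ℂ F).isVonNBounded_iff_seminorm_bounded).1
    (hT _ _ (hb h) (hb k)) ⟨r, hr⟩
  refine ⟨C, hC.le, fun f φ => ?_⟩
  rcases eq_or_ne f 0 with rfl | hf
  · simp
  rcases eq_or_ne φ 0 with rfl | hφ
  · simp
  have hf' := norm_pos_iff.2 hf
  have hφ' := norm_pos_iff.2 hφ
  have h1 := hCb _ ⟨_, ⟨((‖f‖⁻¹ : ℝ) : ℂ) • f, by simp [norm_smul, hf], rfl⟩, _,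
    ⟨((‖φ‖⁻¹ : ℝ) : ℂ) • φ, by simp [norm_smul, hφ], rfl⟩, rfl⟩
  simp only [map_smul, LinearMap.smul_apply, LinearMap.map_smulₛₗ, map_smul_eq_mul,
    RCLike.norm_conj, Complex.norm_real, norm_inv, norm_norm] at h1
  rw [← mul_assoc, ← mul_inv, inv_mul_lt_iff₀ (by positivity)] at h1
  linarith

/-- Continuity in an inductive limit is tested on the steps. On steps i and j, T has a bound c(i,
j), dominated by C(i) C(j) with C(k) one plus the sum over all i, j ≤ k. Maximality of the seminorm
p that belongs to C, used once in each variable, gives r(T f φ) ≤ p(f) p(φ). -/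
theorem Rou.continuous₂_of_bounded {F : Type*} [AddCommGroup F] [Module ℂ F] [TopologicalSpace F]
    [IsTopologicalAddGroup F] [PolynormableSpace ℂ F]
    (T : Rou n s →ₗ[ℂ] Rou n s →ₛₗ[starRingEnd ℂ] F)
    (hT : ∀ S S' : Set (Rou n s), Bornology.IsVonNBounded ℂ S → Bornology.IsVonNBounded ℂ S' →
      Bornology.IsVonNBounded ℂ (Set.image2 (fun f φ => T f φ) S S')) :
    Continuous fun p : Rou n s × Rou n s => T p.1 p.2 := by
  have key : ∀ r : Seminorm ℂ F, Continuous r → ∃ p : Seminorm ℂ (Rou n s), Continuous p ∧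
      ∀ f φ, r (T f φ) ≤ p f * p φ := by
    intro r hr
    choose c hc0 hc using fun i j => Rou.exists_norm_bound T hT r hr (natStep i) (natStep j)
    set C : ℕ → ℝ := fun k => 1 + ∑ i ∈ Finset.range (k + 1), ∑ j ∈ Finset.range (k + 1), c i j
    have hC1 : ∀ k, 1 ≤ C k := fun k => le_add_of_nonneg_right
      (Finset.sum_nonneg fun i _ => Finset.sum_nonneg fun j _ => hc0 i j)
    have hcC : ∀ i j k, i ≤ k → j ≤ k → c i j ≤ C k := fun i j k hi hj => by
      have h1 := Finset.single_le_sum (f := fun j => c i j) (fun j _ => hc0 i j)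
        (Finset.mem_range.2 (Nat.lt_succ_of_le hj))
      have h2 := Finset.single_le_sum (f := fun i => ∑ j ∈ Finset.range (k + 1), c i j)
        (fun i _ => Finset.sum_nonneg fun j _ => hc0 i j) (Finset.mem_range.2 (Nat.lt_succ_of_le hi))
      exact (h1.trans h2).trans (le_add_of_nonneg_left zero_le_one)
    have hcm : ∀ i j, c i j ≤ C i * C j := fun i j => by
      rcases le_total i j with h | h
      · exact (hcC i j j h le_rfl).trans (le_mul_of_one_le_left (zero_le_one.trans (hC1 j)) (hC1 i))
      · exact (hcC i j i le_rfl h).trans (le_mul_of_one_le_right (zero_le_one.trans (hC1 i)) (hC1 j))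
    obtain ⟨p, hp, hmax⟩ := Rou.exists_seminorm (n := n) (s := s) C
    have scale : ∀ (q : Seminorm ℂ (Rou n s)) (a : ℝ), 0 ≤ a →
        (∀ k f, q (Rou.ofStep (natStep k) f) ≤ a * (C k * ‖f‖)) → ∀ f, q f ≤ a * p f := by
      intro q a ha hq f
      rcases ha.eq_or_lt with rfl | ha
      · obtain ⟨k, g, rfl⟩ := Rou.exists_eq_natStep f
        simpa using hq k g
      · have := hmax (a⁻¹.toNNReal • q) (fun k g => ?_) f
        · rw [_root_.smul_apply, NNReal.smul_def, Real.coe_toNNReal _ (by positivity), smul_eq_mul,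
            inv_mul_le_iff₀ ha] at this
          exact this
        · rw [_root_.smul_apply, NNReal.smul_def, Real.coe_toNNReal _ (by positivity), smul_eq_mul,
            inv_mul_le_iff₀ ha]
          exact hq k g
    refine ⟨p, hp, fun f φ => ?_⟩
    refine scale (r.comp (T f)) (p f) (apply_nonneg p f) (fun j φ => ?_) φ
    -- First f varies with φ fixed in step j; the outer use of `scale` then lets φ vary with the
    -- constant p f.
    have := scale (r.comp (T.flip (Rou.ofStep (natStep j) φ))) (C j * ‖φ‖)
      (mul_nonneg (zero_le_one.trans (hC1 j)) (norm_nonneg φ)) (fun i f => ?_) f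
    · rw [mul_comm (p f)]
      exact this
    · refine (hc i j f φ).trans ?_
      calc c i j * (‖f‖ * ‖φ‖) ≤ C i * C j * (‖f‖ * ‖φ‖) := by gcongr; exact hcm i j
        _ = _ := by ring
  have hF := PolynormableSpace.withSeminorms ℂ F
  refine continuous_of_continuousAt_zero₂
    (AddMonoidHom.mk' (fun f => (T f).toAddMonoidHom) fun f g => by ext φ; simp) ?_ ?_ ?_
  · have : Filter.Tendsto (fun p : Rou n s × Rou n s => T p.1 p.2) (nhds 0) (nhds 0) := by
      rw [hF.tendsto_nhds]
      rintro ⟨r, hr⟩ ε hε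
      obtain ⟨p, hp, hb⟩ := key r hr
      have h1 : Filter.Tendsto (fun x : Rou n s × Rou n s => p x.1 * p x.2) (nhds 0) (nhds 0) := by
        have : Continuous fun x : Rou n s × Rou n s => p x.1 * p x.2 := by fun_prop
        simpa using this.tendsto 0
      filter_upwards [h1.eventually_lt_const hε] with x hx
      rw [sub_zero]
      exact (hb _ _).trans_lt hx
    rw [← Prod.mk_zero_zero] at this
    simpa [ContinuousAt] using this
  · intro f
    refine (hF.continuous_of_continuous_comp (T f) fun r => ?_).continuousAt
    obtain ⟨p, hp, hb⟩ := key r.1 r.2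
    refine Seminorm.continuous_of_le (q := (p f).toNNReal • p) (hp.const_smul _) fun φ => ?_
    rw [_root_.smul_apply, NNReal.smul_def, Real.coe_toNNReal _ (apply_nonneg p f)]
    exact hb f φ
  · intro φ
    refine (hF.continuous_of_continuous_comp (T.flip φ) fun r => ?_).continuousAt
    obtain ⟨p, hp, hb⟩ := key r.1 r.2
    refine Seminorm.continuous_of_le (q := (p φ).toNNReal • p) (hp.const_smul _) fun f => ?_
    rw [_root_.smul_apply, NNReal.smul_def, Real.coe_toNNReal _ (apply_nonneg p φ), smul_eq_mul,
      mul_comm]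
    exact hb f φ

/-- The Born-Jordan distribution on a space of test functions. -/
theorem IsTestSpace.exists_bornJordan {𝒲 : Set (ℕ → ℝ)} {h𝒲 : WeightClass 𝒲} {d : ℕ} {E F : Type*}
    [AddCommGroup E] [Module ℂ E] [TopologicalSpace E] [AddCommGroup F] [Module ℂ F]
    [TopologicalSpace F] {ι : E →ₗ[ℂ] Sch d} {κ : F →ₗ[ℂ] Sch (d + d)} (hE : IsTestSpace h𝒲 ι)
    (hF : IsTestSpace h𝒲 κ) : ∃ T : E →ₗ[ℂ] E →ₛₗ[starRingEnd ℂ] F,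
      (∀ f φ, κ (T f φ) = bornJordanL d (ι f) (ι φ)) ∧
      ∀ S S' : Set E, Bornology.IsVonNBounded ℂ S → Bornology.IsVonNBounded ℂ S' →
        Bornology.IsVonNBounded ℂ (Set.image2 (fun f φ => T f φ) S S') := by
  have hex : ∀ f φ, ∃ g, κ g = bornJordanL d (ι f) (ι φ) := fun f φ => by
    obtain ⟨M, hM, hf⟩ := hE.mem_carrier f
    obtain ⟨N, hN, hφ⟩ := hE.mem_carrier φ
    obtain ⟨P, hP, h⟩ := h𝒲.exists_bornJordan_bound hM hN
    exact hF.exists_eq ⟨P, hP, h _ hf _ hφ⟩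
  choose T hT using hex
  refine ⟨LinearMap.mk₂'ₛₗ (RingHom.id ℂ) (starRingEnd ℂ) T
    (fun f f' φ => hF.injective ?_) (fun c f φ => hF.injective ?_)
    (fun f φ φ' => hF.injective ?_) (fun c f φ => hF.injective ?_), hT, fun S S' hS hS' => ?_⟩
  · simp only [hT, map_add, LinearMap.add_apply]
  · simp only [hT, map_smul, LinearMap.smul_apply, RingHom.id_apply]
  · simp only [hT, map_add]
  · simp only [hT, map_smul, LinearMap.map_smulₛₗ]
  · obtain ⟨M, hM, hf⟩ := (hE.isVonNBounded_iff S).1 hS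
    obtain ⟨N, hN, hφ⟩ := (hE.isVonNBounded_iff S').1 hS'
    obtain ⟨P, hP, h⟩ := h𝒲.exists_bornJordan_bound hM hN
    refine (hF.isVonNBounded_iff _).2 ⟨P, hP, ?_⟩
    rintro _ ⟨f, hfS, φ, hφS, rfl⟩
    change κ (T f φ) ∈ _
    rw [hT]
    exact h _ (hf f hfS) _ (hφ φ hφS)

end continuity

end

end GelfandShilov

end

/-! ### Assembly of the theorem -/

theorem mainTheorem10 (d : ℕ) (s : ℝ) (hs : 1 / 2 ≤ s) :
    -- the integrals that define `W_t(f, φ)` and `W_BJ(f, φ)` converge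
    (∀ (f φ : Sch d) (x ξ : EuclideanSpace ℝ (Fin d)),
      (∀ t : ℝ, Integrable (wignerIntegrand t f φ x ξ)) ∧
      IntervalIntegrable (fun t => wigner t f φ x ξ) volume 0 1) ∧
    -- `T = W_BJ` is continuous from `𝒮 × 𝒮` to `𝒮`
    ∃ T : Sch d × Sch d → Sch (d + d),
      (∀ (f φ : Sch d) z, T (f, φ) z = wignerBJ f φ (position z) (frequency z)) ∧
      Continuous T ∧
      -- its restriction `Ts` is continuous from `𝒮_s × 𝒮_s` to `𝒮_s`, and it extends uniquely
      -- to continuous maps on `𝒮_s' × 𝒮_s'` and on `𝒮' × 𝒮'`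
      (∃ Ts : Rou d s × Rou d s → Rou (d + d) s,
        (∀ f φ : Rou d s, (Ts (f, φ)).toSch = T (f.toSch, φ.toSch)) ∧
        Continuous Ts ∧
        (∃! B : StrongDual ℂ (Rou d s) × StrongDual ℂ (Rou d s) → StrongDual ℂ (Rou (d + d) s),
          Continuous B ∧ ∀ f φ : Rou d s, B (rouDist f, rouDist φ) = rouDist (Ts (f, φ))) ∧
        (∃! B : StrongDual ℂ (Sch d) × StrongDual ℂ (Sch d) → StrongDual ℂ (Sch (d + d)),
          Continuous B ∧ ∀ f φ : Rou d s,
            B (schDist f.toSch, schDist φ.toSch) = schDist (Ts (f, φ)).toSch)) ∧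
      -- the same with `Σ_s` in place of `𝒮_s`, when `s > 1/2`
      (1 / 2 < s → ∃ Ts : Beu d s × Beu d s → Beu (d + d) s,
        (∀ f φ : Beu d s, (Ts (f, φ)).toSch = T (f.toSch, φ.toSch)) ∧
        Continuous Ts ∧
        (∃! B : StrongDual ℂ (Beu d s) × StrongDual ℂ (Beu d s) → StrongDual ℂ (Beu (d + d) s),
          Continuous B ∧ ∀ f φ : Beu d s, B (beuDist f, beuDist φ) = beuDist (Ts (f, φ))) ∧
        (∃! B : StrongDual ℂ (Sch d) × StrongDual ℂ (Sch d) → StrongDual ℂ (Sch (d + d)),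
          Continuous B ∧ ∀ f φ : Beu d s,
            B (schDist f.toSch, schDist φ.toSch) = schDist (Ts (f, φ)).toSch)) := by
  -- The common argument for 𝒮_s and Σ_s. That bounded sesquilinear maps are continuous enters as
  -- the hypothesis `hcont`, since the reasons differ in the two cases.
  have key : ∀ {𝒲 : Set (ℕ → ℝ)} (h𝒲 : WeightClass 𝒲) {E F : Type} [AddCommGroup E] [Module ℂ E]
      [TopologicalSpace E] [AddCommGroup F] [Module ℂ F] [TopologicalSpace F]
      [IsTopologicalAddGroup E] [ContinuousSMul ℂ E] [IsTopologicalAddGroup F] [ContinuousSMul ℂ F]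
      (ι : E →ₗ[ℂ] Sch d) (κ : F →ₗ[ℂ] Sch (d + d)) (hE : IsTestSpace h𝒲 ι) (hF : IsTestSpace h𝒲 κ)
      (δ : E → StrongDual ℂ E) (hδ : ∀ f ψ, δ f ψ = ∫ x, ι f x * ι ψ x)
      (ε : F → StrongDual ℂ F) (hε : ∀ f ψ, ε f ψ = ∫ x, κ f x * κ ψ x)
      (hcont : ∀ T : E →ₗ[ℂ] E →ₛₗ[starRingEnd ℂ] F,
        (∀ S S' : Set E, Bornology.IsVonNBounded ℂ S → Bornology.IsVonNBounded ℂ S' →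
          Bornology.IsVonNBounded ℂ (Set.image2 (fun f φ => T f φ) S S')) →
        Continuous fun p : E × E => T p.1 p.2),
      ∃ Ts : E × E → F, (∀ f φ, κ (Ts (f, φ)) = bornJordanS (ι f) (ι φ)) ∧ Continuous Ts ∧
        (∃! B : StrongDual ℂ E × StrongDual ℂ E → StrongDual ℂ F,
          Continuous B ∧ ∀ f φ, B (δ f, δ φ) = ε (Ts (f, φ))) ∧
        ∃! B : StrongDual ℂ (Sch d) × StrongDual ℂ (Sch d) → StrongDual ℂ (Sch (d + d)),
          Continuous B ∧ ∀ f φ, B (schDist (ι f), schDist (ι φ)) = schDist (κ (Ts (f, φ))) := by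
    intro 𝒲 h𝒲 E F _ _ _ _ _ _ _ _ _ _ ι κ hE hF δ hδ ε hε hcont
    obtain ⟨T, hT, hTb⟩ := hE.exists_bornJordan hF
    refine ⟨fun p => T p.1 p.2, hT, hcont T hTb, ?_, ?_⟩
    · exact existsUnique_extension hE hF h𝒲 subset_rfl (fun f hf => hE.exists_eq hf) hδ
        fun f φ ψ => by rw [hε, hT]
    -- Here the functionals live on 𝒮, while the approximating test functions come from the smaller
    -- class 𝒲.
    · exact existsUnique_extension isTestSpace_sch isTestSpace_sch h𝒲 (Set.subset_univ _)
        (fun f hf => hE.exists_eq hf) (fun f ψ => schDist_apply _ _)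
        fun f φ ψ => by rw [schDist_apply, hT]; rfl
  refine ⟨fun f φ x ξ => ⟨integrable_wignerIntegrand f φ x ξ, intervalIntegrable_wigner f φ x ξ⟩,
    fun p => bornJordanS p.1 p.2, bornJordanS_apply, ?_, ?_, fun hs' => ?_⟩
  · obtain ⟨T, hT, hTb⟩ := (isTestSpace_sch (n := d)).exists_bornJordan isTestSpace_sch
    exact (continuous₂_of_bounded T hTb).congr fun p => hT p.1 p.2
  · exact key (weightClass_rouWeights hs) Rou.toSch Rou.toSch (isTestSpace_rou hs)
      (isTestSpace_rou hs) rouDist rouDist_apply rouDist rouDist_apply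
      Rou.continuous₂_of_bounded
  · exact key (weightClass_beuWeights hs') Beu.toSch Beu.toSch (isTestSpace_beu hs')
      (isTestSpace_beu hs') beuDist beuDist_apply beuDist beuDist_apply
      continuous₂_of_bounded
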